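/- **Wong's equations.** Let $G$ be a connected Lie group acting smoothly, freely and properly on the left on a smooth manifold $M$ by isometries of a Riemannian metric $g$, and suppose that the vertical part of $g$ comes from a bi-invariant Riemannian metric $k$ on $G$: for each $m\in M$ the pull-back of $g$ by the orbit map $G\to M$, $h\mapsto h\cdot m$, is $k$. Let $E_1,\dots,E_d$ be a basis of the Lie algebra $\mathfrak g$, $[E_a,E_b]=C^c_{ab}E_c$, and let $\tilde E_a$ be the corresponding fundamental vector fields. Let $\Psi$ be a $G$-equivariant local trivialization of $M\to M/G$ over the domain $U$ of a chart $(x^i)$ of $M/G$, so that the part of $M$ over $U$ is identified with $U\times G$, with $a\cdot(x,h)=(x,ah)$. Put: - $\hat E_a(x,h)=\widetilde{(\mathrm{ad}_hE_a)}(x,h)=\mathcal A_a^b(h)\tilde E_b(x,h)$, where $\mathrm{ad}_hE_a=\mathcal A_a^b(h)E_b$ is the adjoint action, and $(\bar{\mathcal A}^b_a)$ for the inverse matrix of $(\mathcal A^b_a)$; - $X_i$ for the component of $\partial/\partial x^i$ that is $g$-orthogonal to the orbits (the horizontal lift for the mechanical connection), $[X_i,X_j]=R^a_{ij}\tilde E_a$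 and $K^a_{ij}=\bar{\mathcal A}^a_bR^b_{ij}$; - $g_{ij}=g(X_i,X_j)$, $h_{ab}=g(\hat E_a,\hat E_b)$, $X_i=\partial/\partial x^i-\gamma_i^a\hat E_a$ and $\gamma^b_{ia}=\gamma^c_iC^b_{ac}$. Write a tangent vector as $u=v^iX_i+v^a\tilde E_a=v^iX_i+w^a\hat E_a$. For a vector field $Z$ on $M$ let $Z^{\mathsf C},Z^{\mathsf V}$ be its complete and vertical lifts to $TM$. Let $L(u)=\frac12g(u,u)$, let $p_a=\tilde E_a^{\mathsf V}(L)$ be the momentum, let $\mathcal R=L-v^ap_a$ be the Routhian and $\mathcal R^\mu$ its restriction to the level set $N_\mu=\{p_a=\mu_a\}$, and let $\bar X_i^{\mathsf C}$, $\bar X_i^{\mathsf V}$ be the vector fields obtained from $X_i^{\mathsf C}$, $X_i^{\mathsf V}$ by adding the unique combination of the $\tilde E_a^{\mathsf V}$ that makes them tangent to all the level sets $N_\mu$. Then the following hold over $U$. 1. The functions $g_{ij}$, $\gamma^a_i$ and $K^a_{ij}$ depend only on $x$, and the $h_{ab}$ are constant. Let $\Gamma^i_{jk}$ be the Christoffel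 symbols of the reduced metric $g_{ij}(x)$. 2. For a second-order differential equation field $\Gamma$ on $TM$, and at each point of $TM$ over $U$, the following are equivalent: - the Euler–Lagrange equations of $L$, that is, $\Gamma(Z^{\mathsf V}(L))-Z^{\mathsf C}(L)=0$ for all smooth local vector fields $Z$ on $M$ (so that $\Gamma$ is the geodesic field); - conservation of momentum $\Gamma(p_a)=0$ together with the generalized Routh equations $\Gamma(\bar X_i^{\mathsf V}(\mathcal R^\mu))-\bar X_i^{\mathsf C}(\mathcal R^\mu)=-\mu_aR^a_{ij}v^j$, where $N_\mu$ is the level set through the point; - Wong's equations $\Gamma(v^i)+\Gamma^i_{jk}v^jv^k=g^{im}h_{bc}K^c_{lm}v^lw^b$ and $\Gamma(w^a)+\gamma^a_{jb}v^jw^b=0$. 3. Let $\Gamma$ be the geodesic field of $g$, and let $c$ be a differentiable curve in $M$ over $U$, defined on an open set of times. Then $t\mapsto\dot c(t)$ is an integral curve of $\Gamma$ if and only if $x^i(t)=x^i(c(t))$ and $w^a(t)=w^a(\dot c(t))$ satisfy Wong's equations $$\ddot x^i+\Gamma^i_{jk}\dot x^j\dot x^k=g^{im}h_{bc}K^c_{lm}\dot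 x^lw^b,\qquad \dot w^a+\gamma^a_{jb}\dot x^jw^b=0$$ (including that $x$ is twice and $w$ once differentiable). -/

import Mathlib

open Bundle Set
open scoped Manifold ContDiff Matrix

noncomputable section

namespace Routh

/-! ### Vector fields on a manifold and on its tangent manifold -/

section Lifts

variable {E : Type*} [NormedAddCommGroup E] [NormedSpace ℝ E]
  {M : Type*} [TopologicalSpace M] [ChartedSpace E M] [IsManifold 𝓘(ℝ, E) ∞ M]

variable (E M) in
/-- Vector fields (not necessarily smooth) on `M`. -/
abbrev VField := Π m : M, TangentSpace 𝓘(ℝ, E) m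

variable (E M) in
/-- The tangent manifold `TM`. -/
abbrev TM := TangentBundle 𝓘(ℝ, E) M

variable (E M) in
/-- Vector fields (not necessarily smooth) on the tangent manifold `TM`. -/
abbrev TMField := Π p : TM E M, TangentSpace 𝓘(ℝ, E).tangent p

variable (E M) in
/-- Smooth Riemannian metrics on `M`. -/
abbrev Metric := ContMDiffRiemannianMetric 𝓘(ℝ, E) ∞ E (fun m : M => TangentSpace 𝓘(ℝ, E) m)

/-- The point `(m, u)` of `TM`. -/
abbrev pt (m : M) (u : TangentSpace 𝓘(ℝ, E) m) : TM E M := ⟨m, u⟩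

/-- The derivative `W(F)` of a function `F` on `TM` along a vector field `W` on `TM`. -/
def along (W : TMField E M) (F : TM E M → ℝ) (p : TM E M) : ℝ :=
  mfderiv 𝓘(ℝ, E).tangent 𝓘(ℝ, ℝ) F p (W p)

/-- The vertical lift `Zⱽ`: its value at `(m, u)` is the velocity at `s = 0` of
`s ↦ (m, u + s Z(m))`. -/
def vlift (Z : VField E M) : TMField E M := fun p =>
  (mfderiv 𝓘(ℝ, ℝ) 𝓘(ℝ, E).tangent (fun s : ℝ => pt p.1 (p.2 + s • Z p.1)) 0 (1 : ℝ) : E × E)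

/-- The complete lift `Zᶜ`. In the bundle chart of `TM` at `p = (m, u)` given by the preferred chart
of `M` at `m`, through which Mathlib identifies `T_p TM` with `E × E`, it is
`Z^α ∂/∂x^α + u^β (∂Z^α/∂x^β) ∂/∂u^α`; the fibre component is the fibre component of the tangent
map of the section `Z : M → TM` at `u`. -/
def clift (Z : VField E M) : TMField E M := fun p =>
  ((Z p.1 : E),
    ((mfderiv 𝓘(ℝ, E) 𝓘(ℝ, E).tangent (fun m : M => pt m (Z m)) p.1 p.2 : E × E)).2)

/-- `Γ` is a second-order differential equation field: `Tτ(Γ(p)) = p` for `τ : TM → M`. -/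
def IsSecondOrder (Γ : TMField E M) : Prop :=
  ∀ p : TM E M, mfderiv 𝓘(ℝ, E).tangent 𝓘(ℝ, E) (fun q : TM E M => q.1) p (Γ p) = p.2

/-- The Euler-Lagrange equations `Γ(Zⱽ(L)) - Zᶜ(L) = 0` at the point `p` of `TM`, for all smooth
local vector fields `Z` on `M`. -/
def EulerLagrangeAt (L : TM E M → ℝ) (Γ : TMField E M) (p : TM E M) : Prop :=
  ∀ Z : VField E M, ContMDiffAt 𝓘(ℝ, E) 𝓘(ℝ, E).tangent ∞ (fun m : M => pt m (Z m)) p.1 →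
    along Γ (along (vlift Z) L) p - along (clift Z) L p = 0

/-- The Lagrangian `L(m, u) = ½ g(u, u)` of a Riemannian metric. -/
def kinetic (g : Metric E M) (p : TM E M) : ℝ := 1 / 2 * g.inner p.1 p.2 p.2

/-- `Γ` is the geodesic field of `g`: the second-order field satisfying the Euler-Lagrange
equations of `½ g(u, u)`. -/
def IsGeodesicField (g : Metric E M) (Γ : TMField E M) : Prop :=
  IsSecondOrder Γ ∧ ∀ p, EulerLagrangeAt (kinetic g) Γ p

/-- The velocity `t ↦ (c(t), ċ(t))` of a curve in `M`. -/
def velocity (c : ℝ → M) (t : ℝ) : TM E M :=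
  pt (c t) (mfderiv 𝓘(ℝ, ℝ) 𝓘(ℝ, E) c t (1 : ℝ))

end Lifts

/-! ### The group action, the mechanical connection and the adapted frames -/

section Action

variable {E E' : Type*} [NormedAddCommGroup E] [NormedSpace ℝ E]
  [NormedAddCommGroup E'] [NormedSpace ℝ E']
  {M : Type*} [TopologicalSpace M] [ChartedSpace E M] [IsManifold 𝓘(ℝ, E) ∞ M]
  {G : Type*} [TopologicalSpace G] [ChartedSpace E' G] [Group G] [MulAction G M]
  {n d : ℕ}

/-- The fundamental vector field of `ξ ∈ 𝔤`: at `m`, the derivative of `g ↦ g • m` at the identity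
in the direction `ξ`. -/
def fundamental (ξ : GroupLieAlgebra 𝓘(ℝ, E') G) : VField E M := fun m =>
  -- `(1 : G) • m` is propositionally, not definitionally, equal to `m`
  (mfderiv 𝓘(ℝ, E') 𝓘(ℝ, E) (fun h : G => h • m) 1 ξ : E)

/-- `G` acts on `M` by isometries of `g`. -/
def IsInvariantMetric (G : Type*) [Group G] [MulAction G M] (g : Metric E M) : Prop :=
  ∀ (a : G) (m : M) (u v : TangentSpace 𝓘(ℝ, E) m),
    g.inner (a • m) (mfderiv 𝓘(ℝ, E) 𝓘(ℝ, E) (fun y : M => a • y) m u)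
      (mfderiv 𝓘(ℝ, E) 𝓘(ℝ, E) (fun y : M => a • y) m v) = g.inner m u v

/-- `k` is a bi-invariant metric on `G`. -/
def IsBiInvariant [IsManifold 𝓘(ℝ, E') ∞ G] (k : Metric E' G) : Prop :=
  (∀ (a h : G) (u v : TangentSpace 𝓘(ℝ, E') h),
    k.inner (a * h) (mfderiv 𝓘(ℝ, E') 𝓘(ℝ, E') (fun y : G => a * y) h u)
      (mfderiv 𝓘(ℝ, E') 𝓘(ℝ, E') (fun y : G => a * y) h v) = k.inner h u v) ∧
  (∀ (a h : G) (u v : TangentSpace 𝓘(ℝ, E') h),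
    k.inner (h * a) (mfderiv 𝓘(ℝ, E') 𝓘(ℝ, E') (fun y : G => y * a) h u)
      (mfderiv 𝓘(ℝ, E') 𝓘(ℝ, E') (fun y : G => y * a) h v) = k.inner h u v)

/-- The restriction of `g` to the orbits comes from the metric `k` on `G`: the pull-back of `g`
by every orbit map `h ↦ h • m` is `k`. -/
def VerticalPartFrom [IsManifold 𝓘(ℝ, E') ∞ G] (g : Metric E M) (k : Metric E' G) : Prop :=
  ∀ (m : M) (h : G) (u v : TangentSpace 𝓘(ℝ, E') h),
    g.inner (h • m) (mfderiv 𝓘(ℝ, E') 𝓘(ℝ, E) (fun y : G => y • m) h u)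
      (mfderiv 𝓘(ℝ, E') 𝓘(ℝ, E) (fun y : G => y • m) h v) = k.inner h u v

variable (E E' M G n) in
/-- A local trivialization of `M → M/G` over the domain of a coordinate chart `(x¹, …, xⁿ)` of
`M/G`: a diffeomorphism `Ψ` from `base × G`, with `base` open in `ℝⁿ`, onto an open subset of `M`
(the part of `M` over the chart domain), equivariant for `a • (x, h) = (x, a h)`. -/
structure LocalTrivialization where
  /-- The image of the coordinate chart. -/
  base : Set (Fin n → ℝ)
  /-- The trivialization `(x, h) ↦ Ψ(x, h)`. -/
  map : OpenPartialHomeomorph ((Fin n → ℝ) × G) M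
  isOpen_base : IsOpen base
  source_eq : map.source = base ×ˢ univ
  contMDiffOn_map :
    ContMDiffOn (𝓘(ℝ, Fin n → ℝ).prod 𝓘(ℝ, E')) 𝓘(ℝ, E) ∞ map map.source
  contMDiffOn_symm :
    ContMDiffOn 𝓘(ℝ, E) (𝓘(ℝ, Fin n → ℝ).prod 𝓘(ℝ, E')) ∞ map.symm map.target
  equivariant : ∀ x ∈ base, ∀ a h : G, map (x, a * h) = a • map (x, h)

/-- The part of `M` over the chart domain. -/
abbrev LocalTrivialization.dom (Ψ : LocalTrivialization E E' M G n) : Set M := Ψ.map.target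

/-- The coordinates `xⁱ`, as functions on `M`. -/
def LocalTrivialization.coord (Ψ : LocalTrivialization E E' M G n) (m : M) : Fin n → ℝ :=
  (Ψ.map.symm m).1

/-- The `G`-component of a point of `M`. -/
def LocalTrivialization.fib (Ψ : LocalTrivialization E E' M G n) (m : M) : G :=
  (Ψ.map.symm m).2

/-- The section `x ↦ Ψ(x, e)`. -/
def LocalTrivialization.sec (Ψ : LocalTrivialization E E' M G n) (x : Fin n → ℝ) : M :=
  Ψ.map (x, 1)

/-- The coordinate vector field `∂/∂xⁱ` on `M` given by the trivialization. -/
def LocalTrivialization.partialX (Ψ : LocalTrivialization E E' M G n) (i : Fin n) :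
    VField E M := fun m =>
  (mfderiv 𝓘(ℝ, Fin n → ℝ) 𝓘(ℝ, E) (fun x => Ψ.map (x, Ψ.fib m)) (Ψ.coord m)
    (Pi.single i (1 : ℝ) : Fin n → ℝ) : E)

variable (b : Module.Basis (Fin d) ℝ (GroupLieAlgebra 𝓘(ℝ, E') G))
  (g : Metric E M) (Ψ : LocalTrivialization E E' M G n)

/-- The fundamental vector fields `Ẽ_a` of the basis elements. -/
def tildeE (a : Fin d) : VField E M := fundamental (b a)

/-- The structure constants: `[E_a, E_b] = C_{ab}^c E_c`. -/
def structConst (a a' c : Fin d) : ℝ := b.repr ⁅b a, b a'⁆ c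

/-- The adjoint action of `h ∈ G` on `𝔤`. -/
def Ad (h : G) : GroupLieAlgebra 𝓘(ℝ, E') G → GroupLieAlgebra 𝓘(ℝ, E') G := fun ξ =>
  (mfderiv 𝓘(ℝ, E') 𝓘(ℝ, E') (fun y : G => h * y * h⁻¹) 1 ξ : E')

/-- The matrix of `Ad h` in the basis; the entry in row `c` and column `a` is `𝒜_a^c(h)`. -/
def AdMatrix (h : G) : Matrix (Fin d) (Fin d) ℝ := fun c a => b.repr (Ad h (b a)) c

/-- The invariant vector fields `Ê_a`: at `Ψ(x, h)`, the value of the fundamental vector field of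
`Ad h E_a`. -/
def hatE (a : Fin d) : VField E M := fun m => fundamental (Ad (Ψ.fib m) (b a)) m

/-- The components `g_{ab} = g(Ẽ_a, Ẽ_b)`. -/
def vertGram (m : M) : Matrix (Fin d) (Fin d) ℝ := fun a a' =>
  g.inner m (tildeE b a m) (tildeE b a' m)

/-- The components `ω^a(u)` of the mechanical connection, i.e. of the `g`-orthogonal projection
`u ↦ ω^a(u) Ẽ_a` onto the tangent space of the orbit. -/
def conn (m : M) (u : TangentSpace 𝓘(ℝ, E) m) : Fin d → ℝ :=
  (vertGram b g m)⁻¹ *ᵥ (fun a => g.inner m u (tildeE b a m))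

/-- The horizontal lifts `X_i` of the coordinate fields: the horizontal parts of `∂/∂xⁱ`. -/
def frameX (i : Fin n) : VField E M := fun m =>
  Ψ.partialX i m - ∑ a, conn b g m (Ψ.partialX i m) a • tildeE b a m

/-- The curvature components: `[X_i, X_j] = R^a_{ij} Ẽ_a`. -/
def curv (i j : Fin n) (m : M) : Fin d → ℝ :=
  conn b g m (VectorField.mlieBracket 𝓘(ℝ, E) (frameX b g Ψ i) (frameX b g Ψ j) m)

/-- The quasi-velocities `vⁱ`. -/
def velV (i : Fin n) (p : TM E M) : ℝ :=
  (mfderiv 𝓘(ℝ, E) 𝓘(ℝ, Fin n → ℝ) Ψ.coord p.1 p.2 : Fin n → ℝ) i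

/-- The quasi-velocities `v^a` relative to the `Ẽ_a`. -/
def velA (a : Fin d) (p : TM E M) : ℝ := conn b g p.1 p.2 a

/-- The quasi-velocities `w^a` relative to the `Ê_a`, `v^a = 𝒜^a_b w^b`. -/
def velW (a : Fin d) (p : TM E M) : ℝ :=
  ((AdMatrix b (Ψ.fib p.1))⁻¹ *ᵥ (fun a' => velA b g a' p)) a

/-! ### The Routhian and the generalized Routh equations -/

/-- The momentum `p_a = Ẽ_aⱽ(L)`. -/
def momentum (L : TM E M → ℝ) (a : Fin d) : TM E M → ℝ := along (vlift (tildeE b a)) L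

/-- The Hessian components `g_{ab} = Ẽ_aⱽ(p_b)`. -/
def hessVert (L : TM E M → ℝ) (p : TM E M) : Matrix (Fin d) (Fin d) ℝ := fun a a' =>
  along (vlift (tildeE b a)) (momentum b L a') p

/-- The correction `W + A^b Ẽ_bⱽ` of a field `W` on `TM` which is tangent to all level sets of
momentum, that is, with `W(p_a) + A^b g_{ba} = 0`. -/
def tangentPart (L : TM E M → ℝ) (W : TMField E M) : TMField E M := fun p =>
  W p + ∑ a, (-((hessVert b L p)⁻¹ *ᵥ (fun a' => along W (momentum b L a') p)) a) •
    vlift (tildeE b a) p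

/-- The Routhian `ℛ = L - v^a p_a`. -/
def routhian (L : TM E M → ℝ) (p : TM E M) : ℝ :=
  L p - ∑ a, velA b g a p * momentum b L a p

/-- The generalized Routh equations at `p`, for the level set `N_μ = {p_a = μ_a}`:
`Γ(X̄_iⱽ(ℛ)) - X̄_iᶜ(ℛ) = - μ_a R^a_{ij} v^j`. (As `X̄_iⱽ`, `X̄_iᶜ` are tangent to the level sets of
momentum, and so is `Γ` when it conserves momentum, these are derivatives of the restriction of
`ℛ` to `N_μ`.) -/
def RouthAt (L : TM E M → ℝ) (Γ : TMField E M) (μ : Fin d → ℝ) (p : TM E M) : Prop :=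
  ∀ i : Fin n,
    along Γ (along (tangentPart b L (vlift (frameX b g Ψ i))) (routhian b g L)) p
      - along (tangentPart b L (clift (frameX b g Ψ i))) (routhian b g L) p
    = - ∑ a, ∑ j, μ a * curv b g Ψ i j p.1 a * velV Ψ j p

/-! ### The coefficients of Wong's equations, as functions of `x`

Invariant functions on `M` are evaluated on the section `x ↦ Ψ(x, e)`. -/

/-- The reduced metric `g_{ij} = g(X_i, X_j)`. -/
def redMetric (x : Fin n → ℝ) : Matrix (Fin n) (Fin n) ℝ := fun i j =>
  g.inner (Ψ.sec x) (frameX b g Ψ i (Ψ.sec x)) (frameX b g Ψ j (Ψ.sec x))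

/-- `∂g_{ij}/∂x^l`. -/
def dRedMetric (l i j : Fin n) (x : Fin n → ℝ) : ℝ :=
  fderiv ℝ (fun y => redMetric b g Ψ y i j) x (Pi.single l (1 : ℝ))

/-- The Christoffel symbols `Γ^i_{jk}` of the reduced metric. -/
def christoffel (i j k : Fin n) (x : Fin n → ℝ) : ℝ :=
  1 / 2 * ∑ l, (redMetric b g Ψ x)⁻¹ i l *
    (dRedMetric b g Ψ j l k x + dRedMetric b g Ψ k l j x - dRedMetric b g Ψ l j k x)

/-- The components `h_{ab} = g(Ê_a, Ê_b)`. -/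
def hMetric (x : Fin n → ℝ) : Matrix (Fin d) (Fin d) ℝ := fun a a' =>
  g.inner (Ψ.sec x) (hatE b Ψ a (Ψ.sec x)) (hatE b Ψ a' (Ψ.sec x))

/-- `K^a_{ij} = 𝒜̄^a_b R^b_{ij}`, where `𝒜̄` is the inverse matrix of `𝒜`, on `M`. -/
def curvK (i j : Fin n) (m : M) : Fin d → ℝ :=
  (AdMatrix b (Ψ.fib m))⁻¹ *ᵥ curv b g Ψ i j m

/-- `K^a_{ij}` as a function of `x`. -/
def redK (a : Fin d) (i j : Fin n) (x : Fin n → ℝ) : ℝ := curvK b g Ψ i j (Ψ.sec x) a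

/-- The coefficients in `X_i = ∂/∂xⁱ - γ_i^a Ê_a`. -/
def connCoeff (a : Fin d) (i : Fin n) (x : Fin n → ℝ) : ℝ :=
  ((AdMatrix b (Ψ.fib (Ψ.sec x)))⁻¹ *ᵥ conn b g (Ψ.sec x) (Ψ.partialX i (Ψ.sec x))) a

/-- `γ^a_{ic} = γ_i^e C_{ce}^a`. -/
def redGamma (a : Fin d) (i : Fin n) (c : Fin d) (x : Fin n → ℝ) : ℝ :=
  ∑ e, connCoeff b g Ψ e i x * structConst b c e a

/-- Wong's equations for a second-order field `Γ`, at the point `p` of `TM`: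
`Γ(vⁱ) + Γ^i_{jk} v^j v^k = g^{im} h_{bc} K^c_{lm} v^l w^b` and `Γ(w^a) + γ^a_{jb} v^j w^b = 0`. -/
def WongAt (Γ : TMField E M) (p : TM E M) : Prop :=
  (∀ i, along Γ (velV Ψ i) p
      + ∑ j, ∑ k, christoffel b g Ψ i j k (Ψ.coord p.1) * velV Ψ j p * velV Ψ k p
    = ∑ m, ∑ a, ∑ c, ∑ l, (redMetric b g Ψ (Ψ.coord p.1))⁻¹ i m * hMetric b g Ψ (Ψ.coord p.1) a c *
        redK b g Ψ c l m (Ψ.coord p.1) * velV Ψ l p * velW b g Ψ a p) ∧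
  (∀ a, along Γ (velW b g Ψ a) p
      + ∑ j, ∑ c, redGamma b g Ψ a j c (Ψ.coord p.1) * velV Ψ j p * velW b g Ψ c p = 0)

/-- Wong's equations, at time `t`, for a curve `s ↦ (x(s), w(s))`:
`ẍⁱ + Γ^i_{jk} ẋ^j ẋ^k = g^{im} h_{bc} K^c_{lm} ẋ^l w^b` and `ẇ^a + γ^a_{jb} ẋ^j w^b = 0`. -/
def WongCurveAt (x : ℝ → Fin n → ℝ) (w : ℝ → Fin d → ℝ) (t : ℝ) : Prop :=
  DifferentiableAt ℝ x t ∧ DifferentiableAt ℝ (deriv x) t ∧ DifferentiableAt ℝ w t ∧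
  (∀ i, deriv (deriv x) t i
      + ∑ j, ∑ k, christoffel b g Ψ i j k (x t) * deriv x t j * deriv x t k
    = ∑ m, ∑ a, ∑ c, ∑ l, (redMetric b g Ψ (x t))⁻¹ i m * hMetric b g Ψ (x t) a c *
        redK b g Ψ c l m (x t) * deriv x t l * w t a) ∧
  (∀ a, deriv w t a + ∑ j, ∑ c, redGamma b g Ψ a j c (x t) * deriv x t j * w t c = 0)

end Action

end Routh

end

/-! For a second-order field the Euler–Lagrange expression `Γ(Zⱽ(L)) - Zᶜ(L)` is linear over
functions on `M` in the argument `Z` (`eulerLagrange_sum_smul`): the derivatives of the coefficients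
cancel. It is therefore enough to test it on the frame formed by the horizontal fields `X_i` and the
fundamental fields `Ẽ_a`.

To differentiate along `Zᶜ` at a velocity `u`, extend `u` to a field `W`; then `Zᶜ` at `u` is the
tangent map of `W` applied to `Z`, minus the vertical lift of `[Z, W]` (`clift_eq`). The extension
is chosen to simplify the bracket. Fundamental fields commute with invariant fields
(`mlieBracket_fundamental_eq_zero`). Hence for `Z = Ẽ_a` one takes constant coefficients in the
invariant frame `X_i, Ê_a`, and finds `Ẽ_aᶜ(L) = 0`: this equation is conservation of momentum. For
`Z = X_i` one takes constant coefficients in `X_i, Ẽ_a`; only the curvature survives, and `X_iᶜ(L) =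
½ (∂g_{jl}/∂xⁱ) v^j v^l - v^j R^a_{ij} p_a` (`along_clift_frameX_kinetic`). The inverse reduced
metric turns the first term into Christoffel symbols, and Ad-invariance of `k` rewrites the second
through `h`, `K` and `w`.

Since the vertical metric comes from `k`, the matrix `g(Ẽ_a, Ẽ_b)` is constant. So the momenta are
conserved exactly when the `v^a` are. Write `v^a = 𝒜^a_b w^b`: the derivative of `𝒜` is given by the
structure constants (`structConst_eq`), its part quadratic in `w` cancels by antisymmetry, and what
remains is the covariant derivative of `w` (`mvfderiv_velA_eq_wongW`).

For the same reason `v^a p_a` is a quadratic form in `p` with constant coefficients, and the field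
tangent to the level sets satisfies `W̄(ℛ) = W(L) - v^a W(p_a)` (`along_tangentPart`). In the Routh
equations the curvature terms on the two sides then cancel, leaving the Euler–Lagrange equations of
the `X_i` (`routhAt_iff`).

For curves, a vector tangent to `TM` is determined by its projection and the derivatives of `v` and
`w` (`tangent_tangent_ext`). The geodesic field satisfies Wong's equations pointwise, so a curve
solves them exactly when its lifted velocity is the value of that field. -/

open Bundle Set
open scoped Manifold ContDiff Matrix

noncomputable section

namespace Routh

/-! ### Tangent vectors to `TM` in the bundle chart, and vertical lifts. -/

section Lifts
variable {E : Type*} [NormedAddCommGroup E] [NormedSpace ℝ E]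
  {M : Type*} [TopologicalSpace M] [ChartedSpace E M] [IsManifold 𝓘(ℝ, E) ∞ M]
  {EN : Type*} [NormedAddCommGroup EN] [NormedSpace ℝ EN] {HN : Type*} [TopologicalSpace HN]
  {IN : ModelWithCorners ℝ EN HN} {N : Type*} [TopologicalSpace N] [ChartedSpace HN N]

/-- The fibre coordinate of a tangent vector in the bundle chart of `TM` at `m`. -/
def fibreCoord (m : M) (q : TM E M) : E :=
  (trivializationAt E (TangentSpace 𝓘(ℝ, E)) m q).2

theorem mdifferentiableAt_tm_iff {γ : N → TM E M} {x : N} :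
    MDifferentiableAt IN 𝓘(ℝ, E).tangent γ x ↔
      MDifferentiableAt IN 𝓘(ℝ, E) (fun y => (γ y).1) x ∧
      MDifferentiableAt IN 𝓘(ℝ, E) (fun y => fibreCoord (γ x).1 (γ y)) x :=
  mdifferentiableAt_totalSpace _ _

/-- The identification of `T_pTM` with `E × E` uses the bundle chart at the base point of `p`
itself, so the second component differentiates the fibre coordinate with this chart held fixed. -/
theorem mfderiv_tm {γ : N → TM E M} {x : N} (h : MDifferentiableAt IN 𝓘(ℝ, E).tangent γ x)
    (v : TangentSpace IN x) :
    (mfderiv IN 𝓘(ℝ, E).tangent γ x v : E × E) =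
      ((mfderiv IN 𝓘(ℝ, E) (fun y => (γ y).1) x v : E),
        mvfderiv IN (fun y => fibreCoord (γ x).1 (γ y)) x v) := by
  have h' := mdifferentiableAt_tm_iff.1 h
  have h1 := h'.1.hasMFDerivAt
  have h2 := h'.2.hasMFDerivAt
  have h3 : HasMFDerivAt IN 𝓘(ℝ, E).tangent γ x
     (ContinuousLinearMap.prod (mfderiv IN 𝓘(ℝ, E) (fun y => (γ y).1) x : EN →L[ℝ] E)
      (mvfderiv IN (fun y => fibreCoord (γ x).1 (γ y)) x : EN →L[ℝ] E) : EN →L[ℝ] E × E) := by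
    refine ⟨h.continuousAt, ?_⟩
    have := h1.2.prodMk h2.2
    exact this
  rw [h3.mfderiv]
  rfl

theorem fibreCoord_pt (m : M) (u : TangentSpace 𝓘(ℝ, E) m) : fibreCoord m (pt m u) = u := by
  have := tangentCoordChange_self (I := 𝓘(ℝ, E)) (x := m) (z := m) (v := u) (mem_extChartAt_source m)
  exact this

theorem fibreCoord_eq_mvfderiv {m y : M} (hy : y ∈ (chartAt E m).source)
    (u : TangentSpace 𝓘(ℝ, E) y) :
    fibreCoord m (pt y u) = mvfderiv 𝓘(ℝ, E) (extChartAt 𝓘(ℝ, E) m) y u := by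
  have h := TangentBundle.continuousLinearMapAt_trivializationAt (I := 𝓘(ℝ, E)) (x₀ := m) (x := y) hy
  have h2 := congrArg (fun A : E →L[ℝ] E => A u) h
  refine Eq.trans ?_ h2
  have := (trivializationAt E (TangentSpace 𝓘(ℝ, E)) m).coe_linearMapAt_of_mem (R := ℝ) (b := y) hy
  exact (congrFun this u).symm

theorem fibreCoord_add (m y : M) (u v : TangentSpace 𝓘(ℝ, E) y) :
    fibreCoord m (pt y (u + v)) = fibreCoord m (pt y u) + fibreCoord m (pt y v) :=
  map_add (fderivWithin ℝ _ _ _ : E →L[ℝ] E) u v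

theorem fibreCoord_smul (m y : M) (c : ℝ) (u : TangentSpace 𝓘(ℝ, E) y) :
    fibreCoord m (pt y (c • u)) = c • fibreCoord m (pt y u) :=
  map_smul (fderivWithin ℝ _ _ _ : E →L[ℝ] E) c u

theorem mfderiv_proj_apply (p : TM E M) (ζ : TangentSpace 𝓘(ℝ, E).tangent p) :
    (mfderiv 𝓘(ℝ, E).tangent 𝓘(ℝ, E) (fun q : TM E M => q.1) p ζ : E) = (ζ : E × E).1 := by
  have := mfderiv_tm (IN := 𝓘(ℝ, E).tangent) (γ := fun q : TM E M => q) (x := p)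
    mdifferentiableAt_id ζ
  rw [show (fun q : TM E M => q) = id from rfl, mfderiv_id] at this
  exact (congrArg Prod.fst this).symm

theorem mdifferentiableAt_add_smul (m : M) (u z : TangentSpace 𝓘(ℝ, E) m) :
    MDifferentiableAt 𝓘(ℝ, ℝ) 𝓘(ℝ, E).tangent (fun s : ℝ => pt m (u + s • z)) 0 := by
  rw [mdifferentiableAt_tm_iff]
  refine ⟨mdifferentiableAt_const, ?_⟩
  simp only [fibreCoord_add, fibreCoord_smul]
  apply DifferentiableAt.mdifferentiableAt
  fun_prop

theorem mvfderiv_add_smul (u z : E) :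
    mvfderiv 𝓘(ℝ, ℝ) (fun s : ℝ => u + s • z) 0 (1 : ℝ) = z := by
  have h2 : HasFDerivAt (fun s : ℝ => u + s • z)
      ((ContinuousLinearMap.id ℝ ℝ).smulRight z) 0 := by
    apply HasFDerivAt.const_add
    exact ((ContinuousLinearMap.id ℝ ℝ).smulRight z).hasFDerivAt
  refine (congrArg (fun A : ℝ →L[ℝ] E => A 1) h2.hasMFDerivAt.mfderiv).trans ?_
  simp

theorem vlift_eq (Z : VField E M) (p : TM E M) : vlift Z p = ((0 : E), (Z p.1 : E)) := by
  refine (mfderiv_tm (mdifferentiableAt_add_smul p.1 p.2 (Z p.1)) (1 : ℝ)).trans ?_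
  refine Prod.ext ?_ ?_
  · simp only [mfderiv_const]; rfl
  · simp only [fibreCoord_pt]
    exact mvfderiv_add_smul (E := E) p.2 (Z p.1)

/-! ### Calculus rules for derivatives of vector-valued functions on manifolds. -/

section Calculus

variable {EN' : Type*} [NormedAddCommGroup EN'] [NormedSpace ℝ EN'] {HN' : Type*}
  [TopologicalSpace HN'] {IN' : ModelWithCorners ℝ EN' HN'} {N' : Type*} [TopologicalSpace N']
  [ChartedSpace HN' N'] {F : Type*} [NormedAddCommGroup F] [NormedSpace ℝ F]

theorem mvfderiv_comp_apply_vec {f : N → N'} {h : N' → F} {x : N}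
    (hh : MDifferentiableAt IN' 𝓘(ℝ, F) h (f x)) (hf : MDifferentiableAt IN IN' f x)
    (v : TangentSpace IN x) :
    mvfderiv IN (fun y => h (f y)) x v = mvfderiv IN' h (f x) (mfderiv IN IN' f x v) :=
  mfderiv_comp_apply x hh hf v

theorem mvfderiv_congr {h h' : N → F} {x : N} (hh : h =ᶠ[nhds x] h') :
    mvfderiv IN h x = mvfderiv IN h' x := by
  have := hh.mfderiv_eq (I := IN) (I' := 𝓘(ℝ, F))
  ext v
  exact congrArg (fun A : EN →L[ℝ] F => A v) this

theorem mvfderiv_mul_apply {f h : N → ℝ} {x : N} (hf : MDifferentiableAt IN 𝓘(ℝ, ℝ) f x)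
    (hh : MDifferentiableAt IN 𝓘(ℝ, ℝ) h x) (v : TangentSpace IN x) :
    mvfderiv IN (fun y => f y * h y) x v
      = mvfderiv IN f x v * h x + f x * mvfderiv IN h x v := by
  have := mvfderiv_mul (I := IN) hf hh
  rw [show (fun y => f y * h y) = f * h from rfl, this]
  simp; ring

theorem mdifferentiableAt_mul {f h : N → ℝ} {x : N} (hf : MDifferentiableAt IN 𝓘(ℝ, ℝ) f x)
    (hh : MDifferentiableAt IN 𝓘(ℝ, ℝ) h x) :
    MDifferentiableAt IN 𝓘(ℝ, ℝ) (fun y => f y * h y) x := hf.mul hh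

theorem mdifferentiableAt_sum {ι : Type*} (t : Finset ι) {f : ι → N → F} {x : N}
    (hf : ∀ i ∈ t, MDifferentiableAt IN 𝓘(ℝ, F) (f i) x) :
    MDifferentiableAt IN 𝓘(ℝ, F) (fun y => ∑ i ∈ t, f i y) x := by
  classical
  induction t using Finset.induction_on with
  | empty => simpa using mdifferentiableAt_const
  | insert a s ha ih =>
    simp only [Finset.sum_insert ha]
    exact (hf a (by simp)).add (ih fun i hi => hf i (by simp [hi]))

theorem mvfderiv_sum_apply {ι : Type*} (t : Finset ι) {f : ι → N → F} {x : N}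
    (hf : ∀ i ∈ t, MDifferentiableAt IN 𝓘(ℝ, F) (f i) x) (v : TangentSpace IN x) :
    mvfderiv IN (fun y => ∑ i ∈ t, f i y) x v = ∑ i ∈ t, mvfderiv IN (f i) x v := by
  classical
  induction t using Finset.induction_on with
  | empty => simp [mvfderiv_const]
  | insert a s ha ih =>
    simp only [Finset.sum_insert ha]
    rw [← ih fun i hi => hf i (by simp [hi])]
    have := mvfderiv_add (I := IN) (hf a (by simp))
      (mdifferentiableAt_sum s fun i hi => hf i (by simp [hi]))
    exact congrArg (fun A : TangentSpace IN x →L[ℝ] F => A v) this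

theorem mvfderiv_const_mul_apply (c : ℝ) {f : N → ℝ} {x : N}
    (hf : MDifferentiableAt IN 𝓘(ℝ, ℝ) f x) (v : TangentSpace IN x) :
    mvfderiv IN (fun y => c * f y) x v = c * mvfderiv IN f x v := by
  rw [mvfderiv_mul_apply mdifferentiableAt_const hf, mvfderiv_const]; simp

theorem mvfderiv_sub_apply {f h : N → F} {x : N} (hf : MDifferentiableAt IN 𝓘(ℝ, F) f x)
    (hh : MDifferentiableAt IN 𝓘(ℝ, F) h x) (v : TangentSpace IN x) :
    mvfderiv IN (fun y => f y - h y) x v = mvfderiv IN f x v - mvfderiv IN h x v :=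
  congrArg (fun A : TangentSpace IN x →L[ℝ] F => A v) (mvfderiv_sub (I := IN) hf hh)

theorem mvfderiv_add_apply {f h : N → F} {x : N} (hf : MDifferentiableAt IN 𝓘(ℝ, F) f x)
    (hh : MDifferentiableAt IN 𝓘(ℝ, F) h x) (v : TangentSpace IN x) :
    mvfderiv IN (fun y => f y + h y) x v = mvfderiv IN f x v + mvfderiv IN h x v :=
  congrArg (fun A : TangentSpace IN x →L[ℝ] F => A v) (mvfderiv_add (I := IN) hf hh)

end Calculus

theorem along_vlift_eq_deriv {F : TM E M → ℝ} {p : TM E M}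
    (hF : MDifferentiableAt 𝓘(ℝ, E).tangent 𝓘(ℝ, ℝ) F p) (Z : VField E M) :
    along (vlift Z) F p = deriv (fun s : ℝ => F (pt p.1 (p.2 + s • Z p.1))) 0 := by
  have hp : pt p.1 (p.2 + (0 : ℝ) • Z p.1) = p := by simp
  have := mfderiv_comp_apply_of_eq (I := 𝓘(ℝ, ℝ)) (I' := 𝓘(ℝ, E).tangent) (I'' := 𝓘(ℝ, ℝ))
    (f := fun s : ℝ => pt p.1 (p.2 + s • Z p.1)) (g := F)
    (x := (0 : ℝ)) hF (mdifferentiableAt_add_smul p.1 p.2 (Z p.1)) hp (1 : ℝ)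
  refine Eq.trans this.symm ?_
  rw [mfderiv_eq_fderiv]
  exact fderiv_apply_one_eq_deriv (𝕜 := ℝ)

end Lifts

/-! ### Lie brackets in the preferred chart, and complete lifts. -/

section Lifts
variable {E : Type*} [NormedAddCommGroup E] [NormedSpace ℝ E]
  {M : Type*} [TopologicalSpace M] [ChartedSpace E M] [IsManifold 𝓘(ℝ, E) ∞ M]
  {EN : Type*} [NormedAddCommGroup EN] [NormedSpace ℝ EN] {HN : Type*} [TopologicalSpace HN]
  {IN : ModelWithCorners ℝ EN HN} {N : Type*} [TopologicalSpace N] [ChartedSpace HN N]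
  {F : Type*} [NormedAddCommGroup F] [NormedSpace ℝ F]

/-- Smoothness of a vector field at a point. -/
abbrev SmoothAt (Z : VField E M) (m : M) : Prop :=
  ContMDiffAt 𝓘(ℝ, E) 𝓘(ℝ, E).tangent ∞ (fun y : M => pt y (Z y)) m

theorem SmoothAt.mdiff {Z : VField E M} {m : M} (h : SmoothAt Z m) :
    MDifferentiableAt 𝓘(ℝ, E) 𝓘(ℝ, E).tangent (fun y : M => pt y (Z y)) m :=
  h.mdifferentiableAt (by simp)

/-- The bracket is defined by pulling fields back to the model space; this matches the pulled-back
field with the fibre coordinate through which `TM` is differentiated. -/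
theorem mpullback_extChartAt_symm (W : VField E M) {m : M} {z : E}
    (hz : z ∈ (extChartAt 𝓘(ℝ, E) m).target) :
    (VectorField.mpullbackWithin 𝓘(ℝ, E) 𝓘(ℝ, E) (extChartAt 𝓘(ℝ, E) m).symm W
      (range 𝓘(ℝ, E)) z : E) =
      fibreCoord m (pt ((extChartAt 𝓘(ℝ, E) m).symm z) (W ((extChartAt 𝓘(ℝ, E) m).symm z))) := by
  have hy : (extChartAt 𝓘(ℝ, E) m).symm z ∈ (chartAt E m).source := by
    rw [← extChartAt_source 𝓘(ℝ, E)]; exact (extChartAt 𝓘(ℝ, E) m).map_target hz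
  rw [fibreCoord_eq_mvfderiv hy, VectorField.mpullbackWithin_apply]
  have h1 := mfderiv_extChartAt_comp_mfderivWithin_extChartAt_symm (I := 𝓘(ℝ, E)) hz
  have h2 := mfderivWithin_extChartAt_symm_comp_mfderiv_extChartAt (I := 𝓘(ℝ, E)) hz
  rw [ContinuousLinearMap.inverse_eq h2 h1]
  rfl

theorem mvfderiv_eq_fderiv_chart {h : M → F} {m : M}
    (hh : MDifferentiableAt 𝓘(ℝ, E) 𝓘(ℝ, F) h m) (v : TangentSpace 𝓘(ℝ, E) m) :
    mvfderiv 𝓘(ℝ, E) h m v =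
      fderiv ℝ (fun z : E => h ((extChartAt 𝓘(ℝ, E) m).symm z)) (extChartAt 𝓘(ℝ, E) m m) v := by
  let A : E →L[ℝ] F := mvfderiv 𝓘(ℝ, E) h m
  have h1 : HasFDerivWithinAt (fun z : E => h ((extChartAt 𝓘(ℝ, E) m).symm z)) A
    (range 𝓘(ℝ, E)) (extChartAt 𝓘(ℝ, E) m m) := hh.hasMFDerivAt.2
  exact congrArg (fun A : E →L[ℝ] F => A v) (h1.hasFDerivAt (by simp)).fderiv.symm

theorem mlieBracket_eq {Z W : VField E M} {m : M}
    (hZ : MDifferentiableAt 𝓘(ℝ, E) 𝓘(ℝ, E).tangent (fun y : M => pt y (Z y)) m)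
    (hW : MDifferentiableAt 𝓘(ℝ, E) 𝓘(ℝ, E).tangent (fun y : M => pt y (W y)) m) :
    (VectorField.mlieBracket 𝓘(ℝ, E) Z W m : E) =
      (mvfderiv 𝓘(ℝ, E) (fun y => fibreCoord m (pt y (W y))) m (Z m)
      - mvfderiv 𝓘(ℝ, E) (fun y => fibreCoord m (pt y (Z y))) m (W m) : E) := by
  -- There is no boundary, and the preferred chart has identity derivative at its own base point, so
  -- both corrections in the definition of the bracket disappear.
  have h2 : (extChartAt 𝓘(ℝ, E) m).symm ⁻¹' univ ∩ range 𝓘(ℝ, E) = univ := by simp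
  have hinv : ((mfderiv 𝓘(ℝ, E) 𝓘(ℝ, E) (extChartAt 𝓘(ℝ, E) m) m).inverse : E →L[ℝ] E) =
      ContinuousLinearMap.id ℝ E := by
    rw [mfderiv_extChartAt_self]; exact ContinuousLinearMap.inverse_id (M := E)
  have h0 := (VectorField.mlieBracketWithin_apply (I := 𝓘(ℝ, E)) (V := Z) (W := W) (s := univ)
    (x₀ := m)).trans (congrArg (fun A : E →L[ℝ] E => A _) hinv)
  rw [VectorField.mlieBracketWithin_univ, h2] at h0
  refine h0.trans ((congrFun (VectorField.lieBracketWithin_univ (𝕜 := ℝ) (E := E)) _).trans ?_)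
  rw [mvfderiv_eq_fderiv_chart (mdifferentiableAt_tm_iff.1 hZ).2,
    mvfderiv_eq_fderiv_chart (mdifferentiableAt_tm_iff.1 hW).2]
  have key : ∀ V : VField E M, (VectorField.mpullbackWithin 𝓘(ℝ, E) 𝓘(ℝ, E)
      (extChartAt 𝓘(ℝ, E) m).symm V (range 𝓘(ℝ, E)) : E → E) =ᶠ[nhds (extChartAt 𝓘(ℝ, E) m m)]
      fun z => fibreCoord m (pt ((extChartAt 𝓘(ℝ, E) m).symm z)
        (V ((extChartAt 𝓘(ℝ, E) m).symm z))) := fun V =>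
    Filter.eventually_of_mem (extChartAt_target_mem_nhds m) fun z hz =>
      mpullback_extChartAt_symm V hz
  have val : ∀ V : VField E M, fibreCoord m (pt ((extChartAt 𝓘(ℝ, E) m).symm
      (extChartAt 𝓘(ℝ, E) m m)) (V ((extChartAt 𝓘(ℝ, E) m).symm (extChartAt 𝓘(ℝ, E) m m)))) =
      V m := fun V => by
    rw [extChartAt_to_inv]; exact fibreCoord_pt m (V m)
  have hd : ∀ V : VField E M, fderiv ℝ (VectorField.mpullbackWithin 𝓘(ℝ, E) 𝓘(ℝ, E)
      (extChartAt 𝓘(ℝ, E) m).symm V (range 𝓘(ℝ, E)) : E → E) (extChartAt 𝓘(ℝ, E) m m) =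
      fderiv ℝ (fun z => fibreCoord m (pt ((extChartAt 𝓘(ℝ, E) m).symm z)
        (V ((extChartAt 𝓘(ℝ, E) m).symm z)))) (extChartAt 𝓘(ℝ, E) m m) := fun V =>
    (key V).fderiv_eq
  have hv : ∀ V : VField E M, (VectorField.mpullbackWithin 𝓘(ℝ, E) 𝓘(ℝ, E)
      (extChartAt 𝓘(ℝ, E) m).symm V (range 𝓘(ℝ, E)) (extChartAt 𝓘(ℝ, E) m m) : E) = V m :=
    fun V => (key V).eq_of_nhds.trans (val V)
  refine (congrArg₂ (fun a b : E => a - b) (congrArg₂ (fun (A : E →L[ℝ] E) (v : E) => A v)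
    (hd W) (hv Z)) (congrArg₂ (fun (A : E →L[ℝ] E) (v : E) => A v) (hd Z) (hv W))).trans ?_
  rfl

/-- In the chart the fibre component of `Zᶜ` is `DZ(W)`, that of the tangent map of `W` is `DW(Z)`,
and their difference is the bracket. Only values of `W` near `m` enter, so any convenient extension
of a velocity may be used. -/
theorem clift_eq {Z W : VField E M} {m : M} (hZ : SmoothAt Z m) (hW : SmoothAt W m) :
    clift Z (pt m (W m)) = (mfderiv 𝓘(ℝ, E) 𝓘(ℝ, E).tangent (fun y : M => pt y (W y)) m (Z m) : E × E)
      - (vlift (VectorField.mlieBracket 𝓘(ℝ, E) Z W) (pt m (W m)) : E × E) := by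
  rw [vlift_eq, mfderiv_tm hW.mdiff]
  show ((Z m : E), ((mfderiv 𝓘(ℝ, E) 𝓘(ℝ, E).tangent (fun y : M => pt y (Z y)) m (W m) : E × E)).2) = _
  rw [mfderiv_tm hZ.mdiff]
  refine Prod.ext ?_ ?_
  · have : mfderiv 𝓘(ℝ, E) 𝓘(ℝ, E) (fun y : M => y) m (Z m) = Z m := by
      rw [show (fun y : M => y) = id from rfl, mfderiv_id]; rfl
    exact (this.symm.trans (sub_zero (G := E) _).symm)
  · show _ = _ - (VectorField.mlieBracket 𝓘(ℝ, E) Z W m : E)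
    rw [mlieBracket_eq hZ.mdiff hW.mdiff]
    exact (sub_sub_cancel (G := E) _ _).symm

theorem along_eq (W : TMField E M) (f : TM E M → ℝ) (p : TM E M) :
    along W f p = mvfderiv 𝓘(ℝ, E).tangent f p (W p) := rfl

theorem along_clift_eq {Z W : VField E M} {m : M} (hZ : SmoothAt Z m) (hW : SmoothAt W m)
    {f : TM E M → ℝ} (hf : MDifferentiableAt 𝓘(ℝ, E).tangent 𝓘(ℝ, ℝ) f (pt m (W m))) :
    along (clift Z) f (pt m (W m)) = mvfderiv 𝓘(ℝ, E) (fun y => f (pt y (W y))) m (Z m)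
      - along (vlift (VectorField.mlieBracket 𝓘(ℝ, E) Z W)) f (pt m (W m)) := by
  rw [mvfderiv_comp_apply_vec (f := fun y => pt y (W y)) hf hW.mdiff, along_eq, along_eq, clift_eq hZ hW]
  exact map_sub (mvfderiv 𝓘(ℝ, E).tangent f (pt m (W m))) _ _

end Lifts

/-! ### Second derivatives and the bracket as a commutator. -/

section Lifts
variable {E : Type*} [NormedAddCommGroup E] [NormedSpace ℝ E]
  {M : Type*} [TopologicalSpace M] [ChartedSpace E M] [IsManifold 𝓘(ℝ, E) ∞ M]
  {EN : Type*} [NormedAddCommGroup EN] [NormedSpace ℝ EN] {HN : Type*} [TopologicalSpace HN]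
  {IN : ModelWithCorners ℝ EN HN} {N : Type*} [TopologicalSpace N] [ChartedSpace HN N]
  {F : Type*} [NormedAddCommGroup F] [NormedSpace ℝ F]

/-- One fixed chart serves for all nearby `y`; this is what allows a second differentiation with
respect to `y`. -/
theorem mvfderiv_eq_fderiv_fibreCoord {h : M → F} {m y : M} (hy : y ∈ (chartAt E m).source)
    (hh : MDifferentiableAt 𝓘(ℝ, E) 𝓘(ℝ, F) h y) (u : TangentSpace 𝓘(ℝ, E) y) :
    mvfderiv 𝓘(ℝ, E) h y u =
      fderiv ℝ (fun z : E => h ((extChartAt 𝓘(ℝ, E) m).symm z)) (extChartAt 𝓘(ℝ, E) m y)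
        (fibreCoord m (pt y u)) := by
  have hs : y ∈ (extChartAt 𝓘(ℝ, E) m).source := by rwa [extChartAt_source]
  have ht := (extChartAt 𝓘(ℝ, E) m).map_source hs
  have h1 : MDifferentiableAt 𝓘(ℝ, E) 𝓘(ℝ, E) (extChartAt 𝓘(ℝ, E) m).symm
      (extChartAt 𝓘(ℝ, E) m y) := by
    have := mdifferentiableWithinAt_extChartAt_symm (I := 𝓘(ℝ, E)) ht
    rwa [show range 𝓘(ℝ, E) = univ by simp, mdifferentiableWithinAt_univ] at this
  have h2 : MDifferentiableAt 𝓘(ℝ, E) 𝓘(ℝ, F)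
      (fun z : E => h ((extChartAt 𝓘(ℝ, E) m).symm z)) (extChartAt 𝓘(ℝ, E) m y) := by
    refine MDifferentiableAt.comp (I' := 𝓘(ℝ, E)) _ ?_ h1
    rwa [(extChartAt 𝓘(ℝ, E) m).left_inv hs]
  have h3 := mvfderiv_comp_apply_vec (IN := 𝓘(ℝ, E)) (IN' := 𝓘(ℝ, E)) (x := y)
    (f := extChartAt 𝓘(ℝ, E) m) h2 (mdifferentiableAt_extChartAt hy) u
  rw [fibreCoord_eq_mvfderiv hy, ← mvfderiv_congr (h' := h)
    (Filter.eventually_of_mem (extChartAt_source_mem_nhds' hs)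
      fun q hq => congrArg h ((extChartAt 𝓘(ℝ, E) m).left_inv hq)), h3]
  exact congrArg (fun A : E →L[ℝ] F => A _) (mfderiv_eq_fderiv)

theorem contDiffAt_chart {h : M → F} {m : M} (hh : ContMDiffAt 𝓘(ℝ, E) 𝓘(ℝ, F) ∞ h m) :
    ContDiffAt ℝ ∞ (fun z : E => h ((extChartAt 𝓘(ℝ, E) m).symm z)) (extChartAt 𝓘(ℝ, E) m m) := by
  have := (contMDiffAt_iff.1 hh).2
  rw [show range 𝓘(ℝ, E) = univ by simp, contDiffWithinAt_univ] at this
  exact this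

theorem mvfderiv_clm_apply {E₁ : Type*} [NormedAddCommGroup E₁] [NormedSpace ℝ E₁]
    {A : N → E₁ →L[ℝ] F} {w : N → E₁} {x : N}
    (hA : MDifferentiableAt IN 𝓘(ℝ, E₁ →L[ℝ] F) A x) (hw : MDifferentiableAt IN 𝓘(ℝ, E₁) w x)
    (v : TangentSpace IN x) :
    mvfderiv IN (fun y => A y (w y)) x v = mvfderiv IN A x v (w x) + A x (mvfderiv IN w x v) := by
  let A' : EN →L[ℝ] E₁ →L[ℝ] F := mvfderiv IN A x
  let w' : EN →L[ℝ] E₁ := mvfderiv IN w x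
  have h1 : HasFDerivWithinAt (writtenInExtChartAt IN 𝓘(ℝ, E₁ →L[ℝ] F) x A) A' (range IN)
    (extChartAt IN x x) := hA.hasMFDerivAt.2
  have h2 : HasFDerivWithinAt (writtenInExtChartAt IN 𝓘(ℝ, E₁) x w) w' (range IN)
    (extChartAt IN x x) := hw.hasMFDerivAt.2
  have hA0 : writtenInExtChartAt IN 𝓘(ℝ, E₁ →L[ℝ] F) x A (extChartAt IN x x) = A x :=
    congrArg A (extChartAt_to_inv x)
  have hw0 : writtenInExtChartAt IN 𝓘(ℝ, E₁) x w (extChartAt IN x x) = w x :=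
    congrArg w (extChartAt_to_inv x)
  have h3 := h1.clm_apply h2
  rw [hA0, hw0] at h3
  have h4 : HasMFDerivAt IN 𝓘(ℝ, F) (fun y => A y (w y)) x ((A x).comp w' + A'.flip (w x)) :=
    ⟨hA.continuousAt.clm_apply hw.continuousAt, h3⟩
  refine (congrArg (fun B : EN →L[ℝ] F => B v) h4.mfderiv).trans ?_
  exact add_comm _ _

/-- Product rule for `Dh(W)` in the chart: a second-derivative term plus the derivative of `W`. -/
theorem mvfderiv_mvfderiv {h : M → F} {m : M} (hh : ContMDiffAt 𝓘(ℝ, E) 𝓘(ℝ, F) ∞ h m)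
    {W : VField E M} (hW : SmoothAt W m) (v : TangentSpace 𝓘(ℝ, E) m) :
    mvfderiv 𝓘(ℝ, E) (fun y => mvfderiv 𝓘(ℝ, E) h y (W y)) m v =
      fderiv ℝ (fderiv ℝ (fun z : E => h ((extChartAt 𝓘(ℝ, E) m).symm z)))
        (extChartAt 𝓘(ℝ, E) m m) v (W m) +
      mvfderiv 𝓘(ℝ, E) h m
        (mvfderiv 𝓘(ℝ, E) (fun y => fibreCoord m (pt y (W y))) m v : E) := by
  set hc : E → F := fun z : E => h ((extChartAt 𝓘(ℝ, E) m).symm z) with hhc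
  have hd : DifferentiableAt ℝ (fderiv ℝ hc) (extChartAt 𝓘(ℝ, E) m m) :=
    ((contDiffAt_chart hh).fderiv_right (m := 1) (by norm_cast)).differentiableAt (by simp)
  have hWd := (mdifferentiableAt_tm_iff.1 hW.mdiff).2
  have hsrc : ∀ᶠ y in nhds m, y ∈ (chartAt E m).source := chart_source_mem_nhds E m
  have hmd : ∀ᶠ y in nhds m, MDifferentiableAt 𝓘(ℝ, E) 𝓘(ℝ, F) h y := by
    have := (contMDiffAt_iff_contMDiffAt_nhds (n := 1) (by simp)).1 (hh.of_le (by norm_cast))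
    filter_upwards [this] with y hy using hy.mdifferentiableAt (by simp)
  have hev : (fun y => mvfderiv 𝓘(ℝ, E) h y (W y)) =ᶠ[nhds m]
      fun y => fderiv ℝ hc (extChartAt 𝓘(ℝ, E) m y) (fibreCoord m (pt y (W y))) := by
    filter_upwards [hsrc, hmd] with y hy hy' using mvfderiv_eq_fderiv_fibreCoord hy hy' (W y)
  have hA : MDifferentiableAt 𝓘(ℝ, E) 𝓘(ℝ, E →L[ℝ] F)
      (fun y => fderiv ℝ hc (extChartAt 𝓘(ℝ, E) m y)) m :=
    hd.mdifferentiableAt.comp m (mdifferentiableAt_extChartAt (mem_chart_source E m))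
  rw [mvfderiv_congr hev, mvfderiv_clm_apply hA hWd]
  have h1 : fibreCoord (pt m (W m)).1 (pt m (W m)) = W m := fibreCoord_pt m (W m)
  have h2 := mvfderiv_comp_apply_vec (IN := 𝓘(ℝ, E)) (IN' := 𝓘(ℝ, E)) (x := m)
    (f := extChartAt 𝓘(ℝ, E) m) hd.mdifferentiableAt
    (mdifferentiableAt_extChartAt (mem_chart_source E m)) v
  have h3 : mfderiv 𝓘(ℝ, E) 𝓘(ℝ, E) (extChartAt 𝓘(ℝ, E) m) m v = v := by
    rw [mfderiv_extChartAt_self]; rfl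
  have h4 := mvfderiv_eq_fderiv_fibreCoord (mem_chart_source E m) hmd.self_of_nhds
  rw [h1, h2, h3]
  congr 1
  · exact congrArg (fun A : E →L[ℝ] E →L[ℝ] F => A v (W m)) mfderiv_eq_fderiv
  · exact ((h4 _).trans (congrArg (fderiv ℝ hc _) (fibreCoord_pt m _))).symm

/-- The second-derivative terms of the two iterated derivatives cancel by symmetry. -/
theorem mvfderiv_mlieBracket {h : M → F} {m : M} (hh : ContMDiffAt 𝓘(ℝ, E) 𝓘(ℝ, F) ∞ h m)
    {Z W : VField E M} (hZ : SmoothAt Z m) (hW : SmoothAt W m) :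
    mvfderiv 𝓘(ℝ, E) h m (VectorField.mlieBracket 𝓘(ℝ, E) Z W m) =
      mvfderiv 𝓘(ℝ, E) (fun y => mvfderiv 𝓘(ℝ, E) h y (W y)) m (Z m) -
      mvfderiv 𝓘(ℝ, E) (fun y => mvfderiv 𝓘(ℝ, E) h y (Z y)) m (W m) := by
  have hs : IsSymmSndFDerivAt ℝ (fun z : E => h ((extChartAt 𝓘(ℝ, E) m).symm z))
      (extChartAt 𝓘(ℝ, E) m m) := (contDiffAt_chart hh).isSymmSndFDerivAt (by simp; exact ENat.LEInfty.out)
  rw [mvfderiv_mvfderiv hh hW, mvfderiv_mvfderiv hh hZ]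
  have h1 := hs.eq (Z m) (W m)
  have h2 := congrArg (fun e : E => (mvfderiv 𝓘(ℝ, E) h m : E →L[ℝ] F) e) (mlieBracket_eq hZ.mdiff hW.mdiff)
  refine h2.trans ?_
  refine (map_sub (mvfderiv 𝓘(ℝ, E) h m : E →L[ℝ] F) _ _).trans ?_
  erw [h1]
  simp only [add_sub_add_left_eq_sub]

/-! ### Symmetry of mixed partial derivatives on a product of manifolds. -/

section Mixed

variable {E₁ : Type*} [NormedAddCommGroup E₁] [NormedSpace ℝ E₁]
  {N₁ : Type*} [TopologicalSpace N₁] [ChartedSpace E₁ N₁] [IsManifold 𝓘(ℝ, E₁) ∞ N₁]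

theorem contDiffAt_chart_prod {Φ : N₁ × M → F} {x₀ : N₁} {m₀ : M}
    (hΦ : ContMDiffAt (𝓘(ℝ, E₁).prod 𝓘(ℝ, E)) 𝓘(ℝ, F) ∞ Φ (x₀, m₀)) :
    ContDiffAt ℝ ∞ (fun z : E₁ × E => Φ ((extChartAt 𝓘(ℝ, E₁) x₀).symm z.1,
      (extChartAt 𝓘(ℝ, E) m₀).symm z.2)) (extChartAt 𝓘(ℝ, E₁) x₀ x₀, extChartAt 𝓘(ℝ, E) m₀ m₀) := by
  have := (contMDiffAt_iff.1 hΦ).2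
  rw [show range (𝓘(ℝ, E₁).prod 𝓘(ℝ, E)) = univ by simp, contDiffWithinAt_univ] at this
  rw [extChartAt_prod] at this
  exact this

theorem fderiv_mixed_comm {f : E₁ × E → F} {a : E₁} {c : E} (hf : ContDiffAt ℝ ∞ f (a, c))
    (w : E₁) (v : E) :
    fderiv ℝ (fun x => fderiv ℝ (fun y => f (x, y)) c v) a w =
      fderiv ℝ (fun y => fderiv ℝ (fun x => f (x, y)) a w) c v := by
  have hd : HasFDerivAt (fderiv ℝ f) (fderiv ℝ (fderiv ℝ f) (a, c)) (a, c) :=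
    ((hf.fderiv_right (m := 1) (by norm_cast)).differentiableAt (by simp)).hasFDerivAt
  have hd1 : ∀ᶠ q in nhds (a, c), DifferentiableAt ℝ f q := by
    filter_upwards [(hf.of_le (m := 1) (by norm_cast)).eventually (by simp)] with q hq
      using hq.differentiableAt (by simp)
  have hs : IsSymmSndFDerivAt ℝ f (a, c) :=
    hf.isSymmSndFDerivAt (by simp; exact ENat.LEInfty.out)
  have c1 : ContinuousAt (fun x : E₁ => (x, c)) a := by fun_prop
  have c2 : ContinuousAt (fun y : E => (a, y)) c := by fun_prop
  have e1 : (fun x => fderiv ℝ (fun y => f (x, y)) c v) =ᶠ[nhds a]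
      fun x => fderiv ℝ f (x, c) (0, v) := by
    filter_upwards [c1.eventually hd1] with x hx
    have := hx.hasFDerivAt.comp c (hasFDerivAt_prodMk_right (𝕜 := ℝ) x c)
    exact congrArg (fun A : E →L[ℝ] F => A v) this.fderiv
  have e2 : (fun y => fderiv ℝ (fun x => f (x, y)) a w) =ᶠ[nhds c]
      fun y => fderiv ℝ f (a, y) (w, 0) := by
    filter_upwards [c2.eventually hd1] with y hy
    have := hy.hasFDerivAt.comp a (hasFDerivAt_prodMk_left (𝕜 := ℝ) a y)
    exact congrArg (fun A : E₁ →L[ℝ] F => A w) this.fderiv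
  have f1 := (hd.comp a (hasFDerivAt_prodMk_left (𝕜 := ℝ) a c)).clm_apply
    (hasFDerivAt_const ((0, v) : E₁ × E) a)
  have f2 := (hd.comp c (hasFDerivAt_prodMk_right (𝕜 := ℝ) a c)).clm_apply
    (hasFDerivAt_const ((w, 0) : E₁ × E) c)
  have g1 := congrArg (fun A : E₁ →L[ℝ] F => A w) f1.fderiv
  have g2 := congrArg (fun A : E →L[ℝ] F => A v) f2.fderiv
  rw [e1.fderiv_eq, e2.fderiv_eq]
  refine g1.trans (Eq.trans ?_ g2.symm)
  simpa using hs.eq (w, 0) (0, v)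

theorem mvfderiv_mvfderiv_prod {Φ : N₁ × M → F} {x₀ : N₁} {m₀ : M}
    (hΦ : ContMDiffAt (𝓘(ℝ, E₁).prod 𝓘(ℝ, E)) 𝓘(ℝ, F) ∞ Φ (x₀, m₀))
    (w : TangentSpace 𝓘(ℝ, E₁) x₀) (v : TangentSpace 𝓘(ℝ, E) m₀) :
    mvfderiv 𝓘(ℝ, E₁) (fun x => mvfderiv 𝓘(ℝ, E) (fun y => Φ (x, y)) m₀ v) x₀ w =
      fderiv ℝ (fun a => fderiv ℝ (fun z => Φ ((extChartAt 𝓘(ℝ, E₁) x₀).symm a,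
        (extChartAt 𝓘(ℝ, E) m₀).symm z)) (extChartAt 𝓘(ℝ, E) m₀ m₀) v)
        (extChartAt 𝓘(ℝ, E₁) x₀ x₀) w := by
  have hΦ1 := (contMDiffAt_iff_contMDiffAt_nhds (n := 1) (by simp)).1 (hΦ.of_le (by norm_cast))
  have hmd : ∀ᶠ x in nhds x₀, MDifferentiableAt 𝓘(ℝ, E) 𝓘(ℝ, F) (fun y => Φ (x, y)) m₀ := by
    have hcont : ContinuousAt (fun x : N₁ => (x, m₀)) x₀ := by fun_prop
    filter_upwards [hcont.eventually hΦ1] with x hx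
    exact (hx.mdifferentiableAt (by simp)).comp m₀
      (mdifferentiableAt_const.prodMk mdifferentiableAt_id)
  have hev : (fun x => mvfderiv 𝓘(ℝ, E) (fun y => Φ (x, y)) m₀ v) =ᶠ[nhds x₀]
      fun x => fderiv ℝ (fun z => Φ (x, (extChartAt 𝓘(ℝ, E) m₀).symm z))
        (extChartAt 𝓘(ℝ, E) m₀ m₀) v := by
    filter_upwards [hmd] with x hx using mvfderiv_eq_fderiv_chart hx v
  rw [mvfderiv_congr hev]
  refine mvfderiv_eq_fderiv_chart (h := fun x => fderiv ℝ (fun z => Φ (x,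
    (extChartAt 𝓘(ℝ, E) m₀).symm z)) (extChartAt 𝓘(ℝ, E) m₀ m₀) v) ?_ w
  have hc := contDiffAt_chart_prod hΦ
  have hc1 : ∀ᶠ x in nhds x₀, DifferentiableAt ℝ (fun z : E₁ × E =>
      Φ ((extChartAt 𝓘(ℝ, E₁) x₀).symm z.1, (extChartAt 𝓘(ℝ, E) m₀).symm z.2))
      (extChartAt 𝓘(ℝ, E₁) x₀ x, extChartAt 𝓘(ℝ, E) m₀ m₀) := by
    have hcont : ContinuousAt (fun x : N₁ => (extChartAt 𝓘(ℝ, E₁) x₀ x,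
      extChartAt 𝓘(ℝ, E) m₀ m₀)) x₀ := (continuousAt_extChartAt x₀).prodMk continuousAt_const
    filter_upwards [hcont.eventually ((hc.of_le (m := 1) (by norm_cast)).eventually (by simp))]
      with y hy using hy.differentiableAt (by simp)
  -- As the total derivative of the chart expression applied to the fixed vector `(0, v)`, the
  -- partial derivative is visibly differentiable in `x`.
  have hev2 : (fun x => fderiv ℝ (fun z => Φ (x, (extChartAt 𝓘(ℝ, E) m₀).symm z))
        (extChartAt 𝓘(ℝ, E) m₀ m₀) v) =ᶠ[nhds x₀] fun x => (fun a => fderiv ℝ (fun z : E₁ × E =>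
        Φ ((extChartAt 𝓘(ℝ, E₁) x₀).symm z.1, (extChartAt 𝓘(ℝ, E) m₀).symm z.2))
        (a, extChartAt 𝓘(ℝ, E) m₀ m₀) (0, v)) (extChartAt 𝓘(ℝ, E₁) x₀ x) := by
    filter_upwards [hc1, extChartAt_source_mem_nhds (I := 𝓘(ℝ, E₁)) x₀] with x hx hxs
    have := hx.hasFDerivAt.comp _ (hasFDerivAt_prodMk_right (𝕜 := ℝ) (extChartAt 𝓘(ℝ, E₁) x₀ x)
      (extChartAt 𝓘(ℝ, E) m₀ m₀))
    have h2 := congrArg (fun A : E →L[ℝ] F => A v) this.fderiv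
    simp only [Function.comp_def, (extChartAt 𝓘(ℝ, E₁) x₀).left_inv hxs] at h2
    exact h2
  refine MDifferentiableAt.congr_of_eventuallyEq ?_ hev2
  have hd := (hc.fderiv_right (m := 1) (by norm_cast)).differentiableAt (by simp)
  have hd2 := (hd.hasFDerivAt.comp (extChartAt 𝓘(ℝ, E₁) x₀ x₀) (hasFDerivAt_prodMk_left (𝕜 := ℝ)
    (extChartAt 𝓘(ℝ, E₁) x₀ x₀) (extChartAt 𝓘(ℝ, E) m₀ m₀))).clm_apply
    (hasFDerivAt_const ((0, v) : E₁ × E) (extChartAt 𝓘(ℝ, E₁) x₀ x₀))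
  exact MDifferentiableAt.comp (I' := 𝓘(ℝ, E₁)) x₀ hd2.differentiableAt.mdifferentiableAt
    (mdifferentiableAt_extChartAt (mem_chart_source E₁ x₀))

theorem mvfderiv_mixed_comm {Φ : N₁ × M → F} {x₀ : N₁} {m₀ : M}
    (hΦ : ContMDiffAt (𝓘(ℝ, E₁).prod 𝓘(ℝ, E)) 𝓘(ℝ, F) ∞ Φ (x₀, m₀))
    (w : TangentSpace 𝓘(ℝ, E₁) x₀) (v : TangentSpace 𝓘(ℝ, E) m₀) :
    mvfderiv 𝓘(ℝ, E₁) (fun x => mvfderiv 𝓘(ℝ, E) (fun y => Φ (x, y)) m₀ v) x₀ w =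
    mvfderiv 𝓘(ℝ, E) (fun y => mvfderiv 𝓘(ℝ, E₁) (fun x => Φ (x, y)) x₀ w) m₀ v := by
  have hΦ' : ContMDiffAt (𝓘(ℝ, E).prod 𝓘(ℝ, E₁)) 𝓘(ℝ, F) ∞ (fun q : M × N₁ => Φ (q.2, q.1))
      (m₀, x₀) :=
    ContMDiffAt.comp (m₀, x₀) (I' := 𝓘(ℝ, E₁).prod 𝓘(ℝ, E)) (g := Φ) hΦ
      (contMDiffAt_snd.prodMk contMDiffAt_fst)
  rw [mvfderiv_mvfderiv_prod hΦ, mvfderiv_mvfderiv_prod hΦ']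
  exact fderiv_mixed_comm (contDiffAt_chart_prod hΦ) w v

end Mixed

end Lifts

/-! ### The metric, the kinetic energy and its lifts. -/

section Lifts
variable {E : Type*} [NormedAddCommGroup E] [NormedSpace ℝ E]
  {M : Type*} [TopologicalSpace M] [ChartedSpace E M] [IsManifold 𝓘(ℝ, E) ∞ M]
  {EN : Type*} [NormedAddCommGroup EN] [NormedSpace ℝ EN] {HN : Type*} [TopologicalSpace HN]
  {IN : ModelWithCorners ℝ EN HN} {N : Type*} [TopologicalSpace N] [ChartedSpace HN N]
  {F : Type*} [NormedAddCommGroup F] [NormedSpace ℝ F]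

theorem contMDiffAt_inner (g : Metric E M) {c : N → M} {v w : ∀ x, TangentSpace 𝓘(ℝ, E) (c x)}
    {x : N} (hv : ContMDiffAt IN 𝓘(ℝ, E).tangent ∞ (fun y => pt (c y) (v y)) x)
    (hw : ContMDiffAt IN 𝓘(ℝ, E).tangent ∞ (fun y => pt (c y) (w y)) x) :
    ContMDiffAt IN 𝓘(ℝ, ℝ) ∞ (fun y => g.inner (c y) (v y) (w y)) x := by
  have hb : ContMDiffAt IN 𝓘(ℝ, E) ∞ c x := (contMDiffAt_totalSpace.1 hv).1
  have : ContMDiffAt IN (𝓘(ℝ, E).prod 𝓘(ℝ, ℝ)) ∞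
      (fun m ↦ TotalSpace.mk' ℝ (E := Bundle.Trivial M ℝ) (c m) (g.inner (c m) (v m) (w m))) x := by
    apply ContMDiffAt.clm_bundle_apply₂ (F₁ := E) (F₂ := E)
    · exact ContMDiffAt.comp x g.contMDiff.contMDiffAt hb
    · exact hv
    · exact hw
  exact (contMDiffAt_totalSpace.1 this).2

/-- The one-form on `M`, viewed as a function on `TM`, metrically dual to a vector field. -/
def flat (g : Metric E M) (Z : VField E M) (p : TM E M) : ℝ := g.inner p.1 p.2 (Z p.1)

theorem contMDiff_kinetic (g : Metric E M) (p : TM E M) :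
    ContMDiffAt 𝓘(ℝ, E).tangent 𝓘(ℝ, ℝ) ∞ (kinetic g) p := by
  have : ContMDiffAt 𝓘(ℝ, E).tangent 𝓘(ℝ, ℝ) ∞ (fun q : TM E M => g.inner q.1 q.2 q.2) p :=
    contMDiffAt_inner g contMDiffAt_id contMDiffAt_id
  exact contMDiffAt_const.mul this

theorem contMDiffAt_flat (g : Metric E M) {Z : VField E M} {p : TM E M} (hZ : SmoothAt Z p.1) :
    ContMDiffAt 𝓘(ℝ, E).tangent 𝓘(ℝ, ℝ) ∞ (flat g Z) p :=
  contMDiffAt_inner g contMDiffAt_id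
    (hZ.comp p (contMDiffAt_proj (TangentSpace 𝓘(ℝ, E))))

theorem mdifferentiableAt_kinetic (g : Metric E M) (p : TM E M) :
    MDifferentiableAt 𝓘(ℝ, E).tangent 𝓘(ℝ, ℝ) (kinetic g) p :=
  (contMDiff_kinetic g p).mdifferentiableAt (by simp)

theorem mdifferentiableAt_flat (g : Metric E M) {Z : VField E M} {p : TM E M}
    (hZ : SmoothAt Z p.1) : MDifferentiableAt 𝓘(ℝ, E).tangent 𝓘(ℝ, ℝ) (flat g Z) p :=
  (contMDiffAt_flat g hZ).mdifferentiableAt (by simp)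

/-- Along `s ↦ u + s Z` the energy is a quadratic polynomial in `s` with linear coefficient `g(u,
Z)`. -/
theorem along_vlift_kinetic (g : Metric E M) (Z : VField E M) :
    along (vlift Z) (kinetic g) = flat g Z := by
  funext p
  rw [along_vlift_eq_deriv (mdifferentiableAt_kinetic g p)]
  have : (fun s : ℝ => kinetic g (pt p.1 (p.2 + s • Z p.1))) = fun s =>
      kinetic g p + (s * flat g Z p + s ^ 2 * (1 / 2 * g.inner p.1 (Z p.1) (Z p.1))) := by
    funext s
    simp only [kinetic, flat, map_add, map_smul, add_apply,
      smul_apply, smul_eq_mul]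
    rw [g.symm p.1 (Z p.1) p.2]
    ring
  rw [this]
  have h : HasDerivAt (fun s : ℝ => kinetic g p + (s * flat g Z p
      + s ^ 2 * (1 / 2 * g.inner p.1 (Z p.1) (Z p.1))))
      (1 * flat g Z p + (2 * 0 ^ (2 - 1) * 1) * (1 / 2 * g.inner p.1 (Z p.1) (Z p.1))) 0 := by
    apply HasDerivAt.const_add
    exact ((hasDerivAt_id (0 : ℝ)).mul_const _).add (((hasDerivAt_id (0 : ℝ)).pow 2).mul_const _)
  rw [h.deriv]; simp

theorem along_vlift_flat (g : Metric E M) (Z : VField E M) {Y : VField E M} {p : TM E M}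
    (hY : SmoothAt Y p.1) : along (vlift Z) (flat g Y) p = g.inner p.1 (Z p.1) (Y p.1) := by
  rw [along_vlift_eq_deriv (mdifferentiableAt_flat g hY)]
  have : (fun s : ℝ => flat g Y (pt p.1 (p.2 + s • Z p.1))) = fun s =>
      flat g Y p + s * g.inner p.1 (Z p.1) (Y p.1) := by
    funext s
    simp [flat]
  rw [this]
  have h : HasDerivAt (fun s : ℝ => flat g Y p + s * g.inner p.1 (Z p.1) (Y p.1))
      (1 * g.inner p.1 (Z p.1) (Y p.1)) 0 := by
    apply HasDerivAt.const_add
    exact (hasDerivAt_id (0 : ℝ)).mul_const _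
  rw [h.deriv]; simp

theorem along_clift_kinetic (g : Metric E M) {Z W : VField E M} {m : M} (hZ : SmoothAt Z m)
    (hW : SmoothAt W m) : along (clift Z) (kinetic g) (pt m (W m)) =
      mvfderiv 𝓘(ℝ, E) (fun y => 1 / 2 * g.inner y (W y) (W y)) m (Z m)
      - g.inner m (W m) (VectorField.mlieBracket 𝓘(ℝ, E) Z W m) := by
  rw [along_clift_eq hZ hW (mdifferentiableAt_kinetic g _), along_vlift_kinetic]
  rfl

theorem along_clift_flat (g : Metric E M) {Y Z W : VField E M} {m : M} (hY : SmoothAt Y m)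
    (hZ : SmoothAt Z m) (hW : SmoothAt W m) : along (clift Z) (flat g Y) (pt m (W m)) =
      mvfderiv 𝓘(ℝ, E) (fun y => g.inner y (W y) (Y y)) m (Z m)
      - g.inner m (VectorField.mlieBracket 𝓘(ℝ, E) Z W m) (Y m) := by
  rw [along_clift_eq hZ hW (mdifferentiableAt_flat g hY), along_vlift_flat g _ hY]
  rfl

theorem contMDiffAt_inner_field (g : Metric E M) {Z W : VField E M} {m : M} (hZ : SmoothAt Z m)
    (hW : SmoothAt W m) : ContMDiffAt 𝓘(ℝ, E) 𝓘(ℝ, ℝ) ∞ (fun y => g.inner y (Z y) (W y)) m :=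
  contMDiffAt_inner g hZ hW

/-- A second-order field differentiates functions pulled back from `M` along the base vector. -/
theorem along_comp_proj {Γ : TMField E M} (hΓ : IsSecondOrder Γ) {f : M → ℝ} {p : TM E M}
    (hf : MDifferentiableAt 𝓘(ℝ, E) 𝓘(ℝ, ℝ) f p.1) :
    along Γ (fun q => f q.1) p = mvfderiv 𝓘(ℝ, E) f p.1 p.2 := by
  rw [along_eq, mvfderiv_comp_apply_vec (f := fun q : TM E M => q.1) hf
    (mdifferentiableAt_proj (TangentSpace 𝓘(ℝ, E)))]
  exact congrArg (mvfderiv 𝓘(ℝ, E) f p.1) (hΓ p)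

end Lifts

/-! ### Brackets of combinations of fields, and tensoriality of the Euler–Lagrange expression. -/

section Lifts
variable {E : Type*} [NormedAddCommGroup E] [NormedSpace ℝ E]
  {M : Type*} [TopologicalSpace M] [ChartedSpace E M] [IsManifold 𝓘(ℝ, E) ∞ M]
  {EN : Type*} [NormedAddCommGroup EN] [NormedSpace ℝ EN] {HN : Type*} [TopologicalSpace HN]
  {IN : ModelWithCorners ℝ EN HN} {N : Type*} [TopologicalSpace N] [ChartedSpace HN N]
  {F : Type*} [NormedAddCommGroup F] [NormedSpace ℝ F]
variable {ι : Type*}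

theorem SmoothAt.smul_fun {f : M → ℝ} {Z : VField E M} {m : M}
    (hf : ContMDiffAt 𝓘(ℝ, E) 𝓘(ℝ, ℝ) ∞ f m) (hZ : SmoothAt Z m) :
    SmoothAt (fun y => f y • Z y) m :=
  ContMDiffAt.smul_section hf hZ

theorem SmoothAt.sum {t : Finset ι} {Z : ι → VField E M} {m : M}
    (hZ : ∀ i ∈ t, SmoothAt (Z i) m) : SmoothAt (fun y => ∑ i ∈ t, Z i y) m :=
  ContMDiffAt.sum_section hZ

theorem SmoothAt.sum_smul {t : Finset ι} {f : ι → M → ℝ} {Z : ι → VField E M} {m : M}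
    (hf : ∀ i ∈ t, ContMDiffAt 𝓘(ℝ, E) 𝓘(ℝ, ℝ) ∞ (f i) m) (hZ : ∀ i ∈ t, SmoothAt (Z i) m) :
    SmoothAt (fun y => ∑ i ∈ t, f i y • Z i y) m :=
  SmoothAt.sum fun i hi => (hZ i hi).smul_fun (hf i hi)

theorem SmoothAt.sum_const_smul {t : Finset ι} {c : ι → ℝ} {Z : ι → VField E M} {m : M}
    (hZ : ∀ i ∈ t, SmoothAt (Z i) m) :
    SmoothAt (fun y => ∑ i ∈ t, c i • Z i y) m :=
  SmoothAt.sum_smul (f := fun i _ => c i) (fun _ _ => contMDiffAt_const) hZ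

variable [CompleteSpace E]

theorem mlieBracket_sum_left {t : Finset ι} {Z : ι → VField E M} {W : VField E M} {m : M}
    (hZ : ∀ i ∈ t, SmoothAt (Z i) m) :
    VectorField.mlieBracket 𝓘(ℝ, E) (fun y => ∑ i ∈ t, Z i y) W m =
      ∑ i ∈ t, VectorField.mlieBracket 𝓘(ℝ, E) (Z i) W m := by
  classical
  induction t using Finset.induction_on with
  | empty =>
    simp only [Finset.sum_empty]
    exact congrFun (VectorField.mlieBracket_zero_left (I := 𝓘(ℝ, E)) (W := W)) m
  | insert a s ha ih =>
    simp only [Finset.sum_insert ha]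
    rw [← ih fun i hi => hZ i (by simp [hi])]
    exact VectorField.mlieBracket_add_left (hZ a (by simp)).mdiff
      (SmoothAt.sum fun i hi => hZ i (by simp [hi])).mdiff

theorem mlieBracket_sum_smul_left {t : Finset ι} {f : ι → M → ℝ} {Z : ι → VField E M}
    {W : VField E M} {m : M}
    (hf : ∀ i ∈ t, ContMDiffAt 𝓘(ℝ, E) 𝓘(ℝ, ℝ) ∞ (f i) m) (hZ : ∀ i ∈ t, SmoothAt (Z i) m) :
    VectorField.mlieBracket 𝓘(ℝ, E) (fun y => ∑ i ∈ t, f i y • Z i y) W m =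
      ∑ i ∈ t, (f i m • VectorField.mlieBracket 𝓘(ℝ, E) (Z i) W m
        - mvfderiv 𝓘(ℝ, E) (f i) m (W m) • Z i m) := by
  rw [mlieBracket_sum_left (Z := fun i y => f i y • Z i y) fun i hi => (hZ i hi).smul_fun (hf i hi)]
  refine Finset.sum_congr rfl fun i hi => ?_
  have := VectorField.mlieBracket_smul_left (I := 𝓘(ℝ, E)) (V := Z i) (W := W)
    ((hf i hi).mdifferentiableAt (by simp)) (hZ i hi).mdiff
  refine Eq.trans this ?_
  rw [neg_smul, neg_add_eq_sub]

theorem mlieBracket_sum_smul_right {t : Finset ι} {f : ι → M → ℝ} {Z : ι → VField E M}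
    {W : VField E M} {m : M}
    (hf : ∀ i ∈ t, ContMDiffAt 𝓘(ℝ, E) 𝓘(ℝ, ℝ) ∞ (f i) m) (hZ : ∀ i ∈ t, SmoothAt (Z i) m) :
    VectorField.mlieBracket 𝓘(ℝ, E) W (fun y => ∑ i ∈ t, f i y • Z i y) m =
      ∑ i ∈ t, (f i m • VectorField.mlieBracket 𝓘(ℝ, E) W (Z i) m
        + mvfderiv 𝓘(ℝ, E) (f i) m (W m) • Z i m) := by
  rw [VectorField.mlieBracket_swap_apply, mlieBracket_sum_smul_left hf hZ, ← Finset.sum_neg_distrib]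
  refine Finset.sum_congr rfl fun i hi => ?_
  rw [VectorField.mlieBracket_swap_apply (V := W)]
  simp only [neg_sub, smul_neg]
  abel

theorem mlieBracket_sum_const_smul_right {t : Finset ι} {c : ι → ℝ} {Z : ι → VField E M}
    {W : VField E M} {m : M} (hZ : ∀ i ∈ t, SmoothAt (Z i) m) :
    VectorField.mlieBracket 𝓘(ℝ, E) W (fun y => ∑ i ∈ t, c i • Z i y) m =
      ∑ i ∈ t, c i • VectorField.mlieBracket 𝓘(ℝ, E) W (Z i) m := by
  rw [mlieBracket_sum_smul_right (f := fun i _ => c i) (fun _ _ => contMDiffAt_const) hZ]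
  simp [mvfderiv_const]

/-- The left-hand side of the Euler-Lagrange equation for a vector field `Z`. -/
def eulerLagrange (g : Metric E M) (Γ : TMField E M) (p : TM E M) (Z : VField E M) : ℝ :=
  along Γ (flat g Z) p - along (clift Z) (kinetic g) p


theorem eulerLagrangeAt_iff (g : Metric E M) (Γ : TMField E M) (p : TM E M) :
    EulerLagrangeAt (kinetic g) Γ p ↔
      ∀ Z : VField E M, SmoothAt Z p.1 → eulerLagrange g Γ p Z = 0 := by
  simp only [EulerLagrangeAt, along_vlift_kinetic]
  rfl

/-- The Euler-Lagrange expression of a second-order field is linear over functions on `M`. -/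
theorem eulerLagrange_sum_smul [Fintype ι] (g : Metric E M) {Γ : TMField E M} (hΓ : IsSecondOrder Γ)
    {p : TM E M} {W : VField E M} (hW : SmoothAt W p.1) (hWp : W p.1 = p.2)
    {f : ι → M → ℝ} {Y : ι → VField E M} {Z : VField E M}
    (hf : ∀ i, ContMDiffAt 𝓘(ℝ, E) 𝓘(ℝ, ℝ) ∞ (f i) p.1) (hY : ∀ i, SmoothAt (Y i) p.1)
    (hZ : ∀ᶠ y in nhds p.1, Z y = ∑ i, f i y • Y i y) :
    eulerLagrange g Γ p Z = ∑ i, f i p.1 * eulerLagrange g Γ p (Y i) := by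
  obtain ⟨m, u⟩ := p
  simp only at hW hWp hf hY hZ ⊢
  subst hWp
  have hS : SmoothAt (fun y => ∑ i, f i y • Y i y) m :=
    SmoothAt.sum_smul (fun i _ => hf i) (fun i _ => hY i)
  have hZS : SmoothAt Z m := by
    refine ContMDiffAt.congr_of_eventuallyEq hS ?_
    filter_upwards [hZ] with y hy
    exact congrArg (pt y) hy
  have hfd : ∀ i, MDifferentiableAt 𝓘(ℝ, E) 𝓘(ℝ, ℝ) (f i) m := fun i =>
    (hf i).mdifferentiableAt (by simp)
  have hproj : MDifferentiableAt 𝓘(ℝ, E).tangent 𝓘(ℝ, E) (fun q : TM E M => q.1) (pt m (W m)) :=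
    mdifferentiableAt_proj (TangentSpace 𝓘(ℝ, E))
  have hfp : ∀ i, MDifferentiableAt 𝓘(ℝ, E).tangent 𝓘(ℝ, ℝ) (fun q : TM E M => f i q.1)
    (pt m (W m)) := fun i => MDifferentiableAt.comp (pt m (W m)) (hfd i) hproj
  have hfl : ∀ i, MDifferentiableAt 𝓘(ℝ, E).tangent 𝓘(ℝ, ℝ) (flat g (Y i)) (pt m (W m)) :=
    fun i => mdifferentiableAt_flat g (hY i)
  have h1 : along Γ (flat g Z) (pt m (W m)) = ∑ i, (mvfderiv 𝓘(ℝ, E) (f i) m (W m)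
      * flat g (Y i) (pt m (W m)) + f i m * along Γ (flat g (Y i)) (pt m (W m))) := by
    have hev : flat g Z =ᶠ[nhds (pt m (W m))] fun q => ∑ i, f i q.1 * flat g (Y i) q := by
      have := hproj.continuousAt.eventually hZ
      filter_upwards [this] with q hq
      simp only [flat]
      rw [hq]
      simp [map_sum]
    rw [along_eq, mvfderiv_congr hev, mvfderiv_sum_apply _ fun i _ => mdifferentiableAt_mul (hfp i) (hfl i)]
    refine Finset.sum_congr rfl fun i _ => ?_
    rw [mvfderiv_mul_apply (hfp i) (hfl i)]
    have := along_comp_proj hΓ (p := pt m (W m)) (hfd i)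
    rw [along_eq] at this
    rw [this]; rfl
  have hbr : VectorField.mlieBracket 𝓘(ℝ, E) Z W m = ∑ i, (f i m •
      VectorField.mlieBracket 𝓘(ℝ, E) (Y i) W m - mvfderiv 𝓘(ℝ, E) (f i) m (W m) • Y i m) := by
    have := Filter.EventuallyEq.mlieBracket_vectorField_eq (I := 𝓘(ℝ, E)) (V₁ := Z)
      (V := fun y => ∑ i, f i y • Y i y) hZ (Filter.EventuallyEq.refl _ W)
    rw [this, mlieBracket_sum_smul_left (fun i _ => hf i) (fun i _ => hY i)]
  -- The Leibniz terms of the bracket produce the same `df_i(W) g(W, Y_i)` as in `h1`, so they drop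
  -- out of the difference.
  have h2 : along (clift Z) (kinetic g) (pt m (W m)) = ∑ i, (f i m *
      along (clift (Y i)) (kinetic g) (pt m (W m)) + mvfderiv 𝓘(ℝ, E) (f i) m (W m)
      * flat g (Y i) (pt m (W m))) := by
    rw [along_clift_kinetic g hZS hW, hbr, hZ.self_of_nhds, map_sum, map_sum, ← Finset.sum_sub_distrib]
    refine Finset.sum_congr rfl fun i _ => ?_
    rw [along_clift_kinetic g (hY i) hW, map_smul, map_sub, map_smul, map_smul]
    simp only [flat, smul_eq_mul]
    ring
  show along Γ (flat g Z) (pt m (W m)) - along (clift Z) (kinetic g) (pt m (W m)) = _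
  rw [h1, h2, ← Finset.sum_sub_distrib]
  refine Finset.sum_congr rfl fun i _ => ?_
  simp only [eulerLagrange]
  ring

end Lifts

/-! ### The adjoint action, fundamental vector fields and invariance of the metrics. -/

section Action
variable {E E' : Type*} [NormedAddCommGroup E] [NormedSpace ℝ E]
  [NormedAddCommGroup E'] [NormedSpace ℝ E']
  {M : Type*} [TopologicalSpace M] [ChartedSpace E M] [IsManifold 𝓘(ℝ, E) ∞ M]
  {G : Type*} [TopologicalSpace G] [ChartedSpace E' G] [Group G] [LieGroup 𝓘(ℝ, E') ∞ G]
  [MulAction G M] [ContMDiffSMul 𝓘(ℝ, E') 𝓘(ℝ, E) ∞ G M]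

theorem contMDiff_smul_left (m : M) : ContMDiff 𝓘(ℝ, E') 𝓘(ℝ, E) ∞ (fun h : G => h • m) :=
  (contMDiff_smul (I := 𝓘(ℝ, E')) (I' := 𝓘(ℝ, E)) (n := ∞)).comp (contMDiff_id.prodMk contMDiff_const)

theorem contMDiff_smul_right (E' : Type*) [NormedAddCommGroup E'] [NormedSpace ℝ E']
    {G : Type*} [TopologicalSpace G] [ChartedSpace E' G] [Group G] [MulAction G M]
    [ContMDiffSMul 𝓘(ℝ, E') 𝓘(ℝ, E) ∞ G M] (a : G) : ContMDiff 𝓘(ℝ, E) 𝓘(ℝ, E) ∞ (fun y : M => a • y) :=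
  (contMDiff_smul (I := 𝓘(ℝ, E')) (I' := 𝓘(ℝ, E)) (n := ∞)).comp (contMDiff_const.prodMk contMDiff_id)

theorem mdifferentiableAt_smul_left (m : M) (h : G) :
    MDifferentiableAt 𝓘(ℝ, E') 𝓘(ℝ, E) (fun h : G => h • m) h :=
  (contMDiff_smul_left m).mdifferentiableAt (by simp)

theorem mdifferentiableAt_smul_right (E' : Type*) [NormedAddCommGroup E'] [NormedSpace ℝ E']
    {G : Type*} [TopologicalSpace G] [ChartedSpace E' G] [Group G] [MulAction G M]
    [ContMDiffSMul 𝓘(ℝ, E') 𝓘(ℝ, E) ∞ G M] (a : G) (m : M) :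
    MDifferentiableAt 𝓘(ℝ, E) 𝓘(ℝ, E) (fun y : M => a • y) m :=
  (contMDiff_smul_right E' a).mdifferentiableAt (by simp)

theorem mdifferentiableAt_mul_left (a h : G) :
    MDifferentiableAt 𝓘(ℝ, E') 𝓘(ℝ, E') (fun y : G => a * y) h :=
  (contMDiff_mul_left (I := 𝓘(ℝ, E')) (n := ∞)).mdifferentiableAt (by simp)

theorem mdifferentiableAt_mul_right (a h : G) :
    MDifferentiableAt 𝓘(ℝ, E') 𝓘(ℝ, E') (fun y : G => y * a) h :=
  (contMDiff_mul_right (I := 𝓘(ℝ, E')) (n := ∞)).mdifferentiableAt (by simp)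

theorem mdifferentiableAt_conj (a h : G) :
    MDifferentiableAt 𝓘(ℝ, E') 𝓘(ℝ, E') (fun y : G => a * y * a⁻¹) h :=
  ((contMDiff_mul_right (I := 𝓘(ℝ, E')) (n := ∞) (a := a⁻¹)).comp
    (contMDiff_mul_left (I := 𝓘(ℝ, E')) (n := ∞) (a := a))).mdifferentiableAt (by simp)

/-- Equal maps have equal derivatives, as vectors of the model spaces. -/
theorem mfderiv_fun_congr {EN : Type*} [NormedAddCommGroup EN] [NormedSpace ℝ EN] {HN : Type*}
    [TopologicalSpace HN] {IN : ModelWithCorners ℝ EN HN} {N : Type*} [TopologicalSpace N]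
    [ChartedSpace HN N] {f f' : N → M} (h : f = f') (x : N) (v : TangentSpace IN x) :
    (mfderiv IN 𝓘(ℝ, E) f x v : E) = (mfderiv IN 𝓘(ℝ, E) f' x v : E) := by
  subst h; rfl

theorem fundamental_congr {m m' : M} (h : m = m') (ξ : GroupLieAlgebra 𝓘(ℝ, E') G) :
    (fundamental (E := E) ξ m : E) = fundamental (E := E) ξ m' := by
  subst h; rfl

/-- `Ad h` as a linear map. -/
def AdL (h : G) : GroupLieAlgebra 𝓘(ℝ, E') G →ₗ[ℝ] GroupLieAlgebra 𝓘(ℝ, E') G where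
  toFun := Ad h
  map_add' := fun x y =>
    map_add (mfderiv 𝓘(ℝ, E') 𝓘(ℝ, E') (fun y : G => h * y * h⁻¹) 1 : E' →L[ℝ] E') x y
  map_smul' := fun c x =>
    map_smul (mfderiv 𝓘(ℝ, E') 𝓘(ℝ, E') (fun y : G => h * y * h⁻¹) 1 : E' →L[ℝ] E') c x

theorem Ad_mul (a h : G) (ξ : GroupLieAlgebra 𝓘(ℝ, E') G) : Ad (a * h) ξ = Ad a (Ad h ξ) := by
  have := mfderiv_comp_apply_of_eq (I := 𝓘(ℝ, E')) (I' := 𝓘(ℝ, E')) (I'' := 𝓘(ℝ, E')) (1 : G)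
    (f := fun y : G => h * y * h⁻¹) (g := fun y : G => a * y * a⁻¹) (y := 1)
    (mdifferentiableAt_conj a 1) (mdifferentiableAt_conj h 1) (by simp) ξ
  refine Eq.trans ?_ this
  have h2 : (fun y : G => a * h * y * (a * h)⁻¹) =
    (fun y : G => a * y * a⁻¹) ∘ (fun y : G => h * y * h⁻¹) := by
    funext y; simp [mul_assoc]
  exact mfderiv_fun_congr h2 1 ξ

theorem Ad_one (ξ : GroupLieAlgebra 𝓘(ℝ, E') G) : Ad (1 : G) ξ = ξ := by
  have h2 : (fun y : G => 1 * y * 1⁻¹) = id := by funext y; simp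
  refine (mfderiv_fun_congr h2 1 ξ).trans ?_
  exact congrArg (fun A : E' →L[ℝ] E' => A ξ) (mfderiv_id (I := 𝓘(ℝ, E')) (x := (1 : G)))

/-- The map `ξ ↦ ξ_M(m)` as a linear map. -/
def fundamentalL (m : M) : GroupLieAlgebra 𝓘(ℝ, E') G →ₗ[ℝ] TangentSpace 𝓘(ℝ, E) m where
  toFun := fun ξ => fundamental ξ m
  map_add' := fun x y => map_add (mfderiv 𝓘(ℝ, E') 𝓘(ℝ, E) (fun h : G => h • m) 1 : E' →L[ℝ] E) x y
  map_smul' := fun c x =>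
    map_smul (mfderiv 𝓘(ℝ, E') 𝓘(ℝ, E) (fun h : G => h • m) 1 : E' →L[ℝ] E) c x

theorem fundamental_sum {ι : Type*} (t : Finset ι) (c : ι → ℝ)
    (ξ : ι → GroupLieAlgebra 𝓘(ℝ, E') G) (m : M) :
    (fundamental (∑ i ∈ t, c i • ξ i) m : TangentSpace 𝓘(ℝ, E) m) =
      ∑ i ∈ t, c i • fundamental (ξ i) m := by
  have := map_sum (fundamentalL (E := E) m) (fun i => c i • ξ i) t
  refine Eq.trans this (Finset.sum_congr rfl fun i _ => map_smul (fundamentalL (E := E) m) (c i) (ξ i))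

/-- Differentiates `a • (h • m) = (a h a⁻¹) • (a • m)` at `h = 1`. -/
theorem mfderiv_smul_fundamental (a : G) (m : M) (ξ : GroupLieAlgebra 𝓘(ℝ, E') G) :
    (mfderiv 𝓘(ℝ, E) 𝓘(ℝ, E) (fun y : M => a • y) m (fundamental ξ m) : E) =
      (fundamental (Ad a ξ) (a • m) : TangentSpace 𝓘(ℝ, E) (a • m)) := by
  have h1 := mfderiv_comp_apply_of_eq (I := 𝓘(ℝ, E')) (I' := 𝓘(ℝ, E)) (I'' := 𝓘(ℝ, E)) (1 : G)
    (f := fun h : G => h • m) (g := fun y : M => a • y) (y := m)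
    (mdifferentiableAt_smul_right E' a m) (mdifferentiableAt_smul_left m 1) (by simp) ξ
  have h2 := mfderiv_comp_apply_of_eq (I := 𝓘(ℝ, E')) (I' := 𝓘(ℝ, E')) (I'' := 𝓘(ℝ, E)) (1 : G)
    (f := fun h : G => a * h * a⁻¹) (g := fun h : G => h • (a • m)) (y := 1)
    (mdifferentiableAt_smul_left _ 1) (mdifferentiableAt_conj a 1) (by simp) ξ
  have h3 : (fun y : M => a • y) ∘ (fun h : G => h • m) =
      (fun h : G => h • (a • m)) ∘ (fun h : G => a * h * a⁻¹) := by
    funext y; simp [mul_smul]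
  rw [h3] at h1
  exact h1.symm.trans h2

/-- Tangent vectors to orbits are values of fundamental vector fields. -/
theorem mfderiv_smul_left_eq_fundamental (m : M) (h : G) (v : TangentSpace 𝓘(ℝ, E') h) :
    (mfderiv 𝓘(ℝ, E') 𝓘(ℝ, E) (fun y : G => y • m) h v : E) =
      (fundamental (E := E) (G := G) (mfderiv 𝓘(ℝ, E') 𝓘(ℝ, E') (fun y : G => y * h⁻¹) h v : E') (h • m)
        : TangentSpace 𝓘(ℝ, E) (h • m)) := by
  have h2 := mfderiv_comp_apply_of_eq (I := 𝓘(ℝ, E')) (I' := 𝓘(ℝ, E')) (I'' := 𝓘(ℝ, E)) h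
    (f := fun y : G => y * h⁻¹) (g := fun y : G => y • (h • m)) (y := 1)
    (mdifferentiableAt_smul_left _ 1) (mdifferentiableAt_mul_right h⁻¹ h) (by simp) v
  have h3 : (fun y : G => y • m) = (fun y : G => y • (h • m)) ∘ (fun y : G => y * h⁻¹) := by
    funext y; simp [mul_smul]
  rw [← h3] at h2
  exact h2

/-- Base points such as `1 • m` and `m` are equal only propositionally; vectors are taken in the
model space so that they can be compared. -/
theorem inner_congr (g : Metric E M) {m m' : M} (h : m' = m) (u v : E) :
    g.inner m' u v = g.inner m u v := by
  subst h; rfl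

/-- This is the pull-back hypothesis at the identity, where the orbit map carries `ξ` to its
fundamental vector. -/
theorem inner_fundamental {g : Metric E M} {k : Metric E' G} (hgk : VerticalPartFrom g k) (m : M)
    (ξ η : GroupLieAlgebra 𝓘(ℝ, E') G) :
    g.inner m (fundamental ξ m) (fundamental η m) = k.inner 1 ξ η := by
  rw [← hgk m 1 ξ η]
  exact (inner_congr g (one_smul G m) _ _).symm

/-- Conjugation is a left translation followed by a right one, and both are isometries of `k`. -/
theorem inner_Ad {k : Metric E' G} (hk : IsBiInvariant k) (h : G)
    (ξ η : GroupLieAlgebra 𝓘(ℝ, E') G) : k.inner 1 (Ad h ξ) (Ad h η) = k.inner 1 ξ η := by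
  have key : ∀ ζ : GroupLieAlgebra 𝓘(ℝ, E') G, (Ad h ζ : E') =
    mfderiv 𝓘(ℝ, E') 𝓘(ℝ, E') (fun y : G => y * h⁻¹) (h * 1)
      (mfderiv 𝓘(ℝ, E') 𝓘(ℝ, E') (fun y : G => h * y) 1 ζ) := fun ζ =>
    mfderiv_comp_apply (I := 𝓘(ℝ, E')) (I' := 𝓘(ℝ, E')) (I'' := 𝓘(ℝ, E')) (1 : G)
      (f := fun y : G => h * y) (g := fun y : G => y * h⁻¹)
      (mdifferentiableAt_mul_right h⁻¹ (h * 1)) (mdifferentiableAt_mul_left h 1) ζ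
  rw [← hk.1 h 1 ξ η, ← hk.2 h⁻¹ (h * 1)]
  refine Eq.trans ?_ (inner_congr k (by simp : h * 1 * h⁻¹ = 1) _ _).symm
  rw [← key, ← key]

end Action

/-! ### Smoothness of fundamental fields, and brackets of invariant fields. -/

section Action
variable {E E' : Type*} [NormedAddCommGroup E] [NormedSpace ℝ E]
  [NormedAddCommGroup E'] [NormedSpace ℝ E']
  {M : Type*} [TopologicalSpace M] [ChartedSpace E M] [IsManifold 𝓘(ℝ, E) ∞ M]
  {G : Type*} [TopologicalSpace G] [ChartedSpace E' G] [Group G] [LieGroup 𝓘(ℝ, E') ∞ G]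
  [MulAction G M] [ContMDiffSMul 𝓘(ℝ, E') 𝓘(ℝ, E) ∞ G M]

section Param

variable {EN : Type*} [NormedAddCommGroup EN] [NormedSpace ℝ EN] {HN : Type*} [TopologicalSpace HN]
  {IN : ModelWithCorners ℝ EN HN} {N : Type*} [TopologicalSpace N] [ChartedSpace HN N]
  [IsManifold IN ∞ N]
  {E₁ : Type*} [NormedAddCommGroup E₁] [NormedSpace ℝ E₁] {H₁ : Type*} [TopologicalSpace H₁]
  {I₁ : ModelWithCorners ℝ E₁ H₁} {N₁ : Type*} [TopologicalSpace N₁] [ChartedSpace H₁ N₁]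
  [IsManifold I₁ ∞ N₁]
  {E₂ : Type*} [NormedAddCommGroup E₂] [NormedSpace ℝ E₂] {H₂ : Type*} [TopologicalSpace H₂]
  {I₂ : ModelWithCorners ℝ E₂ H₂} {N₂ : Type*} [TopologicalSpace N₂] [ChartedSpace H₂ N₂]
  [IsManifold I₂ ∞ N₂]
  {F : Type*} [NormedAddCommGroup F] [NormedSpace ℝ F]

/-- Partial derivatives of smooth maps, along smooth fields, are smooth. -/
theorem contMDiffAt_mfderiv_vec {f : N → N₁ → N₂} {s : N → N₁} {x₀ : N}
    (hf : ContMDiffAt (IN.prod I₁) I₂ ∞ (Function.uncurry f) (x₀, s x₀))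
    {v : ∀ y, TangentSpace I₁ (s y)}
    (hv : ContMDiffAt IN I₁.tangent ∞ (fun y => (⟨s y, v y⟩ : TangentBundle I₁ N₁)) x₀) :
    ContMDiffAt IN I₂.tangent ∞
      (fun y => (⟨f y (s y), mfderiv I₁ I₂ (f y) (s y) (v y)⟩ : TangentBundle I₂ N₂)) x₀ := by
  have hs : ContMDiffAt IN I₁ ∞ s x₀ := (Bundle.contMDiffAt_totalSpace.1 hv).1
  have h1 := ContMDiffAt.mfderiv f s hf hs (m := ∞) (by norm_cast)
  have h2 : ContMDiffAt IN I₂ ∞ (fun y => f y (s y)) x₀ :=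
    ContMDiffAt.comp x₀ (g := Function.uncurry f) (f := fun y => (y, s y)) hf
      (contMDiffAt_id.prodMk hs)
  exact ContMDiffAt.clm_apply_of_inCoordinates (b₁ := s) (b₂ := fun y => f y (s y)) (v := v)
    (ϕ := fun y => mfderiv I₁ I₂ (f y) (s y)) (F₁ := E₁) (F₂ := E₂)
    (E₁ := TangentSpace I₁) (E₂ := TangentSpace I₂) h1 hv h2

theorem contMDiffAt_mvfderiv_vec {f : N → N₁ → F} {s : N → N₁} {x₀ : N}
    (hf : ContMDiffAt (IN.prod I₁) 𝓘(ℝ, F) ∞ (Function.uncurry f) (x₀, s x₀))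
    {v : ∀ y, TangentSpace I₁ (s y)}
    (hv : ContMDiffAt IN I₁.tangent ∞ (fun y => (⟨s y, v y⟩ : TangentBundle I₁ N₁)) x₀) :
    ContMDiffAt IN 𝓘(ℝ, F) ∞ (fun y => mvfderiv I₁ (f y) (s y) (v y)) x₀ := by
  have := contMDiffAt_mfderiv_vec hf hv
  exact (contMDiff_snd_tangentBundle_modelSpace F 𝓘(ℝ, F)).contMDiffAt.comp x₀ this

end Param

theorem contMDiffAt_mvfderiv_field {F : Type*} [NormedAddCommGroup F] [NormedSpace ℝ F]
    {f : M → F} {X : VField E M} {m : M}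
    (hf : ContMDiffAt 𝓘(ℝ, E) 𝓘(ℝ, F) ∞ f m) (hX : SmoothAt X m) :
    ContMDiffAt 𝓘(ℝ, E) 𝓘(ℝ, F) ∞ (fun y => mvfderiv 𝓘(ℝ, E) f y (X y)) m :=
  contMDiffAt_mvfderiv_vec (f := fun _ => f) (s := fun y => y)
    (ContMDiffAt.comp (m, m) (g := f) hf contMDiffAt_snd) hX

theorem pt_congr {m m' : M} (h : m = m') (u : E) : (pt m u : TM E M) = pt m' u := by
  subst h; rfl

theorem smoothAt_fundamental (ξ : GroupLieAlgebra 𝓘(ℝ, E') G) (m : M) :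
    SmoothAt (fundamental (E := E) ξ) m := by
  have h1 : ContMDiffAt (𝓘(ℝ, E).prod 𝓘(ℝ, E')) 𝓘(ℝ, E) ∞
      (Function.uncurry fun (y : M) (h : G) => h • y) (m, 1) :=
    ((contMDiff_smul (I := 𝓘(ℝ, E')) (I' := 𝓘(ℝ, E)) (n := ∞) (G := G) (M := M)).comp
      (contMDiff_snd.prodMk contMDiff_fst)).contMDiffAt
  have h2 : IsManifold 𝓘(ℝ, E') ∞ G := inferInstance
  have := contMDiffAt_mfderiv_vec (I₁ := 𝓘(ℝ, E')) (f := fun (y : M) (h : G) => h • y)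
    (s := fun _ : M => (1 : G)) (v := fun _ => ξ) h1 contMDiffAt_const
  refine this.congr_of_eventuallyEq (Filter.Eventually.of_forall fun y => ?_)
  exact pt_congr (one_smul G y).symm _

theorem mvfderiv_extChartAt_self (m : M) (v : TangentSpace 𝓘(ℝ, E) m) :
    mvfderiv 𝓘(ℝ, E) (extChartAt 𝓘(ℝ, E) m) m v = v :=
  congrArg (fun A : E →L[ℝ] E => A v) (mfderiv_extChartAt_self (I := 𝓘(ℝ, E)) (x := m))

theorem mvfderiv_fundamental {F : Type*} [NormedAddCommGroup F] [NormedSpace ℝ F] {f : M → F} {m : M}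
    (hf : MDifferentiableAt 𝓘(ℝ, E) 𝓘(ℝ, F) f m) (ξ : GroupLieAlgebra 𝓘(ℝ, E') G) :
    mvfderiv 𝓘(ℝ, E) f m (fundamental ξ m) = mvfderiv 𝓘(ℝ, E') (fun a : G => f (a • m)) 1 ξ :=
  (mfderiv_comp_apply_of_eq (I := 𝓘(ℝ, E')) (I' := 𝓘(ℝ, E)) (I'' := 𝓘(ℝ, F)) (1 : G)
    (f := fun a : G => a • m) (g := f) (y := m) hf (mdifferentiableAt_smul_left m 1)
    (one_smul G m) ξ).symm

theorem eventually_mdifferentiableAt {F : Type*} [NormedAddCommGroup F] [NormedSpace ℝ F] {f : M → F}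
    {m : M} (hf : ContMDiffAt 𝓘(ℝ, E) 𝓘(ℝ, F) ∞ f m) :
    ∀ᶠ y in nhds m, MDifferentiableAt 𝓘(ℝ, E) 𝓘(ℝ, F) f y := by
  have hf1 := (contMDiffAt_iff_contMDiffAt_nhds (n := 1) (by simp)).1 (hf.of_le (by norm_cast))
  filter_upwards [hf1] with y hy using hy.mdifferentiableAt (by simp)

/-- By invariance of `X`, the two iterated derivatives of `f` are the two mixed partials of `(a, y)
↦ f(a • y)` at `(1, m)`, in the directions `ξ` and `X(m)`. -/
theorem mvfderiv_mlieBracket_fundamental {F : Type*} [NormedAddCommGroup F] [NormedSpace ℝ F]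
    {f : M → F} {m : M} (hf : ContMDiffAt 𝓘(ℝ, E) 𝓘(ℝ, F) ∞ f m)
    (ξ : GroupLieAlgebra 𝓘(ℝ, E') G) {X : VField E M} (hX : SmoothAt X m)
    (hinv : ∀ᶠ a : G in nhds 1,
      (X (a • m) : E) = mfderiv 𝓘(ℝ, E) 𝓘(ℝ, E) (fun y : M => a • y) m (X m)) :
    mvfderiv 𝓘(ℝ, E) f m (VectorField.mlieBracket 𝓘(ℝ, E) (fundamental (E := E) ξ) X m) = 0 := by
  rw [mvfderiv_mlieBracket hf (smoothAt_fundamental ξ m) hX, sub_eq_zero]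
  have hd := eventually_mdifferentiableAt hf
  have hsm : ContinuousAt (fun a : G => a • m) 1 := (contMDiff_smul_left (E := E) (E' := E') m).continuous.continuousAt
  have hsm' : Filter.Tendsto (fun a : G => a • m) (nhds 1) (nhds m) := by
    simpa [ContinuousAt] using hsm
  have hΦ : ContMDiffAt (𝓘(ℝ, E').prod 𝓘(ℝ, E)) 𝓘(ℝ, F) ∞ (fun q : G × M => f (q.1 • q.2)) (1, m) :=
    ContMDiffAt.comp_of_eq (y := m) hf
      (contMDiff_smul (I := 𝓘(ℝ, E')) (I' := 𝓘(ℝ, E)) (n := ∞) (G := G) (M := M)).contMDiffAt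
      (one_smul G m)
  have hmix := mvfderiv_mixed_comm hΦ ξ (X m)
  have h1 : mvfderiv 𝓘(ℝ, E) (fun y => mvfderiv 𝓘(ℝ, E) f y (X y)) m (fundamental ξ m) =
      mvfderiv 𝓘(ℝ, E') (fun a : G => mvfderiv 𝓘(ℝ, E) (fun y => f (a • y)) m (X m)) 1 ξ := by
    rw [mvfderiv_fundamental ((contMDiffAt_mvfderiv_field hf hX).mdifferentiableAt (by simp))]
    refine congrArg (fun A : E' →L[ℝ] F => A ξ) (mvfderiv_congr ?_)
    filter_upwards [hinv, hsm'.eventually hd] with a ha hfa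
    rw [mvfderiv_comp_apply_vec (f := fun y : M => a • y) hfa (mdifferentiableAt_smul_right E' a m)]
    exact congrArg (fun v : E => mvfderiv 𝓘(ℝ, E) f (a • m) v) ha
  have h2 : mvfderiv 𝓘(ℝ, E) (fun y => mvfderiv 𝓘(ℝ, E) f y (fundamental ξ y)) m (X m) =
      mvfderiv 𝓘(ℝ, E) (fun y => mvfderiv 𝓘(ℝ, E') (fun a : G => f (a • y)) 1 ξ) m (X m) := by
    refine congrArg (fun A : E →L[ℝ] F => A (X m)) (mvfderiv_congr ?_)
    filter_upwards [hd] with y hy using mvfderiv_fundamental hy ξ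
  rw [h1, h2, hmix]

/-- A smooth field which is invariant near `m` commutes with the fundamental fields at `m`. -/
theorem mlieBracket_fundamental_eq_zero (ξ : GroupLieAlgebra 𝓘(ℝ, E') G) {X : VField E M} {m : M}
    (hX : SmoothAt X m)
    (hinv : ∀ᶠ a : G in nhds 1,
      (X (a • m) : E) = mfderiv 𝓘(ℝ, E) 𝓘(ℝ, E) (fun y : M => a • y) m (X m)) :
    VectorField.mlieBracket 𝓘(ℝ, E) (fundamental (E := E) ξ) X m = 0 := by
  -- The chart at `m` is a vector-valued test function with identity derivative at `m`, so it
  -- detects the whole bracket.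
  refine Eq.trans ?_ (mvfderiv_mlieBracket_fundamental (E := E) (F := E) contMDiffAt_extChartAt ξ hX hinv)
  exact (mvfderiv_extChartAt_self (E := E) m _).symm

/-- Naturality of the Lie bracket. -/
theorem mlieBracket_of_related {τ : M → M} {X Y : VField E M} {m : M}
    (hτ : ContMDiff 𝓘(ℝ, E) 𝓘(ℝ, E) ∞ τ)
    (hX : SmoothAt X m) (hY : SmoothAt Y m) (hX' : SmoothAt X (τ m)) (hY' : SmoothAt Y (τ m))
    (hXinv : ∀ᶠ y in nhds m, (X (τ y) : E) = mfderiv 𝓘(ℝ, E) 𝓘(ℝ, E) τ y (X y))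
    (hYinv : ∀ᶠ y in nhds m, (Y (τ y) : E) = mfderiv 𝓘(ℝ, E) 𝓘(ℝ, E) τ y (Y y)) :
    (VectorField.mlieBracket 𝓘(ℝ, E) X Y (τ m) : E) =
      mfderiv 𝓘(ℝ, E) 𝓘(ℝ, E) τ m (VectorField.mlieBracket 𝓘(ℝ, E) X Y m) := by
  -- The chart at `τ m` tests the bracket there, and `φ ∘ τ` tests the one at `m`; relatedness of
  -- the fields identifies the iterated derivatives of the two functions.
  set φ := extChartAt 𝓘(ℝ, E) (τ m) with hφdef
  have hφ : ContMDiffAt 𝓘(ℝ, E) 𝓘(ℝ, E) ∞ φ (τ m) := contMDiffAt_extChartAt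
  have hφa : ContMDiffAt 𝓘(ℝ, E) 𝓘(ℝ, E) ∞ (fun y => φ (τ y)) m :=
    ContMDiffAt.comp m (g := φ) hφ hτ.contMDiffAt
  have hτd : ∀ y, MDifferentiableAt 𝓘(ℝ, E) 𝓘(ℝ, E) τ y := fun y => hτ.mdifferentiableAt (by simp)
  have hc : Filter.Tendsto τ (nhds m) (nhds (τ m)) := (hτd m).continuousAt
  have hd := hc.eventually (eventually_mdifferentiableAt hφ)
  refine (mvfderiv_extChartAt_self (E := E) (τ m) _).symm.trans
    (Eq.trans ?_ (mvfderiv_extChartAt_self (E := E) (τ m) _))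
  rw [← mvfderiv_comp_apply_vec (f := τ) (hφ.mdifferentiableAt (by simp)) (hτd m),
    mvfderiv_mlieBracket hφ hX' hY', mvfderiv_mlieBracket hφa hX hY]
  have key : ∀ {X Y : VField E M}, SmoothAt Y (τ m) →
      (∀ᶠ y in nhds m, (X (τ y) : E) = mfderiv 𝓘(ℝ, E) 𝓘(ℝ, E) τ y (X y)) →
      (∀ᶠ y in nhds m, (Y (τ y) : E) = mfderiv 𝓘(ℝ, E) 𝓘(ℝ, E) τ y (Y y)) →
      mvfderiv 𝓘(ℝ, E) (fun y => mvfderiv 𝓘(ℝ, E) φ y (Y y)) (τ m) (X (τ m)) =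
      mvfderiv 𝓘(ℝ, E) (fun y => mvfderiv 𝓘(ℝ, E) (fun y => φ (τ y)) y (Y y)) m (X m) := by
    intro X Y hY' hXinv hYinv
    refine (congrArg (fun v : E => mvfderiv 𝓘(ℝ, E) (fun y => mvfderiv 𝓘(ℝ, E) φ y (Y y)) (τ m) v)
      hXinv.self_of_nhds).trans ?_
    refine (mvfderiv_comp_apply_vec (f := τ)
      ((contMDiffAt_mvfderiv_field hφ hY').mdifferentiableAt (by simp)) (hτd m) _).symm.trans ?_
    refine congrArg (fun A : E →L[ℝ] E => A (X m)) (mvfderiv_congr ?_)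
    filter_upwards [hYinv, hd] with y hy hfy
    rw [mvfderiv_comp_apply_vec (f := τ) hfy (hτd y)]
    exact congrArg (fun v : E => mvfderiv 𝓘(ℝ, E) φ (τ y) v) hy
  rw [key hY' hXinv hYinv, key hX' hYinv hXinv]

end Action

/-! ### The local trivialization and its coordinate fields. -/

section Action
variable {E E' : Type*} [NormedAddCommGroup E] [NormedSpace ℝ E]
  [NormedAddCommGroup E'] [NormedSpace ℝ E']
  {M : Type*} [TopologicalSpace M] [ChartedSpace E M] [IsManifold 𝓘(ℝ, E) ∞ M]
  {G : Type*} [TopologicalSpace G] [ChartedSpace E' G] [Group G] [LieGroup 𝓘(ℝ, E') ∞ G]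
  [MulAction G M] [ContMDiffSMul 𝓘(ℝ, E') 𝓘(ℝ, E) ∞ G M]
  {n d : ℕ} (Ψ : LocalTrivialization E E' M G n)

namespace LocalTrivialization

variable {Ψ} {m : M}

theorem symm_mem_source (hm : m ∈ Ψ.dom) : Ψ.map.symm m ∈ Ψ.map.source := Ψ.map.map_target hm

theorem coord_mem (hm : m ∈ Ψ.dom) : Ψ.coord m ∈ Ψ.base := by
  have := symm_mem_source hm
  rw [Ψ.source_eq] at this
  exact this.1

theorem mem_source {x : Fin n → ℝ} (hx : x ∈ Ψ.base) (h : G) : (x, h) ∈ Ψ.map.source := by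
  rw [Ψ.source_eq]; exact ⟨hx, mem_univ _⟩

theorem map_coord_fib (hm : m ∈ Ψ.dom) : Ψ.map (Ψ.coord m, Ψ.fib m) = m := Ψ.map.right_inv hm

theorem map_mem {x : Fin n → ℝ} (hx : x ∈ Ψ.base) (h : G) : Ψ.map (x, h) ∈ Ψ.dom :=
  Ψ.map.map_source (mem_source hx h)

theorem symm_map {x : Fin n → ℝ} (hx : x ∈ Ψ.base) (h : G) : Ψ.map.symm (Ψ.map (x, h)) = (x, h) :=
  Ψ.map.left_inv (mem_source hx h)

theorem coord_map {x : Fin n → ℝ} (hx : x ∈ Ψ.base) (h : G) : Ψ.coord (Ψ.map (x, h)) = x :=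
  congrArg Prod.fst (symm_map hx h)

theorem fib_map {x : Fin n → ℝ} (hx : x ∈ Ψ.base) (h : G) : Ψ.fib (Ψ.map (x, h)) = h :=
  congrArg Prod.snd (symm_map hx h)

theorem smul_eq_map (hm : m ∈ Ψ.dom) (a : G) : a • m = Ψ.map (Ψ.coord m, a * Ψ.fib m) := by
  rw [Ψ.equivariant _ (coord_mem hm), map_coord_fib hm]

theorem smul_mem (hm : m ∈ Ψ.dom) (a : G) : a • m ∈ Ψ.dom := by
  rw [smul_eq_map hm]; exact map_mem (coord_mem hm) _

theorem coord_smul (hm : m ∈ Ψ.dom) (a : G) : Ψ.coord (a • m) = Ψ.coord m := by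
  rw [smul_eq_map hm, coord_map (coord_mem hm)]

theorem fib_smul (hm : m ∈ Ψ.dom) (a : G) : Ψ.fib (a • m) = a * Ψ.fib m := by
  rw [smul_eq_map hm, fib_map (coord_mem hm)]

theorem sec_mem {x : Fin n → ℝ} (hx : x ∈ Ψ.base) : Ψ.sec x ∈ Ψ.dom := map_mem hx 1

theorem fib_sec {x : Fin n → ℝ} (hx : x ∈ Ψ.base) : Ψ.fib (Ψ.sec x) = 1 := fib_map hx 1

theorem map_eq_smul {x : Fin n → ℝ} (hx : x ∈ Ψ.base) (h : G) : Ψ.map (x, h) = h • Ψ.sec x := by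
  rw [sec, ← Ψ.equivariant x hx, mul_one]

theorem fib_smul_sec (hm : m ∈ Ψ.dom) : Ψ.fib m • Ψ.sec (Ψ.coord m) = m := by
  rw [← map_eq_smul (coord_mem hm), map_coord_fib hm]

theorem dom_mem_nhds (hm : m ∈ Ψ.dom) : ∀ᶠ y in nhds m, y ∈ Ψ.dom := Ψ.map.open_target.mem_nhds hm

theorem base_mem_nhds {x : Fin n → ℝ} (hx : x ∈ Ψ.base) : ∀ᶠ y in nhds x, y ∈ Ψ.base :=
  Ψ.isOpen_base.mem_nhds hx

theorem contMDiffAt_symm (hm : m ∈ Ψ.dom) :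
    ContMDiffAt 𝓘(ℝ, E) (𝓘(ℝ, Fin n → ℝ).prod 𝓘(ℝ, E')) ∞ Ψ.map.symm m :=
  Ψ.contMDiffOn_symm.contMDiffAt (dom_mem_nhds hm)

theorem contMDiffAt_coord (hm : m ∈ Ψ.dom) : ContMDiffAt 𝓘(ℝ, E) 𝓘(ℝ, Fin n → ℝ) ∞ Ψ.coord m :=
  contMDiffAt_fst.comp m (contMDiffAt_symm hm)

theorem contMDiffAt_fib (hm : m ∈ Ψ.dom) : ContMDiffAt 𝓘(ℝ, E) 𝓘(ℝ, E') ∞ Ψ.fib m :=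
  contMDiffAt_snd.comp m (contMDiffAt_symm hm)

theorem mdifferentiableAt_coord (hm : m ∈ Ψ.dom) :
    MDifferentiableAt 𝓘(ℝ, E) 𝓘(ℝ, Fin n → ℝ) Ψ.coord m :=
  (contMDiffAt_coord hm).mdifferentiableAt (by simp)

theorem mdifferentiableAt_fib (hm : m ∈ Ψ.dom) :
    MDifferentiableAt 𝓘(ℝ, E) 𝓘(ℝ, E') Ψ.fib m :=
  (contMDiffAt_fib hm).mdifferentiableAt (by simp)

theorem contMDiffAt_map {x : Fin n → ℝ} (hx : x ∈ Ψ.base) (h : G) :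
    ContMDiffAt (𝓘(ℝ, Fin n → ℝ).prod 𝓘(ℝ, E')) 𝓘(ℝ, E) ∞ Ψ.map (x, h) :=
  Ψ.contMDiffOn_map.contMDiffAt (Ψ.map.open_source.mem_nhds (mem_source hx h))

theorem mdifferentiableAt_map {x : Fin n → ℝ} (hx : x ∈ Ψ.base) (h : G) :
    MDifferentiableAt 𝓘(ℝ, Fin n → ℝ) 𝓘(ℝ, E) (fun y => Ψ.map (y, h)) x :=
  ((contMDiffAt_map hx h).comp x (contMDiffAt_id.prodMk contMDiffAt_const)).mdifferentiableAt
    (by simp)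

theorem mdifferentiableAt_sec {x : Fin n → ℝ} (hx : x ∈ Ψ.base) :
    MDifferentiableAt 𝓘(ℝ, Fin n → ℝ) 𝓘(ℝ, E) Ψ.sec x := mdifferentiableAt_map hx 1

theorem smoothAt_partialX (hm : m ∈ Ψ.dom) (i : Fin n) : SmoothAt (Ψ.partialX i) m := by
  have h1 : ContMDiffAt (𝓘(ℝ, E).prod 𝓘(ℝ, Fin n → ℝ)) 𝓘(ℝ, E) ∞
      (Function.uncurry fun (y : M) (x : Fin n → ℝ) => Ψ.map (x, Ψ.fib y)) (m, Ψ.coord m) := by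
    refine ContMDiffAt.comp (m, Ψ.coord m) (g := Ψ.map) (contMDiffAt_map (coord_mem hm) (Ψ.fib m)) ?_
    exact contMDiffAt_snd.prodMk (ContMDiffAt.comp (m, Ψ.coord m) (g := Ψ.fib) (f := Prod.fst)
      (contMDiffAt_fib hm) contMDiffAt_fst)
  have hv : ContMDiffAt 𝓘(ℝ, E) 𝓘(ℝ, Fin n → ℝ).tangent ∞
      (fun y => (⟨Ψ.coord y, (Pi.single i (1 : ℝ) : Fin n → ℝ)⟩ :
        TangentBundle 𝓘(ℝ, Fin n → ℝ) (Fin n → ℝ))) m := by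
    have := contMDiffAt_vectorSpace_iff_contDiffAt.2 (contDiffAt_const (𝕜 := ℝ) (n := ∞)
      (c := (Pi.single i (1 : ℝ) : Fin n → ℝ)) (x := Ψ.coord m))
    exact ContMDiffAt.comp m this (contMDiffAt_coord hm)
  have := contMDiffAt_mfderiv_vec h1 hv
  refine this.congr_of_eventuallyEq ?_
  filter_upwards [dom_mem_nhds hm] with y hy
  exact pt_congr (map_coord_fib hy).symm _

theorem mvfderiv_coord_partialX (hm : m ∈ Ψ.dom) (i : Fin n) :
    mvfderiv 𝓘(ℝ, E) Ψ.coord m (Ψ.partialX i m) = Pi.single i (1 : ℝ) := by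
  have h := mfderiv_comp_apply_of_eq (I := 𝓘(ℝ, Fin n → ℝ)) (I' := 𝓘(ℝ, E))
    (I'' := 𝓘(ℝ, Fin n → ℝ)) (Ψ.coord m) (f := fun x => Ψ.map (x, Ψ.fib m)) (g := Ψ.coord) (y := m)
    (mdifferentiableAt_coord hm) (mdifferentiableAt_map (coord_mem hm) _) (map_coord_fib hm)
    (Pi.single i (1 : ℝ) : Fin n → ℝ)
  refine Eq.trans h.symm ?_
  have h2 : (Ψ.coord ∘ fun x => Ψ.map (x, Ψ.fib m)) =ᶠ[nhds (Ψ.coord m)] id := by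
    filter_upwards [base_mem_nhds (coord_mem hm)] with x hx using coord_map hx _
  have h3 := mvfderiv_congr (IN := 𝓘(ℝ, Fin n → ℝ)) h2
  refine (congrArg (fun A : (Fin n → ℝ) →L[ℝ] (Fin n → ℝ) => A (Pi.single i (1 : ℝ))) h3).trans ?_
  exact congrArg (fun A : (Fin n → ℝ) →L[ℝ] (Fin n → ℝ) => A (Pi.single i (1 : ℝ)))
    (mfderiv_id (I := 𝓘(ℝ, Fin n → ℝ)) (x := Ψ.coord m))

/-- Equivariance `Ψ(x, a h) = a • Ψ(x, h)`, differentiated in `x` with `h` fixed. -/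
theorem partialX_smul (hm : m ∈ Ψ.dom) (a : G) (i : Fin n) :
    (Ψ.partialX i (a • m) : E) =
      mfderiv 𝓘(ℝ, E) 𝓘(ℝ, E) (fun y : M => a • y) m (Ψ.partialX i m) := by
  have h := mfderiv_comp_apply_of_eq (I := 𝓘(ℝ, Fin n → ℝ)) (I' := 𝓘(ℝ, E))
    (I'' := 𝓘(ℝ, E)) (Ψ.coord m) (f := fun x => Ψ.map (x, Ψ.fib m)) (g := fun y => a • y) (y := m)
    (mdifferentiableAt_smul_right E' a m) (mdifferentiableAt_map (coord_mem hm) _) (map_coord_fib hm)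
    (Pi.single i (1 : ℝ) : Fin n → ℝ)
  refine Eq.trans ?_ h
  have h2 : (fun x => Ψ.map (x, Ψ.fib (a • m))) =ᶠ[nhds (Ψ.coord m)]
      (fun y => a • y) ∘ fun x => Ψ.map (x, Ψ.fib m) := by
    filter_upwards [base_mem_nhds (coord_mem hm)] with x hx
    rw [fib_smul hm, Ψ.equivariant x hx]; rfl
  have h3 := h2.mfderiv_eq (I := 𝓘(ℝ, Fin n → ℝ)) (I' := 𝓘(ℝ, E))
  rw [partialX, coord_smul hm]
  exact congrArg (fun A : (Fin n → ℝ) →L[ℝ] E => A (Pi.single i (1 : ℝ))) h3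

theorem mvfderiv_coord_fundamental (hm : m ∈ Ψ.dom) (ξ : GroupLieAlgebra 𝓘(ℝ, E') G) :
    mvfderiv 𝓘(ℝ, E) Ψ.coord m (fundamental ξ m) = 0 := by
  rw [mvfderiv_fundamental (mdifferentiableAt_coord hm)]
  simp only [coord_smul hm, mvfderiv_const]
  rfl

/-- A vector that is killed by the projection is vertical. -/
theorem exists_eq_fundamental (hm : m ∈ Ψ.dom) {u : TangentSpace 𝓘(ℝ, E) m}
    (hu : mvfderiv 𝓘(ℝ, E) Ψ.coord m u = 0) :
    ∃ ξ : GroupLieAlgebra 𝓘(ℝ, E') G, u = fundamental ξ m := by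
  have hms := (contMDiffAt_symm hm).mdifferentiableAt (by simp)
  have hmap := (contMDiffAt_map (coord_mem hm) (Ψ.fib m)).mdifferentiableAt (by simp)
  have h := mfderiv_comp_apply (I := 𝓘(ℝ, E)) (I' := 𝓘(ℝ, Fin n → ℝ).prod 𝓘(ℝ, E'))
    (I'' := 𝓘(ℝ, E)) m (f := Ψ.map.symm) (g := Ψ.map) hmap hms u
  have h2 : Ψ.map ∘ Ψ.map.symm =ᶠ[nhds m] id := by
    filter_upwards [dom_mem_nhds hm] with y hy using Ψ.map.right_inv hy
  have h3 := h2.mfderiv_eq (I := 𝓘(ℝ, E)) (I' := 𝓘(ℝ, E))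
  have h4 : mfderiv 𝓘(ℝ, E) 𝓘(ℝ, E) (Ψ.map ∘ Ψ.map.symm) m u = u :=
    (congrArg (fun A : E →L[ℝ] E => A u) h3).trans
      (congrArg (fun A : E →L[ℝ] E => A u) (mfderiv_id (I := 𝓘(ℝ, E)) (x := m)))
  -- The vector splits along the two factors. Its coordinate part vanishes by `hu`, and the rest is
  -- the derivative of `z ↦ z • sec x`, a direction tangent to the orbit.
  have h5 := mfderiv_prod_eq_add_apply hmap
    (v := (mfderiv 𝓘(ℝ, E) (𝓘(ℝ, Fin n → ℝ).prod 𝓘(ℝ, E')) Ψ.map.symm m u))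
  have h6 : mfderiv 𝓘(ℝ, E) (𝓘(ℝ, Fin n → ℝ).prod 𝓘(ℝ, E')) Ψ.map.symm m =
      (mfderiv 𝓘(ℝ, E) 𝓘(ℝ, Fin n → ℝ) Ψ.coord m).prod (mfderiv 𝓘(ℝ, E) 𝓘(ℝ, E') Ψ.fib m) :=
    MDifferentiableAt.mfderiv_prod (mdifferentiableAt_coord hm) (mdifferentiableAt_fib hm)
  have h7 : (mfderiv 𝓘(ℝ, E) (𝓘(ℝ, Fin n → ℝ).prod 𝓘(ℝ, E')) Ψ.map.symm m u).1 = 0 :=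
    (congrArg Prod.fst (congrArg (fun A : E →L[ℝ] (Fin n → ℝ) × E' => A u) h6)).trans hu
  set w := mfderiv 𝓘(ℝ, E) (𝓘(ℝ, Fin n → ℝ).prod 𝓘(ℝ, E')) Ψ.map.symm m u with hw
  have h8 : (mfderiv 𝓘(ℝ, Fin n → ℝ) 𝓘(ℝ, E) (fun z => Ψ.map (z, Ψ.fib m)) (Ψ.coord m) w.1 : E) = 0 :=
    (congrArg (fun v : Fin n → ℝ => (mfderiv 𝓘(ℝ, Fin n → ℝ) 𝓘(ℝ, E) (fun z => Ψ.map (z, Ψ.fib m))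
      (Ψ.coord m) v : E)) h7).trans
      (map_zero (mfderiv 𝓘(ℝ, Fin n → ℝ) 𝓘(ℝ, E) (fun z => Ψ.map (z, Ψ.fib m)) (Ψ.coord m)
        : (Fin n → ℝ) →L[ℝ] E))
  have h9 : (fun z => Ψ.map (Ψ.coord m, z)) = fun z => z • Ψ.sec (Ψ.coord m) := by
    funext z; exact map_eq_smul (coord_mem hm) z
  have h10 : (mfderiv 𝓘(ℝ, E') 𝓘(ℝ, E) (fun z => Ψ.map (Ψ.coord m, z)) (Ψ.fib m) w.2 : E) =
      mfderiv 𝓘(ℝ, E') 𝓘(ℝ, E) (fun z => z • Ψ.sec (Ψ.coord m)) (Ψ.fib m) w.2 :=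
    mfderiv_fun_congr h9 _ _
  have h11 := mfderiv_smul_left_eq_fundamental (E := E) (Ψ.sec (Ψ.coord m)) (Ψ.fib m) w.2
  refine ⟨(mfderiv 𝓘(ℝ, E') 𝓘(ℝ, E') (fun y : G => y * (Ψ.fib m)⁻¹) (Ψ.fib m) w.2 : E'),
    Eq.trans ?_ (fundamental_congr (fib_smul_sec hm) _)⟩
  refine Eq.trans ?_ (h10.trans h11)
  have h12 : (u : E) = (mfderiv 𝓘(ℝ, Fin n → ℝ) 𝓘(ℝ, E) (fun z => Ψ.map (z, Ψ.fib m)) (Ψ.coord m) w.1 : E)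
    + (mfderiv 𝓘(ℝ, E') 𝓘(ℝ, E) (fun z => Ψ.map (Ψ.coord m, z)) (Ψ.fib m) w.2 : E) :=
    h4.symm.trans (h.trans h5)
  rw [h8, zero_add] at h12
  exact h12

end LocalTrivialization
end Action

/-- A kernel vector `c` of the Gram matrix gives `∑ c_i v_i` zero length, hence a linear relation
among the `v_i`. -/
theorem isUnit_det_gram {ι V : Type*} [Fintype ι] [DecidableEq ι] [AddCommGroup V] [Module ℝ V]
    [TopologicalSpace V] {B : V →L[ℝ] V →L[ℝ] ℝ} (hB : ∀ v, v ≠ 0 → 0 < B v v) {v : ι → V}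
    (hv : LinearIndependent ℝ v) : IsUnit (Matrix.det fun i j => B (v i) (v j)) := by
  rw [isUnit_iff_ne_zero]
  intro h
  obtain ⟨c, hc, h0⟩ := Matrix.exists_mulVec_eq_zero_iff.2 h
  have h1 : B (∑ i, c i • v i) (∑ i, c i • v i) = ∑ i, c i * (Matrix.mulVec (fun i j => B (v i) (v j)) c) i := by
    simp only [map_sum, map_smul, ContinuousLinearMap.sum_apply, ContinuousLinearMap.smul_apply,
      smul_eq_mul, Matrix.mulVec, dotProduct, Finset.mul_sum]
    rw [Finset.sum_comm]
    exact Finset.sum_congr rfl fun i _ => Finset.sum_congr rfl fun j _ => by ring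
  rw [h0] at h1
  simp only [Pi.zero_apply, mul_zero, Finset.sum_const_zero] at h1
  have h2 : ∑ i, c i • v i = 0 := by
    by_contra h3
    exact (hB _ h3).ne' h1
  exact hc (funext fun i => Fintype.linearIndependent_iff.1 hv c h2 i)

/-! ### The mechanical connection and the invariance of the horizontal fields. -/

section Action
variable {E E' : Type*} [NormedAddCommGroup E] [NormedSpace ℝ E]
  [NormedAddCommGroup E'] [NormedSpace ℝ E']
  {M : Type*} [TopologicalSpace M] [ChartedSpace E M] [IsManifold 𝓘(ℝ, E) ∞ M]
  {G : Type*} [TopologicalSpace G] [ChartedSpace E' G] [Group G] [LieGroup 𝓘(ℝ, E') ∞ G]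
  [MulAction G M] [ContMDiffSMul 𝓘(ℝ, E') 𝓘(ℝ, E) ∞ G M]
  {n d : ℕ} {b : Module.Basis (Fin d) ℝ (GroupLieAlgebra 𝓘(ℝ, E') G)} {g : Metric E M}
  {k : Metric E' G} {Ψ : LocalTrivialization E E' M G n} {m : M}

/-- The components `k(E_a, E_b)` at the identity. -/
def lieGram (b : Module.Basis (Fin d) ℝ (GroupLieAlgebra 𝓘(ℝ, E') G)) (k : Metric E' G) :
    Matrix (Fin d) (Fin d) ℝ := fun a c => k.inner 1 (b a) (b c)

/-- The vertical Gram matrix is thus one constant matrix on all of `M`. Momenta and the `v^a` are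
then related with constant coefficients, which the conservation law and the Routhian both exploit.
-/
theorem vertGram_eq (hgk : VerticalPartFrom g k) (m : M) : vertGram b g m = lieGram b k :=
  funext fun a => funext fun c => inner_fundamental hgk m (b a) (b c)

theorem isUnit_lieGram : IsUnit (lieGram b k).det :=
  isUnit_det_gram (V := GroupLieAlgebra 𝓘(ℝ, E') G) (B := k.inner 1) (fun v hv => k.pos 1 v hv)
    b.linearIndependent

theorem lieGram_symm (a c : Fin d) : lieGram b k a c = lieGram b k c a := k.symm 1 _ _

theorem isUnit_vertGram (hgk : VerticalPartFrom g k) (m : M) : IsUnit (vertGram b g m).det := by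
  rw [vertGram_eq hgk]; exact isUnit_lieGram

variable (b g) in
/-- The connection form as a linear map. -/
def connL (m : M) : TangentSpace 𝓘(ℝ, E) m →ₗ[ℝ] (Fin d → ℝ) where
  toFun := conn b g m
  map_add' u v := by
    simp only [conn, ← Matrix.mulVec_add]
    congr 1
    funext a
    simp
  map_smul' c u := by
    simp only [conn, RingHom.id_apply, ← Matrix.mulVec_smul]
    congr 1
    funext a
    simp

theorem fundamental_eq_sum (ξ : GroupLieAlgebra 𝓘(ℝ, E') G) (m : M) :
    (fundamental ξ m : TangentSpace 𝓘(ℝ, E) m) = ∑ a, b.repr ξ a • tildeE b a m := by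
  have := fundamental_sum (E := E) Finset.univ (fun a => b.repr ξ a) b m
  rw [b.sum_repr] at this
  exact this

theorem vertGram_mulVec_conn (hgk : VerticalPartFrom g k) (u : TangentSpace 𝓘(ℝ, E) m) :
    vertGram b g m *ᵥ conn b g m u = fun a => g.inner m u (tildeE b a m) := by
  rw [conn, Matrix.mulVec_mulVec, Matrix.mul_nonsing_inv _ (isUnit_vertGram hgk m), Matrix.one_mulVec]

theorem conn_tildeE (hgk : VerticalPartFrom g k) (m : M) (c : Fin d) :
    conn b g m (tildeE b c m) = Pi.single c 1 := by
  have : (fun a => g.inner m (tildeE b c m) (tildeE b a m)) = vertGram b g m *ᵥ Pi.single c 1 := by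
    funext a
    rw [Matrix.mulVec_single_one]
    exact g.symm m _ _
  rw [conn, this, Matrix.mulVec_mulVec, Matrix.nonsing_inv_mul _ (isUnit_vertGram hgk m),
    Matrix.one_mulVec]

theorem conn_sum_smul {ι : Type*} (t : Finset ι) (c : ι → ℝ) (u : ι → TangentSpace 𝓘(ℝ, E) m)
    (a : Fin d) : conn b g m (∑ i ∈ t, c i • u i) a = ∑ i ∈ t, c i * conn b g m (u i) a := by
  have := map_sum (connL b g m) (fun i => c i • u i) t
  have h2 := congrFun this a
  refine h2.trans ?_
  rw [Finset.sum_apply]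
  exact Finset.sum_congr rfl fun i _ => congrFun (map_smul (connL b g m) (c i) (u i)) a

theorem conn_sub (u v : TangentSpace 𝓘(ℝ, E) m) :
    conn b g m (u - v) = conn b g m u - conn b g m v := map_sub (connL b g m) u v

theorem conn_fundamental (hgk : VerticalPartFrom g k) (m : M)
    (ξ : GroupLieAlgebra 𝓘(ℝ, E') G) : conn b g m (fundamental ξ m) = b.repr ξ := by
  rw [fundamental_eq_sum (b := b)]
  funext a
  rw [conn_sum_smul]
  simp [conn_tildeE hgk, Pi.single_apply]

theorem conn_eq_zero_iff (hgk : VerticalPartFrom g k) {u : TangentSpace 𝓘(ℝ, E) m} :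
    conn b g m u = 0 ↔ ∀ ξ : GroupLieAlgebra 𝓘(ℝ, E') G, g.inner m u (fundamental ξ m) = 0 := by
  constructor
  · intro h ξ
    have h1 := vertGram_mulVec_conn (b := b) hgk u
    rw [h, Matrix.mulVec_zero] at h1
    rw [fundamental_eq_sum (b := b), map_sum]
    refine Finset.sum_eq_zero fun a _ => ?_
    rw [map_smul, ← congrFun h1 a]; simp
  · intro h
    have : (fun a => g.inner m u (tildeE b a m)) = 0 := funext fun a => h (b a)
    rw [conn, this, Matrix.mulVec_zero]

/-- A vector is determined by its projection and its vertical part. -/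
theorem eq_zero_of_coord_of_conn (hgk : VerticalPartFrom g k) (hm : m ∈ Ψ.dom)
    {u : TangentSpace 𝓘(ℝ, E) m} (h1 : mvfderiv 𝓘(ℝ, E) Ψ.coord m u = 0)
    (h2 : conn b g m u = 0) : u = 0 := by
  obtain ⟨ξ, rfl⟩ := LocalTrivialization.exists_eq_fundamental hm h1
  have := (conn_eq_zero_iff hgk).1 h2 ξ
  by_contra h
  exact (g.pos m _ h).ne' this

theorem ext_coord_conn (hgk : VerticalPartFrom g k) (hm : m ∈ Ψ.dom)
    {u v : TangentSpace 𝓘(ℝ, E) m}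
    (h1 : mvfderiv 𝓘(ℝ, E) Ψ.coord m u = mvfderiv 𝓘(ℝ, E) Ψ.coord m v)
    (h2 : conn b g m u = conn b g m v) : u = v := by
  rw [← sub_eq_zero]
  refine eq_zero_of_coord_of_conn (b := b) hgk hm ?_ ?_
  · rw [map_sub, h1, sub_self]
  · rw [conn_sub, h2, sub_self]

theorem conn_frameX (hgk : VerticalPartFrom g k) (m : M) (i : Fin n) :
    conn b g m (frameX b g Ψ i m) = 0 := by
  rw [frameX, conn_sub, sub_eq_zero]
  funext a
  rw [conn_sum_smul]
  simp [conn_tildeE hgk, Pi.single_apply]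

theorem inner_frameX_fundamental (hgk : VerticalPartFrom g k) (m : M) (i : Fin n)
    (ξ : GroupLieAlgebra 𝓘(ℝ, E') G) : g.inner m (frameX b g Ψ i m) (fundamental ξ m) = 0 :=
  (conn_eq_zero_iff hgk).1 (conn_frameX hgk m i) ξ

theorem mvfderiv_coord_tildeE (hm : m ∈ Ψ.dom) (a : Fin d) :
    mvfderiv 𝓘(ℝ, E) Ψ.coord m (tildeE b a m) = 0 :=
  LocalTrivialization.mvfderiv_coord_fundamental hm (b a)

theorem mvfderiv_coord_frameX (hm : m ∈ Ψ.dom) (i : Fin n) :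
    mvfderiv 𝓘(ℝ, E) Ψ.coord m (frameX b g Ψ i m) = Pi.single i (1 : ℝ) := by
  rw [frameX, map_sub, map_sum, LocalTrivialization.mvfderiv_coord_partialX hm, sub_eq_self]
  refine Finset.sum_eq_zero fun a _ => ?_
  rw [map_smul, mvfderiv_coord_tildeE hm, smul_zero]

/-- The translation by `a` carries the fundamental vector of `Ad a⁻¹ ξ` to that of `ξ`; being an
isometry, it also preserves orthogonality to the orbits. -/
theorem conn_smul_mfderiv (hg : IsInvariantMetric G g) (hgk : VerticalPartFrom g k) (a : G)
    {u : TangentSpace 𝓘(ℝ, E) m} (hu : conn b g m u = 0) :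
    conn b g (a • m) (mfderiv 𝓘(ℝ, E) 𝓘(ℝ, E) (fun y : M => a • y) m u) = 0 := by
  rw [conn_eq_zero_iff hgk] at hu ⊢
  intro ξ
  have h1 := mfderiv_smul_fundamental (E := E) a m (Ad a⁻¹ ξ)
  rw [← Ad_mul, mul_inv_cancel, Ad_one] at h1
  refine Eq.trans ?_ ((hg a m u (fundamental (Ad a⁻¹ ξ) m)).trans (hu _))
  exact congrArg (fun v : TangentSpace 𝓘(ℝ, E) (a • m) => g.inner (a • m) _ v) h1.symm

theorem mvfderiv_coord_smul (hm : m ∈ Ψ.dom) (a : G) (u : TangentSpace 𝓘(ℝ, E) m) :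
    mvfderiv 𝓘(ℝ, E) Ψ.coord (a • m) (mfderiv 𝓘(ℝ, E) 𝓘(ℝ, E) (fun y : M => a • y) m u) =
      mvfderiv 𝓘(ℝ, E) Ψ.coord m u := by
  rw [← mvfderiv_comp_apply_vec (f := fun y : M => a • y)
    (LocalTrivialization.mdifferentiableAt_coord (LocalTrivialization.smul_mem hm a))
    (mdifferentiableAt_smul_right E' a m)]
  refine congrArg (fun A : E →L[ℝ] (Fin n → ℝ) => A u) (mvfderiv_congr ?_)
  filter_upwards [LocalTrivialization.dom_mem_nhds hm] with y hy
    using LocalTrivialization.coord_smul hy a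

/-- Both vectors are horizontal and have the same projection. -/
theorem frameX_smul (hg : IsInvariantMetric G g) (hgk : VerticalPartFrom g k) (hm : m ∈ Ψ.dom)
    (a : G) (i : Fin n) :
    (frameX b g Ψ i (a • m) : E) =
      mfderiv 𝓘(ℝ, E) 𝓘(ℝ, E) (fun y : M => a • y) m (frameX b g Ψ i m) := by
  have hm' := LocalTrivialization.smul_mem hm a
  refine ext_coord_conn (b := b) hgk hm' ?_ ?_
  · rw [mvfderiv_coord_frameX hm', mvfderiv_coord_smul hm, mvfderiv_coord_frameX hm]
  · rw [conn_frameX hgk, conn_smul_mfderiv hg hgk a (conn_frameX hgk m i)]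

theorem smoothAt_tildeE (a : Fin d) (m : M) : SmoothAt (E := E) (tildeE b a) m :=
  smoothAt_fundamental (b a) m

/-- The connection form of a smooth field is smooth. -/
theorem contMDiffAt_conn (hgk : VerticalPartFrom g k) {X : VField E M} (hX : SmoothAt X m)
    (a : Fin d) : ContMDiffAt 𝓘(ℝ, E) 𝓘(ℝ, ℝ) ∞ (fun y => conn b g y (X y) a) m := by
  have h : (fun y => conn b g y (X y) a) =
      fun y => ∑ c, (lieGram b k)⁻¹ a c * g.inner y (X y) (tildeE b c y) := by
    funext y; rw [conn, vertGram_eq hgk]; rfl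
  rw [h]
  exact contMDiffAt_finsetSum fun c _ =>
    contMDiffAt_const.mul (contMDiffAt_inner_field g hX (smoothAt_tildeE c m))

end Action

section Action
variable {E E' : Type*} [NormedAddCommGroup E] [NormedSpace ℝ E]
  [NormedAddCommGroup E'] [NormedSpace ℝ E']
  {M : Type*} [TopologicalSpace M] [ChartedSpace E M] [IsManifold 𝓘(ℝ, E) ∞ M]
  {G : Type*} [TopologicalSpace G] [ChartedSpace E' G] [Group G] [LieGroup 𝓘(ℝ, E') ∞ G]
  [MulAction G M] [ContMDiffSMul 𝓘(ℝ, E') 𝓘(ℝ, E) ∞ G M]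
  {n d : ℕ} {b : Module.Basis (Fin d) ℝ (GroupLieAlgebra 𝓘(ℝ, E') G)} {g : Metric E M}
  {k : Metric E' G} {Ψ : LocalTrivialization E E' M G n} {m : M}

theorem smoothAt_frameX (hgk : VerticalPartFrom g k) (hm : m ∈ Ψ.dom) (i : Fin n) :
    SmoothAt (frameX b g Ψ i) m :=
  ContMDiffAt.sub_section (LocalTrivialization.smoothAt_partialX hm i)
    (SmoothAt.sum_smul (f := fun a y => conn b g y (Ψ.partialX i y) a)
      (fun a _ => contMDiffAt_conn hgk (LocalTrivialization.smoothAt_partialX hm i) a)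
      (fun a _ => smoothAt_tildeE a m))

/-! ### The adjoint matrices -/

theorem AdMatrix_eq_toMatrix (h : G) : AdMatrix b h = LinearMap.toMatrix b b (AdL h) := by
  ext c a
  rw [LinearMap.toMatrix_apply]; rfl

theorem AdMatrix_mul (a h : G) : AdMatrix b (a * h) = AdMatrix b a * AdMatrix b h := by
  rw [AdMatrix_eq_toMatrix, AdMatrix_eq_toMatrix, AdMatrix_eq_toMatrix, ← LinearMap.toMatrix_comp]
  congr 1
  ext ξ
  exact Ad_mul a h ξ

theorem AdMatrix_one : AdMatrix b (1 : G) = 1 := by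
  rw [AdMatrix_eq_toMatrix, ← LinearMap.toMatrix_id b]
  congr 1
  ext ξ
  exact Ad_one ξ

theorem isUnit_AdMatrix (h : G) : IsUnit (AdMatrix b h).det := by
  rw [← Matrix.isUnit_iff_isUnit_det]
  exact IsUnit.of_mul_eq_one (AdMatrix b h⁻¹) (by rw [← AdMatrix_mul, mul_inv_cancel, AdMatrix_one])

theorem AdMatrix_mulVec_repr (h : G) (ξ : GroupLieAlgebra 𝓘(ℝ, E') G) :
    AdMatrix b h *ᵥ b.repr ξ = b.repr (Ad h ξ) := by
  rw [AdMatrix_eq_toMatrix, LinearMap.toMatrix_mulVec_repr]; rfl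

/-- The derivative of conjugation lands at `y * 1 * y⁻¹`, equal to `1` only propositionally. Once
moved to the fixed point `1`, its fibre coordinate in the chart there is `Ad y ξ` itself. -/
theorem contMDiffAt_Ad (h : G) (ξ : GroupLieAlgebra 𝓘(ℝ, E') G) :
    ContMDiffAt 𝓘(ℝ, E') 𝓘(ℝ, E') (M' := E') ∞ (fun y : G => Ad y ξ) h := by
  have h1 : ContMDiffAt (𝓘(ℝ, E').prod 𝓘(ℝ, E')) 𝓘(ℝ, E') ∞
      (Function.uncurry fun (y z : G) => y * z * y⁻¹) (h, 1) := by
    have : ContMDiff (𝓘(ℝ, E').prod 𝓘(ℝ, E')) 𝓘(ℝ, E') ∞ (fun q : G × G => q.1 * q.2 * q.1⁻¹) :=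
      (contMDiff_fst.mul contMDiff_snd).mul contMDiff_fst.inv
    exact this.contMDiffAt
  have h2 := contMDiffAt_mfderiv_vec (I₁ := 𝓘(ℝ, E')) (f := fun (y z : G) => y * z * y⁻¹)
    (s := fun _ : G => (1 : G)) (v := fun _ => ξ) h1 contMDiffAt_const
  have h3 : ContMDiffAt 𝓘(ℝ, E') 𝓘(ℝ, E').tangent ∞
      (fun y : G => (pt (1 : G) (Ad y ξ) : TM E' G)) h := by
    refine h2.congr_of_eventuallyEq (Filter.Eventually.of_forall fun y => ?_)
    exact pt_congr (by simp) _
  have h4 := (Bundle.contMDiffAt_totalSpace.1 h3).2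
  refine h4.congr_of_eventuallyEq (Filter.Eventually.of_forall fun y => ?_)
  exact (fibreCoord_pt (1 : G) (Ad y ξ)).symm

theorem contMDiffAt_AdMatrix [FiniteDimensional ℝ E'] (h : G) (c a : Fin d) :
    ContMDiffAt 𝓘(ℝ, E') 𝓘(ℝ, ℝ) ∞ (fun y : G => AdMatrix b y c a) h := by
  let ℓ : E' →ₗ[ℝ] ℝ := b.coord c
  have h1 : ContMDiff 𝓘(ℝ, E') 𝓘(ℝ, ℝ) ∞ (LinearMap.toContinuousLinearMap ℓ) :=
    (LinearMap.toContinuousLinearMap ℓ).contMDiff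
  exact h1.contMDiffAt.comp h (contMDiffAt_Ad h (b a))

theorem contMDiffAt_AdMatrix_fib [FiniteDimensional ℝ E'] (hm : m ∈ Ψ.dom) (c a : Fin d) :
    ContMDiffAt 𝓘(ℝ, E) 𝓘(ℝ, ℝ) ∞ (fun y : M => AdMatrix b (Ψ.fib y) c a) m :=
  (contMDiffAt_AdMatrix (b := b) (Ψ.fib m) c a).comp m (LocalTrivialization.contMDiffAt_fib hm)

/-! ### The invariant fields -/

theorem hatE_eq_sum (a : Fin d) (m : M) :
    (hatE b Ψ a m : TangentSpace 𝓘(ℝ, E) m) = ∑ c, AdMatrix b (Ψ.fib m) c a • tildeE b c m :=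
  fundamental_eq_sum _ m

theorem smoothAt_hatE [FiniteDimensional ℝ E'] (hm : m ∈ Ψ.dom) (a : Fin d) :
    SmoothAt (hatE b Ψ a) m := by
  have h : hatE b Ψ a = fun y => ∑ c, AdMatrix b (Ψ.fib y) c a • tildeE (E := E) b c y :=
    funext fun y => hatE_eq_sum a y
  rw [h]
  exact SmoothAt.sum_smul (f := fun c y => AdMatrix b (Ψ.fib y) c a)
    (fun c _ => contMDiffAt_AdMatrix_fib hm c a) (fun c _ => smoothAt_tildeE c m)

/-- The twist by `Ad (fib m)` in `Ê_a` compensates the `Ad a` by which fundamental fields transform,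
as `fib (h • m) = h * fib m`. -/
theorem hatE_smul (hm : m ∈ Ψ.dom) (h : G) (a : Fin d) :
    (hatE b Ψ a (h • m) : E) =
      mfderiv 𝓘(ℝ, E) 𝓘(ℝ, E) (fun y : M => h • y) m (hatE b Ψ a m) := by
  rw [hatE, hatE, mfderiv_smul_fundamental, ← Ad_mul, LocalTrivialization.fib_smul hm]

/-- Bi-invariance removes `Ad (fib m)`; this is why the `h_{ab}` are constant and not just functions
of `x`. -/
theorem inner_hatE (hk : IsBiInvariant k) (hgk : VerticalPartFrom g k) (m : M) (a c : Fin d) :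
    g.inner m (hatE b Ψ a m) (hatE b Ψ c m) = lieGram b k a c :=
  (inner_fundamental hgk m _ _).trans (inner_Ad hk _ _ _)

theorem mlieBracket_tildeE_frameX (hg : IsInvariantMetric G g) (hgk : VerticalPartFrom g k)
    (hm : m ∈ Ψ.dom) (a : Fin d) (i : Fin n) :
    VectorField.mlieBracket 𝓘(ℝ, E) (tildeE b a) (frameX b g Ψ i) m = 0 :=
  mlieBracket_fundamental_eq_zero (b a) (smoothAt_frameX hgk hm i)
    (Filter.Eventually.of_forall fun h => frameX_smul hg hgk hm h i)

/-! ### The curvature -/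

/-- The `X_i` project to the constant fields `∂/∂xⁱ`, so both iterated derivatives of the
coordinates vanish and the bracket is vertical. -/
theorem mvfderiv_coord_mlieBracket_frameX (hgk : VerticalPartFrom g k) (hm : m ∈ Ψ.dom)
    (i j : Fin n) : mvfderiv 𝓘(ℝ, E) Ψ.coord m
      (VectorField.mlieBracket 𝓘(ℝ, E) (frameX b g Ψ i) (frameX b g Ψ j) m) = 0 := by
  rw [mvfderiv_mlieBracket (LocalTrivialization.contMDiffAt_coord hm) (smoothAt_frameX hgk hm i)
    (smoothAt_frameX hgk hm j)]
  have h : ∀ (l : Fin n), (fun y => mvfderiv 𝓘(ℝ, E) Ψ.coord y (frameX b g Ψ l y)) =ᶠ[nhds m]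
      fun _ => Pi.single l (1 : ℝ) := fun l => by
    filter_upwards [LocalTrivialization.dom_mem_nhds hm] with y hy using mvfderiv_coord_frameX hy l
  rw [mvfderiv_congr (h j), mvfderiv_congr (h i), mvfderiv_const, mvfderiv_const]
  exact sub_self _

theorem sum_conn_smul_tildeE (hgk : VerticalPartFrom g k) (hm : m ∈ Ψ.dom)
    {u : TangentSpace 𝓘(ℝ, E) m} (hu : mvfderiv 𝓘(ℝ, E) Ψ.coord m u = 0) :
    u = ∑ a, conn b g m u a • tildeE b a m := by
  obtain ⟨ξ, rfl⟩ := LocalTrivialization.exists_eq_fundamental hm hu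
  rw [conn_fundamental hgk]
  exact fundamental_eq_sum ξ m

theorem mlieBracket_frameX (hgk : VerticalPartFrom g k) (hm : m ∈ Ψ.dom) (i j : Fin n) :
    VectorField.mlieBracket 𝓘(ℝ, E) (frameX b g Ψ i) (frameX b g Ψ j) m =
      ∑ a, curv b g Ψ i j m a • tildeE b a m :=
  sum_conn_smul_tildeE hgk hm (mvfderiv_coord_mlieBracket_frameX hgk hm i j)

/-- The connection form is equivariant. -/
theorem conn_mfderiv_smul (hg : IsInvariantMetric G g) (hgk : VerticalPartFrom g k)
    (a : G) (u : TangentSpace 𝓘(ℝ, E) m) :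
    conn b g (a • m) (mfderiv 𝓘(ℝ, E) 𝓘(ℝ, E) (fun y : M => a • y) m u) =
      AdMatrix b a *ᵥ conn b g m u := by
  -- Subtract the vertical part of `u`: the horizontal remainder stays horizontal, and the vertical
  -- part transforms by `Ad a`.
  set ξ : GroupLieAlgebra 𝓘(ℝ, E') G := b.equivFun.symm (conn b g m u) with hξ
  have hr : b.repr ξ = conn b g m u := b.equivFun.apply_symm_apply (conn b g m u)
  have h1 : conn b g m (u - fundamental ξ m) = 0 := by
    rw [conn_sub, conn_fundamental hgk, hr, sub_self]
  have h2 := conn_smul_mfderiv hg hgk a h1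
  rw [map_sub, conn_sub, sub_eq_zero] at h2
  rw [h2, ← hr, AdMatrix_mulVec_repr, ← conn_fundamental hgk (a • m) (Ad a ξ)]
  exact congrArg (fun v : TangentSpace 𝓘(ℝ, E) (a • m) => conn b g (a • m) v)
    (mfderiv_smul_fundamental a m ξ)

/-- The bracket of two invariant fields is invariant by naturality; its vertical components
transform as the connection form does. -/
theorem curv_smul (hg : IsInvariantMetric G g) (hgk : VerticalPartFrom g k) (hm : m ∈ Ψ.dom)
    (a : G) (i j : Fin n) : curv b g Ψ i j (a • m) = AdMatrix b a *ᵥ curv b g Ψ i j m := by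
  have hm' := LocalTrivialization.smul_mem hm a
  rw [curv, curv, ← conn_mfderiv_smul hg hgk]
  refine congrArg (fun v : TangentSpace 𝓘(ℝ, E) (a • m) => conn b g (a • m) v) ?_
  have hinv : ∀ l, ∀ᶠ y in nhds m, (frameX b g Ψ l (a • y) : E) =
      mfderiv 𝓘(ℝ, E) 𝓘(ℝ, E) (fun y : M => a • y) y (frameX b g Ψ l y) := fun l => by
    filter_upwards [LocalTrivialization.dom_mem_nhds hm] with y hy using frameX_smul hg hgk hy a l
  exact mlieBracket_of_related (contMDiff_smul_right E' a) (smoothAt_frameX hgk hm i)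
    (smoothAt_frameX hgk hm j) (smoothAt_frameX hgk hm' i) (smoothAt_frameX hgk hm' j) (hinv i) (hinv j)

/-- Moving from the section to `m` multiplies `R` by `𝒜(fib m)`, which the factor `𝒜̄` undoes. -/
theorem curvK_eq (hg : IsInvariantMetric G g) (hgk : VerticalPartFrom g k) (hm : m ∈ Ψ.dom)
    (i j : Fin n) (a : Fin d) : curvK b g Ψ i j m a = redK b g Ψ a i j (Ψ.coord m) := by
  have hx := LocalTrivialization.coord_mem hm
  have h1 := curv_smul hg hgk (b := b) (LocalTrivialization.sec_mem hx) (Ψ.fib m) i j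
  rw [LocalTrivialization.fib_smul_sec hm] at h1
  rw [redK, curvK, curvK, h1, LocalTrivialization.fib_sec hx, AdMatrix_one, Matrix.mulVec_mulVec,
    Matrix.nonsing_inv_mul _ (isUnit_AdMatrix _), inv_one]

end Action

section Action
variable {E E' : Type*} [NormedAddCommGroup E] [NormedSpace ℝ E]
  [NormedAddCommGroup E'] [NormedSpace ℝ E']
  {M : Type*} [TopologicalSpace M] [ChartedSpace E M] [IsManifold 𝓘(ℝ, E) ∞ M]
  {G : Type*} [TopologicalSpace G] [ChartedSpace E' G] [Group G] [LieGroup 𝓘(ℝ, E') ∞ G]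
  [MulAction G M] [ContMDiffSMul 𝓘(ℝ, E') 𝓘(ℝ, E) ∞ G M]
  {n d : ℕ} {b : Module.Basis (Fin d) ℝ (GroupLieAlgebra 𝓘(ℝ, E') G)} {g : Metric E M}
  {k : Metric E' G} {Ψ : LocalTrivialization E E' M G n} {m : M}

/-! ### The structure constants -/

section StructureConstants

open GroupLieAlgebra

/-- The bracket of the Lie algebra is that of left-invariant fields, while the fundamental fields of
left multiplication are right-invariant. The relation between them is `h y = (h y h⁻¹) h`,
differentiated at `y = 1`. -/
theorem mulInvariantVectorField_eq (ξ : GroupLieAlgebra 𝓘(ℝ, E') G) (h : G) :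
    (mulInvariantVectorField ξ h : E') = fundamental (E := E') (M := G) (Ad h ξ) h := by
  have h1 := mfderiv_comp_apply_of_eq (I := 𝓘(ℝ, E')) (I' := 𝓘(ℝ, E')) (I'' := 𝓘(ℝ, E')) (1 : G)
    (f := fun y : G => h * y * h⁻¹) (g := fun y : G => y * h) (y := 1)
    (mdifferentiableAt_mul_right h 1) (mdifferentiableAt_conj h 1) (by simp) ξ
  refine Eq.trans ?_ h1
  refine mfderiv_fun_congr (E := E') (f := fun y : G => h * y) ?_ 1 ξ
  funext y; simp

theorem mulInvariantVectorField_eq_sum (a : Fin d) (h : G) :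
    (mulInvariantVectorField (b a) h : TangentSpace 𝓘(ℝ, E') h) =
      ∑ c, AdMatrix b h c a • tildeE (E := E') (M := G) b c h :=
  (mulInvariantVectorField_eq (b a) h).trans (fundamental_eq_sum (Ad h (b a)) h)

theorem mulInvariantVectorField_smul (ξ : GroupLieAlgebra 𝓘(ℝ, E') G) (a h : G) :
    (mulInvariantVectorField ξ (a • h) : E') =
      mfderiv 𝓘(ℝ, E') 𝓘(ℝ, E') (fun y : G => a • y) h (mulInvariantVectorField ξ h) := by
  have h1 := mfderiv_comp_apply_of_eq (I := 𝓘(ℝ, E')) (I' := 𝓘(ℝ, E')) (I'' := 𝓘(ℝ, E')) (1 : G)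
    (f := fun y : G => h * y) (g := fun y : G => a * y) (y := h)
    (mdifferentiableAt_mul_left a h) (mdifferentiableAt_mul_left h 1) (by simp) ξ
  refine Eq.trans ?_ h1
  refine mfderiv_fun_congr (E := E') (f := fun y : G => a * h * y) ?_ 1 ξ
  funext y; simp [mul_assoc]

theorem smoothAt_mulInvariantVectorField [FiniteDimensional ℝ E'] (a : Fin d) (h : G) :
    SmoothAt (E := E') (M := G) (mulInvariantVectorField (b a)) h := by
  have h1 : mulInvariantVectorField (b a) = fun y : G => ∑ c, AdMatrix b y c a •
      tildeE (E := E') (M := G) b c y := funext fun y => mulInvariantVectorField_eq_sum a y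
  rw [h1]
  exact SmoothAt.sum_smul (f := fun c y => AdMatrix b y c a)
    (fun c _ => contMDiffAt_AdMatrix h c a) (fun c _ => smoothAt_tildeE c h)

theorem mulInvariantVectorField_one (ξ : GroupLieAlgebra 𝓘(ℝ, E') G) :
    (mulInvariantVectorField ξ (1 : G) : E') = ξ := by
  refine (mfderiv_fun_congr (E := E') (f := fun y : G => 1 * y) (f' := id) (by funext y; simp) 1 ξ).trans ?_
  exact congrArg (fun A : E' →L[ℝ] E' => A ξ) (mfderiv_id (I := 𝓘(ℝ, E')) (x := (1 : G)))

theorem fundamental_one (ξ : GroupLieAlgebra 𝓘(ℝ, E') G) :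
    (fundamental (E := E') ξ (1 : G) : E') = ξ := by
  refine (mfderiv_fun_congr (E := E') (f := fun y : G => y * 1) (f' := id) (by funext y; simp) 1 ξ).trans ?_
  exact congrArg (fun A : E' →L[ℝ] E' => A ξ) (mfderiv_id (I := 𝓘(ℝ, E')) (x := (1 : G)))

/-- The structure constants are the derivatives of the adjoint matrices at the identity. -/
theorem structConst_eq [FiniteDimensional ℝ E'] (e a f : Fin d) :
    structConst b e a f = mvfderiv 𝓘(ℝ, E') (fun y : G => AdMatrix b y f a) 1 (b e : E') := by
  have : CompleteSpace E' := FiniteDimensional.complete ℝ E'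
  have hL : mulInvariantVectorField (b a) = fun y : G => ∑ c, AdMatrix b y c a •
      tildeE (E := E') (M := G) b c y := funext fun y => mulInvariantVectorField_eq_sum a y
  -- A left-invariant field is invariant under the left action of `G` on itself, hence commutes with
  -- its fundamental fields; only the derivatives of the coefficients `𝒜` contribute to `[E_e,
  -- E_a]`.
  have h0 : ∀ c, VectorField.mlieBracket 𝓘(ℝ, E') (mulInvariantVectorField (b e))
      (tildeE (E := E') (M := G) b c) 1 = 0 := fun c => by
    rw [VectorField.mlieBracket_swap_apply]
    have h1 := mlieBracket_fundamental_eq_zero (M := G) (b c) (smoothAt_mulInvariantVectorField e (1 : G))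
      (Filter.Eventually.of_forall fun h => mulInvariantVectorField_smul (b e) h 1)
    exact (congrArg (fun v : E' => -v) h1).trans neg_zero
  have h1 : (⁅b e, b a⁆ : GroupLieAlgebra 𝓘(ℝ, E') G) =
      ∑ c, mvfderiv 𝓘(ℝ, E') (fun y : G => AdMatrix b y c a) 1 (b e : E') • b c := by
    rw [bracket_def, hL, mlieBracket_sum_smul_right (f := fun c y => AdMatrix b y c a)
      (fun c _ => contMDiffAt_AdMatrix 1 c a) (fun c _ => smoothAt_tildeE c 1)]
    refine Finset.sum_congr rfl fun c _ => ?_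
    rw [h0 c, smul_zero, zero_add]
    exact congrArg₂ (fun (r : ℝ) (v : E') => r • v)
      (congrArg (fun v : E' => mvfderiv 𝓘(ℝ, E') (fun y : G => AdMatrix b y c a) 1 v)
        (mulInvariantVectorField_one (b e))) (fundamental_one (b c))
  rw [structConst, h1]
  simp [Finsupp.single_apply]

theorem structConst_swap (a c e : Fin d) : structConst b a c e = -structConst b c a e := by
  have h : (⁅b a, b c⁆ : GroupLieAlgebra 𝓘(ℝ, E') G) = -⁅b c, b a⁆ := by
    rw [bracket_def, bracket_def]; exact VectorField.mlieBracket_swap_apply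
  rw [structConst, structConst, h, map_neg]; rfl

end StructureConstants

theorem AdMatrix_fib_partialX [FiniteDimensional ℝ E'] (hm : m ∈ Ψ.dom) (c a : Fin d) (i : Fin n) :
    mvfderiv 𝓘(ℝ, E) (fun y => AdMatrix b (Ψ.fib y) c a) m (Ψ.partialX i m) = 0 := by
  have h := mfderiv_comp_apply_of_eq (I := 𝓘(ℝ, Fin n → ℝ)) (I' := 𝓘(ℝ, E))
    (I'' := 𝓘(ℝ, ℝ)) (Ψ.coord m) (f := fun x => Ψ.map (x, Ψ.fib m))
    (g := fun y => AdMatrix b (Ψ.fib y) c a) (y := m)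
    ((contMDiffAt_AdMatrix_fib hm c a).mdifferentiableAt (by simp))
    (LocalTrivialization.mdifferentiableAt_map (LocalTrivialization.coord_mem hm) _)
    (LocalTrivialization.map_coord_fib hm) (Pi.single i (1 : ℝ) : Fin n → ℝ)
  refine Eq.trans h.symm ?_
  have h2 : ((fun y => AdMatrix b (Ψ.fib y) c a) ∘ fun x => Ψ.map (x, Ψ.fib m)) =ᶠ[nhds (Ψ.coord m)]
      fun _ => AdMatrix b (Ψ.fib m) c a := by
    filter_upwards [LocalTrivialization.base_mem_nhds (LocalTrivialization.coord_mem hm)] with x hx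
    simp only [Function.comp, LocalTrivialization.fib_map hx]
  have h3 := mvfderiv_congr (IN := 𝓘(ℝ, Fin n → ℝ)) h2
  refine (congrArg (fun A : (Fin n → ℝ) →L[ℝ] ℝ => A (Pi.single i (1 : ℝ))) h3).trans ?_
  exact congrArg (fun A : (Fin n → ℝ) →L[ℝ] ℝ => A (Pi.single i (1 : ℝ)))
    (mvfderiv_const (I := 𝓘(ℝ, Fin n → ℝ)) (x := Ψ.coord m) _)

/-- The direction `Ad h E_e` comes from the curve `h y h⁻¹`, and `𝒜(h y h⁻¹ h) = 𝒜(h) 𝒜(y)` reduces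
the derivative to that of `𝒜` at the identity. -/
theorem AdMatrix_fib_hatE [FiniteDimensional ℝ E'] (hm : m ∈ Ψ.dom) (c a e : Fin d) :
    mvfderiv 𝓘(ℝ, E) (fun y => AdMatrix b (Ψ.fib y) c a) m (hatE b Ψ e m) =
      ∑ f, AdMatrix b (Ψ.fib m) c f * structConst b e a f := by
  set h := Ψ.fib m with hh
  rw [hatE, mvfderiv_fundamental ((contMDiffAt_AdMatrix_fib hm c a).mdifferentiableAt (by simp))]
  have hA : ∀ (y : G) c a, MDifferentiableAt 𝓘(ℝ, E') 𝓘(ℝ, ℝ) (fun y => AdMatrix b y c a) y :=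
    fun y c a => (contMDiffAt_AdMatrix y c a).mdifferentiableAt (by simp)
  have h1 := mfderiv_comp_apply_of_eq (I := 𝓘(ℝ, E')) (I' := 𝓘(ℝ, E')) (I'' := 𝓘(ℝ, ℝ)) (1 : G)
    (f := fun y : G => h * y * h⁻¹) (g := fun y : G => AdMatrix b (y * h) c a) (y := 1)
    (MDifferentiableAt.comp (1 : G) (hA _ c a) (mdifferentiableAt_mul_right h 1))
    (mdifferentiableAt_conj h 1) (by simp) (b e)
  have h2 : (fun s : G => AdMatrix b (Ψ.fib (s • m)) c a) = fun y : G => AdMatrix b (y * h) c a := by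
    funext s; rw [LocalTrivialization.fib_smul hm]
  have h3 : ((fun y : G => AdMatrix b (y * h) c a) ∘ fun y : G => h * y * h⁻¹) =
      fun y => ∑ f, AdMatrix b h c f * AdMatrix b y f a := by
    funext y
    simp only [Function.comp, inv_mul_cancel_right, AdMatrix_mul]; rfl
  rw [h2]
  refine Eq.trans h1.symm ?_
  rw [h3]
  refine (mvfderiv_sum_apply Finset.univ (fun f _ => mdifferentiableAt_mul mdifferentiableAt_const (hA 1 f a))
    (b e : E')).trans (Finset.sum_congr rfl fun f _ => ?_)
  rw [mvfderiv_const_mul_apply _ (hA 1 f a), structConst_eq]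

/-! ### Quasi-velocities -/

/-- Translate from the section by `fib m`: the coordinate field is invariant and the connection form
is equivariant. -/
theorem conn_partialX (hg : IsInvariantMetric G g) (hgk : VerticalPartFrom g k) (hm : m ∈ Ψ.dom)
    (i : Fin n) : conn b g m (Ψ.partialX i m) =
      AdMatrix b (Ψ.fib m) *ᵥ fun a => connCoeff b g Ψ a i (Ψ.coord m) := by
  have hx := LocalTrivialization.coord_mem hm
  have hs := LocalTrivialization.sec_mem hx
  have h1 : (fun a => connCoeff b g Ψ a i (Ψ.coord m)) =
      conn b g (Ψ.sec (Ψ.coord m)) (Ψ.partialX i (Ψ.sec (Ψ.coord m))) := by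
    funext a
    rw [connCoeff, LocalTrivialization.fib_sec hx, AdMatrix_one, inv_one, Matrix.one_mulVec]
  rw [h1, ← conn_mfderiv_smul hg hgk]
  have h2 := LocalTrivialization.partialX_smul hs (Ψ.fib m) i
  have h3 : ∀ {y : M} (hy : y = m), conn b g m (Ψ.partialX i m) = conn b g y (Ψ.partialX i y) := by
    rintro y rfl; rfl
  rw [h3 (LocalTrivialization.fib_smul_sec hm)]
  exact congrArg (fun v : TangentSpace 𝓘(ℝ, E) (Ψ.fib m • Ψ.sec (Ψ.coord m)) => conn b g _ v) h2

theorem sum_smul_hatE (w : Fin d → ℝ) (m : M) :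
    (∑ a, w a • hatE b Ψ a m : TangentSpace 𝓘(ℝ, E) m) =
      ∑ c, (AdMatrix b (Ψ.fib m) *ᵥ w) c • tildeE b c m := by
  simp only [hatE_eq_sum, Finset.smul_sum, smul_smul, Matrix.mulVec, dotProduct, Finset.sum_smul]
  rw [Finset.sum_comm]
  exact Finset.sum_congr rfl fun i _ => Finset.sum_congr rfl fun j _ => by rw [mul_comm]

theorem frameX_eq (hg : IsInvariantMetric G g) (hgk : VerticalPartFrom g k) (hm : m ∈ Ψ.dom)
    (i : Fin n) : frameX b g Ψ i m =
      Ψ.partialX i m - ∑ a, connCoeff b g Ψ a i (Ψ.coord m) • hatE b Ψ a m := by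
  rw [frameX, sum_smul_hatE, conn_partialX hg hgk hm]

theorem velA_eq (p : TM E M) : (fun a => velA b g a p) =
    AdMatrix b (Ψ.fib p.1) *ᵥ fun a => velW b g Ψ a p := by
  have : (fun a => velW b g Ψ a p) = (AdMatrix b (Ψ.fib p.1))⁻¹ *ᵥ (fun a' => velA b g a' p) := rfl
  rw [this, Matrix.mulVec_mulVec, Matrix.mul_nonsing_inv _ (isUnit_AdMatrix _), Matrix.one_mulVec]

theorem velV_eq (i : Fin n) (p : TM E M) :
    velV Ψ i p = mvfderiv 𝓘(ℝ, E) Ψ.coord p.1 p.2 i := rfl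

theorem sum_frameX_add_tildeE (hgk : VerticalPartFrom g k) (hm : m ∈ Ψ.dom)
    (u : TangentSpace 𝓘(ℝ, E) m) :
    u = (∑ i, mvfderiv 𝓘(ℝ, E) Ψ.coord m u i • frameX b g Ψ i m) +
      ∑ a, conn b g m u a • tildeE b a m := by
  have h1 : mvfderiv 𝓘(ℝ, E) Ψ.coord m
      (u - ∑ i, mvfderiv 𝓘(ℝ, E) Ψ.coord m u i • frameX b g Ψ i m) = 0 := by
    rw [map_sub, map_sum, sub_eq_zero]
    funext j
    simp [mvfderiv_coord_frameX hm, Pi.single_apply]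
  have h2 := sum_conn_smul_tildeE (b := b) hgk hm h1
  have h3 : conn b g m (u - ∑ i, mvfderiv 𝓘(ℝ, E) Ψ.coord m u i • frameX b g Ψ i m) =
      conn b g m u := by
    rw [conn_sub, sub_eq_self]
    funext a
    rw [conn_sum_smul]
    simp [conn_frameX hgk]
  rw [h3] at h2
  exact sub_eq_iff_eq_add'.1 h2

theorem vel_decomp (hgk : VerticalPartFrom g k) {p : TM E M} (hp : p.1 ∈ Ψ.dom) :
    p.2 = (∑ i, velV Ψ i p • frameX b g Ψ i p.1) + ∑ a, velA b g a p • tildeE b a p.1 :=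
  sum_frameX_add_tildeE hgk hp p.2

theorem vel_decomp' (hgk : VerticalPartFrom g k) {p : TM E M} (hp : p.1 ∈ Ψ.dom) :
    p.2 = (∑ i, velV Ψ i p • frameX b g Ψ i p.1) + ∑ a, velW b g Ψ a p • hatE b Ψ a p.1 := by
  rw [sum_smul_hatE, ← velA_eq]
  exact vel_decomp hgk hp

end Action

section Action
variable {E E' : Type*} [NormedAddCommGroup E] [NormedSpace ℝ E]
  [NormedAddCommGroup E'] [NormedSpace ℝ E']
  {M : Type*} [TopologicalSpace M] [ChartedSpace E M] [IsManifold 𝓘(ℝ, E) ∞ M]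
  {G : Type*} [TopologicalSpace G] [ChartedSpace E' G] [Group G] [LieGroup 𝓘(ℝ, E') ∞ G]
  [MulAction G M] [ContMDiffSMul 𝓘(ℝ, E') 𝓘(ℝ, E) ∞ G M]
  {n d : ℕ} {b : Module.Basis (Fin d) ℝ (GroupLieAlgebra 𝓘(ℝ, E') G)} {g : Metric E M}
  {k : Metric E' G} {Ψ : LocalTrivialization E E' M G n} {m : M}

/-! ### The reduced metric -/

theorem inner_frameX (hg : IsInvariantMetric G g) (hgk : VerticalPartFrom g k) (hm : m ∈ Ψ.dom)
    (i j : Fin n) :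
    g.inner m (frameX b g Ψ i m) (frameX b g Ψ j m) = redMetric b g Ψ (Ψ.coord m) i j := by
  have hs := LocalTrivialization.sec_mem (LocalTrivialization.coord_mem hm)
  have h3 : ∀ {y : M} (_ : y = m), g.inner m (frameX b g Ψ i m) (frameX b g Ψ j m) =
      g.inner y (frameX b g Ψ i y) (frameX b g Ψ j y) := by rintro y rfl; rfl
  rw [h3 (LocalTrivialization.fib_smul_sec hm), redMetric,
    ← hg (Ψ.fib m) (Ψ.sec (Ψ.coord m))]
  exact congrArg₂ (fun u v : TangentSpace 𝓘(ℝ, E) (Ψ.fib m • Ψ.sec (Ψ.coord m)) => g.inner _ u v)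
    (frameX_smul hg hgk hs _ i) (frameX_smul hg hgk hs _ j)

theorem redMetric_symm (x : Fin n → ℝ) (i j : Fin n) :
    redMetric b g Ψ x i j = redMetric b g Ψ x j i := g.symm _ _ _

/-- The `X_i` are independent because they project to the standard basis of `ℝⁿ`. -/
theorem isUnit_redMetric {x : Fin n → ℝ} (hx : x ∈ Ψ.base) : IsUnit (redMetric b g Ψ x).det := by
  have hm := LocalTrivialization.sec_mem hx
  refine isUnit_det_gram (V := TangentSpace 𝓘(ℝ, E) (Ψ.sec x)) (B := g.inner (Ψ.sec x))
    (fun v hv => g.pos _ v hv) (v := fun i => frameX b g Ψ i (Ψ.sec x)) ?_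
  refine LinearIndependent.of_comp (mvfderiv 𝓘(ℝ, E) Ψ.coord (Ψ.sec x)).toLinearMap ?_
  have : ((mvfderiv 𝓘(ℝ, E) Ψ.coord (Ψ.sec x)).toLinearMap ∘ fun i => frameX b g Ψ i (Ψ.sec x)) =
      Pi.basisFun ℝ (Fin n) := by
    funext i
    rw [Pi.basisFun_apply]
    exact mvfderiv_coord_frameX hm i
  rw [this]
  exact (Pi.basisFun ℝ (Fin n)).linearIndependent

theorem differentiableAt_redMetric (hgk : VerticalPartFrom g k) {x : Fin n → ℝ} (hx : x ∈ Ψ.base)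
    (i j : Fin n) : DifferentiableAt ℝ (fun y => redMetric b g Ψ y i j) x := by
  rw [← mdifferentiableAt_iff_differentiableAt]
  have hm := LocalTrivialization.sec_mem hx
  have h := (contMDiffAt_inner_field g (smoothAt_frameX (b := b) (g := g) hgk hm i)
    (smoothAt_frameX (b := b) (g := g) hgk hm j)).mdifferentiableAt (by simp)
  exact h.comp x (LocalTrivialization.mdifferentiableAt_sec hx)

theorem mdifferentiableAt_redMetric_coord (hgk : VerticalPartFrom g k) (hm : m ∈ Ψ.dom)
    (i j : Fin n) :
    MDifferentiableAt 𝓘(ℝ, E) 𝓘(ℝ, ℝ) (fun y => redMetric b g Ψ (Ψ.coord y) i j) m :=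
  (differentiableAt_redMetric hgk (LocalTrivialization.coord_mem hm) i j).mdifferentiableAt.comp m
    (LocalTrivialization.mdifferentiableAt_coord hm)

theorem fderiv_apply_eq_sum {f : (Fin n → ℝ) → ℝ} (x v : Fin n → ℝ) :
    fderiv ℝ f x v = ∑ l, fderiv ℝ f x (Pi.single l (1 : ℝ)) * v l := by
  conv_lhs => rw [← Finset.univ_sum_single v]
  rw [map_sum]
  refine Finset.sum_congr rfl fun l _ => ?_
  rw [show (Pi.single l (v l) : Fin n → ℝ) = v l • Pi.single l (1 : ℝ) by
    rw [← Pi.single_smul]; simp, map_smul, smul_eq_mul, mul_comm]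

theorem mvfderiv_redMetric_coord (hgk : VerticalPartFrom g k) (hm : m ∈ Ψ.dom) (i j : Fin n)
    (u : TangentSpace 𝓘(ℝ, E) m) :
    mvfderiv 𝓘(ℝ, E) (fun y => redMetric b g Ψ (Ψ.coord y) i j) m u =
      ∑ l, dRedMetric b g Ψ l i j (Ψ.coord m) * mvfderiv 𝓘(ℝ, E) Ψ.coord m u l := by
  have hd := differentiableAt_redMetric (b := b) hgk (LocalTrivialization.coord_mem hm) i j
  rw [mvfderiv_comp_apply_vec (f := Ψ.coord) (h := fun y => redMetric b g Ψ y i j)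
    hd.mdifferentiableAt (LocalTrivialization.mdifferentiableAt_coord hm)]
  refine Eq.trans ?_ (fderiv_apply_eq_sum (f := fun y => redMetric b g Ψ y i j) (Ψ.coord m)
    (mvfderiv 𝓘(ℝ, E) Ψ.coord m u))
  exact congrArg (fun A : (Fin n → ℝ) →L[ℝ] ℝ => A (mvfderiv 𝓘(ℝ, E) Ψ.coord m u))
    (mfderiv_eq_fderiv (f := fun y => redMetric b g Ψ y i j) (x := Ψ.coord m))

theorem hMetric_eq (hk : IsBiInvariant k) (hgk : VerticalPartFrom g k) (x : Fin n → ℝ) :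
    hMetric b g Ψ x = lieGram b k :=
  funext fun a => funext fun c => inner_hatE hk hgk (Ψ.sec x) a c

/-- Ad-invariance of `k` as a matrix identity, in the form needed to trade `R` and `v^a` for `K` and
`w^a`. -/
theorem hMetric_eq_mul (hk : IsBiInvariant k) (hgk : VerticalPartFrom g k) (x : Fin n → ℝ) (h : G) :
    hMetric b g Ψ x = (AdMatrix b h)ᵀ * lieGram b k * AdMatrix b h := by
  rw [hMetric_eq hk hgk]
  ext a c
  have h1 : ∀ e, (Ad h (b e) : GroupLieAlgebra 𝓘(ℝ, E') G) = ∑ f, AdMatrix b h f e • b f := fun e =>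
    (b.sum_repr _).symm
  have h2 := inner_Ad hk h (b a) (b c)
  refine Eq.trans h2.symm ?_
  rw [h1 a, h1 c]
  simp only [map_sum, map_smul, ContinuousLinearMap.sum_apply, ContinuousLinearMap.smul_apply,
    smul_eq_mul, Matrix.mul_apply, Matrix.transpose_apply, Finset.sum_mul, lieGram, Finset.mul_sum]
  exact Finset.sum_congr rfl fun i _ => Finset.sum_congr rfl fun j _ => by ring

theorem invariance_on_dom (hg : IsInvariantMetric G g) (hk : IsBiInvariant k)
    (hgk : VerticalPartFrom g k) (hm : m ∈ Ψ.dom) :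
    (∀ i j, g.inner m (frameX b g Ψ i m) (frameX b g Ψ j m)
      = redMetric b g Ψ (Ψ.coord m) i j) ∧
    (∀ a c, g.inner m (hatE b Ψ a m) (hatE b Ψ c m) = hMetric b g Ψ (Ψ.coord m) a c) ∧
    (∀ i, frameX b g Ψ i m
      = Ψ.partialX i m - ∑ a, connCoeff b g Ψ a i (Ψ.coord m) • hatE b Ψ a m) ∧
    (∀ i j, VectorField.mlieBracket 𝓘(ℝ, E) (frameX b g Ψ i) (frameX b g Ψ j) m
      = ∑ a, curv b g Ψ i j m a • tildeE b a m) ∧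
    (∀ i j a, curvK b g Ψ i j m a = redK b g Ψ a i j (Ψ.coord m)) :=
  ⟨fun i j => inner_frameX hg hgk hm i j,
    fun a c => (inner_hatE hk hgk m a c).trans (congrFun (congrFun (hMetric_eq hk hgk _) a) c).symm,
    fun i => frameX_eq hg hgk hm i, fun i j => mlieBracket_frameX hgk hm i j,
    fun i j a => curvK_eq hg hgk hm i j a⟩

end Action

section Action
variable {E E' : Type*} [NormedAddCommGroup E] [NormedSpace ℝ E]
  [NormedAddCommGroup E'] [NormedSpace ℝ E']
  {M : Type*} [TopologicalSpace M] [ChartedSpace E M] [IsManifold 𝓘(ℝ, E) ∞ M]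
  {G : Type*} [TopologicalSpace G] [ChartedSpace E' G] [Group G] [LieGroup 𝓘(ℝ, E') ∞ G]
  [MulAction G M] [ContMDiffSMul 𝓘(ℝ, E') 𝓘(ℝ, E) ∞ G M]
  {n d : ℕ} {b : Module.Basis (Fin d) ℝ (GroupLieAlgebra 𝓘(ℝ, E') G)} {g : Metric E M}
  {k : Metric E' G} {Ψ : LocalTrivialization E E' M G n} {m : M}

/-! ### Quasi-velocities as functions on the tangent manifold -/

theorem contMDiffAt_velV {p : TM E M} (hp : p.1 ∈ Ψ.dom) (i : Fin n) :
    ContMDiffAt 𝓘(ℝ, E).tangent 𝓘(ℝ, ℝ) ∞ (velV Ψ i) p := by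
  have h1 : ContMDiffAt (𝓘(ℝ, E).tangent.prod 𝓘(ℝ, E)) 𝓘(ℝ, Fin n → ℝ) ∞
      (Function.uncurry fun (_ : TM E M) (y : M) => Ψ.coord y) (p, p.1) :=
    ContMDiffAt.comp (p, p.1) (g := Ψ.coord) (f := Prod.snd)
      (LocalTrivialization.contMDiffAt_coord hp) contMDiffAt_snd
  have h2 := contMDiffAt_mvfderiv_vec (f := fun (_ : TM E M) (y : M) => Ψ.coord y)
    (s := fun q : TM E M => q.1) (v := fun q => q.2) h1 contMDiffAt_id
  have h3 : ContMDiff 𝓘(ℝ, Fin n → ℝ) 𝓘(ℝ, ℝ) ∞ (fun x : Fin n → ℝ => x i) :=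
    (ContinuousLinearMap.proj (R := ℝ) (φ := fun _ : Fin n => ℝ) i).contMDiff
  exact h3.contMDiffAt.comp p h2

theorem mdifferentiableAt_velV {p : TM E M} (hp : p.1 ∈ Ψ.dom) (i : Fin n) :
    MDifferentiableAt 𝓘(ℝ, E).tangent 𝓘(ℝ, ℝ) (velV Ψ i) p :=
  (contMDiffAt_velV hp i).mdifferentiableAt (by simp)

theorem velA_eq_sum (hgk : VerticalPartFrom g k) (a : Fin d) :
    velA b g a = fun q : TM E M => ∑ c, (lieGram b k)⁻¹ a c * flat g (tildeE b c) q := by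
  funext q
  rw [velA, conn, vertGram_eq hgk]
  show ∑ c, (lieGram b k)⁻¹ a c * g.inner q.1 q.2 (tildeE b c q.1) = _
  rfl

theorem mdifferentiableAt_flat_tildeE (a : Fin d) (p : TM E M) :
    MDifferentiableAt 𝓘(ℝ, E).tangent 𝓘(ℝ, ℝ) (flat g (tildeE b a)) p :=
  mdifferentiableAt_flat g (smoothAt_tildeE a p.1)

theorem mdifferentiableAt_velA (hgk : VerticalPartFrom g k) (a : Fin d) (p : TM E M) :
    MDifferentiableAt 𝓘(ℝ, E).tangent 𝓘(ℝ, ℝ) (velA b g a) p := by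
  rw [velA_eq_sum hgk]
  exact mdifferentiableAt_sum _ fun c _ =>
    mdifferentiableAt_mul mdifferentiableAt_const (mdifferentiableAt_flat_tildeE c p)

theorem mvfderiv_velA (hgk : VerticalPartFrom g k) (p : TM E M)
    (ζ : TangentSpace 𝓘(ℝ, E).tangent p) :
    (fun a => mvfderiv 𝓘(ℝ, E).tangent (velA b g a) p ζ) =
      (lieGram b k)⁻¹ *ᵥ fun a => mvfderiv 𝓘(ℝ, E).tangent (flat g (tildeE b a)) p ζ := by
  funext a
  rw [velA_eq_sum hgk, mvfderiv_sum_apply _ fun c _ =>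
    mdifferentiableAt_mul mdifferentiableAt_const (mdifferentiableAt_flat_tildeE c p)]
  exact Finset.sum_congr rfl fun c _ =>
    mvfderiv_const_mul_apply _ (mdifferentiableAt_flat_tildeE c p) ζ

theorem lieGram_mulVec_velA (hgk : VerticalPartFrom g k) (p : TM E M) :
    (lieGram b k *ᵥ fun a => velA b g a p) = fun a => flat g (tildeE b a) p := by
  have := vertGram_mulVec_conn (b := b) hgk p.2
  rw [vertGram_eq hgk] at this
  exact this

theorem AdMatrix_inv (h : G) : (AdMatrix b h)⁻¹ = AdMatrix b h⁻¹ :=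
  Matrix.inv_eq_right_inv (by rw [← AdMatrix_mul, mul_inv_cancel, AdMatrix_one])

theorem mdifferentiableAt_comp_proj {f : M → ℝ} {p : TM E M}
    (hf : MDifferentiableAt 𝓘(ℝ, E) 𝓘(ℝ, ℝ) f p.1) :
    MDifferentiableAt 𝓘(ℝ, E).tangent 𝓘(ℝ, ℝ) (fun q : TM E M => f q.1) p :=
  MDifferentiableAt.comp p (g := f) hf (mdifferentiableAt_proj (TangentSpace 𝓘(ℝ, E)))

theorem mvfderiv_comp_proj {f : M → ℝ} {p : TM E M}
    (hf : MDifferentiableAt 𝓘(ℝ, E) 𝓘(ℝ, ℝ) f p.1) (ζ : TangentSpace 𝓘(ℝ, E).tangent p) :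
    mvfderiv 𝓘(ℝ, E).tangent (fun q : TM E M => f q.1) p ζ = mvfderiv 𝓘(ℝ, E) f p.1 (ζ : E × E).1 := by
  rw [mvfderiv_comp_apply_vec (f := fun q : TM E M => q.1) hf
    (mdifferentiableAt_proj (TangentSpace 𝓘(ℝ, E)))]
  exact congrArg (fun v : E => mvfderiv 𝓘(ℝ, E) f p.1 v) (mfderiv_proj_apply p ζ)

theorem mdifferentiableAt_AdMatrix_fib [FiniteDimensional ℝ E'] (hm : m ∈ Ψ.dom) (c a : Fin d) :
    MDifferentiableAt 𝓘(ℝ, E) 𝓘(ℝ, ℝ) (fun y : M => AdMatrix b (Ψ.fib y) c a) m :=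
  (contMDiffAt_AdMatrix_fib hm c a).mdifferentiableAt (by simp)

theorem mdifferentiableAt_velW [FiniteDimensional ℝ E'] (hgk : VerticalPartFrom g k) {p : TM E M}
    (hp : p.1 ∈ Ψ.dom) (a : Fin d) :
    MDifferentiableAt 𝓘(ℝ, E).tangent 𝓘(ℝ, ℝ) (velW b g Ψ a) p := by
  have h : velW b g Ψ a = fun q : TM E M => ∑ c, AdMatrix b (Ψ.fib q.1)⁻¹ a c * velA b g c q := by
    funext q; rw [velW, AdMatrix_inv]; rfl
  rw [h]
  refine mdifferentiableAt_sum _ fun c _ => mdifferentiableAt_mul ?_ (mdifferentiableAt_velA hgk c p)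
  have h1 : ContMDiffAt 𝓘(ℝ, E) 𝓘(ℝ, E') ∞ (fun y => (Ψ.fib y)⁻¹) p.1 :=
    (LocalTrivialization.contMDiffAt_fib hp).inv
  have h2 := (contMDiffAt_AdMatrix (b := b) (Ψ.fib p.1)⁻¹ a c).comp p.1 h1
  exact mdifferentiableAt_comp_proj (f := fun y => AdMatrix b (Ψ.fib y)⁻¹ a c)
    (h2.mdifferentiableAt (by simp))

/-- The derivative of the adjoint matrices along a tangent vector. -/
theorem mvfderiv_AdMatrix_fib [FiniteDimensional ℝ E'] (hg : IsInvariantMetric G g)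
    (hgk : VerticalPartFrom g k) {p : TM E M} (hp : p.1 ∈ Ψ.dom) (c a : Fin d) :
    mvfderiv 𝓘(ℝ, E) (fun y => AdMatrix b (Ψ.fib y) c a) p.1 p.2 =
      ∑ f, AdMatrix b (Ψ.fib p.1) c f * ∑ e, structConst b e a f *
        (velW b g Ψ e p - ∑ i, velV Ψ i p * connCoeff b g Ψ e i (Ψ.coord p.1)) := by
  -- Substituting `X_i = ∂/∂xⁱ - γ_i^e Ê_e` makes the `Ê_e`-coefficient `w^e - v^i γ_i^e`; along
  -- `∂/∂xⁱ` the adjoint matrix does not vary.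
  have h1 : p.2 = (∑ i, velV Ψ i p • Ψ.partialX i p.1) + ∑ e,
      (velW b g Ψ e p - ∑ i, velV Ψ i p * connCoeff b g Ψ e i (Ψ.coord p.1)) • hatE b Ψ e p.1 := by
    refine (vel_decomp' (b := b) (g := g) hgk hp).trans ?_
    simp only [frameX_eq hg hgk hp, smul_sub, sub_smul, Finset.sum_sub_distrib, Finset.smul_sum,
      smul_smul, Finset.sum_smul]
    rw [Finset.sum_comm (f := fun i e => (velV Ψ i p * connCoeff b g Ψ e i (Ψ.coord p.1)) • hatE b Ψ e p.1)]
    abel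
  have h2 := congrArg (fun v => mvfderiv 𝓘(ℝ, E) (fun y => AdMatrix b (Ψ.fib y) c a) p.1 v) h1
  refine h2.trans ?_
  simp only [map_add, map_sum, map_smul, AdMatrix_fib_partialX hp, AdMatrix_fib_hatE hp, mul_zero,
    Finset.sum_const_zero, zero_add, smul_eq_mul, Finset.mul_sum]
  rw [Finset.sum_comm]
  exact Finset.sum_congr rfl fun i _ => Finset.sum_congr rfl fun j _ => by ring

/-- The covariant derivative of `w` that occurs in Wong's equations. -/
def wongW (b : Module.Basis (Fin d) ℝ (GroupLieAlgebra 𝓘(ℝ, E') G)) (g : Metric E M)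
    (Ψ : LocalTrivialization E E' M G n) (p : TM E M) (ζ : TangentSpace 𝓘(ℝ, E).tangent p) : Fin d → ℝ :=
  fun a => mvfderiv 𝓘(ℝ, E).tangent (velW b g Ψ a) p ζ +
    ∑ j, ∑ c, redGamma b g Ψ a j c (Ψ.coord p.1) * velV Ψ j p * velW b g Ψ c p

/-- The structure constants are antisymmetric in their lower indices, while `w^e w^a` is symmetric.
-/
theorem sum_structConst_velW (f : Fin d) (w : Fin d → ℝ) :
    ∑ a, (∑ e, structConst b e a f * w e) * w a = 0 := by
  have h : ∑ a, (∑ e, structConst b e a f * w e) * w a =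
      -∑ a, (∑ e, structConst b e a f * w e) * w a := by
    simp only [Finset.sum_mul]
    conv_lhs => rw [Finset.sum_comm]
    rw [← Finset.sum_neg_distrib]
    refine Finset.sum_congr rfl fun i _ => ?_
    rw [← Finset.sum_neg_distrib]
    exact Finset.sum_congr rfl fun j _ => by rw [structConst_swap]; ring
  linarith

theorem sum_sum_mul_comm {ι κ : Type*} [Fintype ι] [Fintype κ] (A : ι → ℝ) (X : ι → κ → ℝ)
    (w : κ → ℝ) : ∑ a, (∑ f, A f * X f a) * w a = ∑ f, A f * ∑ a, X f a * w a := by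
  simp only [Finset.sum_mul, Finset.mul_sum, mul_assoc]
  exact Finset.sum_comm

/-- Product rule for `v^c = 𝒜^c_a w^a`. Because `ζ` projects to the velocity, `𝒜` is differentiated
along `p.2`; its contribution quadratic in `w` vanishes and the one containing `γ` completes the
covariant derivative. -/
theorem mvfderiv_velA_eq_wongW [FiniteDimensional ℝ E'] (hg : IsInvariantMetric G g)
    (hgk : VerticalPartFrom g k) {p : TM E M} (hp : p.1 ∈ Ψ.dom)
    {ζ : TangentSpace 𝓘(ℝ, E).tangent p} (hζ : (ζ : E × E).1 = p.2) :
    (fun a => mvfderiv 𝓘(ℝ, E).tangent (velA b g a) p ζ) =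
      AdMatrix b (Ψ.fib p.1) *ᵥ wongW b g Ψ p ζ := by
  funext c
  have h1 : velA b g c = fun q : TM E M => ∑ a, AdMatrix b (Ψ.fib q.1) c a * velW b g Ψ a q :=
    funext fun q => congrFun (velA_eq q) c
  have hA := fun a => mdifferentiableAt_comp_proj (mdifferentiableAt_AdMatrix_fib (b := b) hp c a)
  have hW := fun a => mdifferentiableAt_velW (b := b) hgk hp a
  have h2 : mvfderiv 𝓘(ℝ, E).tangent (velA b g c) p ζ =
      ∑ a, (mvfderiv 𝓘(ℝ, E) (fun y => AdMatrix b (Ψ.fib y) c a) p.1 p.2 * velW b g Ψ a p +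
        AdMatrix b (Ψ.fib p.1) c a * mvfderiv 𝓘(ℝ, E).tangent (velW b g Ψ a) p ζ) := by
    rw [h1, mvfderiv_sum_apply _ fun a _ => mdifferentiableAt_mul (hA a) (hW a)]
    refine Finset.sum_congr rfl fun a _ => ?_
    rw [mvfderiv_mul_apply (hA a) (hW a), mvfderiv_comp_proj (mdifferentiableAt_AdMatrix_fib hp c a)]
    exact congrArg (fun v : E => mvfderiv 𝓘(ℝ, E) (fun y => AdMatrix b (Ψ.fib y) c a) p.1 v *
      velW b g Ψ a p + AdMatrix b (Ψ.fib p.1) c a * mvfderiv 𝓘(ℝ, E).tangent (velW b g Ψ a) p ζ) hζ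
  rw [h2]
  simp only [mvfderiv_AdMatrix_fib hg hgk hp]
  set A := AdMatrix b (Ψ.fib p.1)
  set w := fun a => velW b g Ψ a p
  set v := fun i => velV Ψ i p
  set dw := fun a => mvfderiv 𝓘(ℝ, E).tangent (velW b g Ψ a) p ζ
  set γ := fun e i => connCoeff b g Ψ e i (Ψ.coord p.1)
  show ∑ a, ((∑ f, A c f * ∑ e, structConst b e a f * (w e - ∑ i, v i * γ e i)) * w a + A c a * dw a)
    = ∑ f, A c f * (dw f + ∑ j, ∑ a, (∑ e, γ e j * structConst b a e f) * v j * w a)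
  have h3 : ∀ f, ∑ a, (∑ e, structConst b e a f * (w e - ∑ i, v i * γ e i)) * w a =
      ∑ j, ∑ a, (∑ e, γ e j * structConst b a e f) * v j * w a := by
    intro f
    -- Swapping the lower indices of the structure constants absorbs the minus sign and gives the
    -- combination defining `redGamma`.
    have h5 : ∀ a e, structConst b e a f * (w e - ∑ i, v i * γ e i) =
        structConst b e a f * w e + ∑ j, γ e j * structConst b a e f * v j := by
      intro a e
      rw [mul_sub, sub_eq_add_neg, Finset.mul_sum, ← Finset.sum_neg_distrib]
      congr 1
      exact Finset.sum_congr rfl fun j _ => by rw [structConst_swap a e]; ring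
    have h4 : ∀ a, (∑ e, structConst b e a f * (w e - ∑ i, v i * γ e i)) * w a =
        (∑ e, structConst b e a f * w e) * w a +
          ∑ j, (∑ e, γ e j * structConst b a e f) * v j * w a := by
      intro a
      simp only [h5, Finset.sum_add_distrib, add_mul]
      rw [Finset.sum_comm]
      simp only [Finset.sum_mul]
    simp only [h4, Finset.sum_add_distrib, sum_structConst_velW, zero_add]
    rw [Finset.sum_comm]
  simp only [mul_add, Finset.sum_add_distrib, ← h3]
  rw [add_comm, sum_sum_mul_comm]

/-- Momentum is conserved exactly if the second group of Wong's equations holds. -/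
theorem mvfderiv_flat_tildeE_eq_zero_iff [FiniteDimensional ℝ E'] (hg : IsInvariantMetric G g)
    (hgk : VerticalPartFrom g k) {p : TM E M} (hp : p.1 ∈ Ψ.dom)
    {ζ : TangentSpace 𝓘(ℝ, E).tangent p} (hζ : (ζ : E × E).1 = p.2) :
    (∀ a, mvfderiv 𝓘(ℝ, E).tangent (flat g (tildeE b a)) p ζ = 0) ↔ wongW b g Ψ p ζ = 0 := by
  have h1 := mvfderiv_velA_eq_wongW (b := b) hg hgk hp hζ
  rw [mvfderiv_velA hgk] at h1
  constructor
  · intro h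
    have h2 : (fun a => mvfderiv 𝓘(ℝ, E).tangent (flat g (tildeE b a)) p ζ) = 0 := funext h
    rw [h2, Matrix.mulVec_zero] at h1
    have h3 := congrArg (fun v => (AdMatrix b (Ψ.fib p.1))⁻¹ *ᵥ v) h1
    simp only [Matrix.mulVec_mulVec, Matrix.nonsing_inv_mul _ (isUnit_AdMatrix (b := b) (Ψ.fib p.1)),
      Matrix.one_mulVec, Matrix.mulVec_zero] at h3
    exact h3.symm
  · intro h
    rw [h, Matrix.mulVec_zero] at h1
    have h3 := congrArg (fun v => lieGram b k *ᵥ v) h1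
    simp only [Matrix.mulVec_mulVec, Matrix.mul_nonsing_inv _ (isUnit_lieGram (b := b) (k := k)),
      Matrix.one_mulVec, Matrix.mulVec_zero] at h3
    exact congrFun h3

end Action

section Action
variable {E E' : Type*} [NormedAddCommGroup E] [NormedSpace ℝ E]
  [NormedAddCommGroup E'] [NormedSpace ℝ E']
  {M : Type*} [TopologicalSpace M] [ChartedSpace E M] [IsManifold 𝓘(ℝ, E) ∞ M]
  {G : Type*} [TopologicalSpace G] [ChartedSpace E' G] [Group G] [LieGroup 𝓘(ℝ, E') ∞ G]
  [MulAction G M] [ContMDiffSMul 𝓘(ℝ, E') 𝓘(ℝ, E) ∞ G M]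
  {n d : ℕ} {b : Module.Basis (Fin d) ℝ (GroupLieAlgebra 𝓘(ℝ, E') G)} {g : Metric E M}
  {k : Metric E' G} {Ψ : LocalTrivialization E E' M G n} {m : M}

/-! ### Complete lifts of the frame fields -/

/-- The combination of the `X_i` and the `Ê_a` with constant coefficients. -/
def hatField (b : Module.Basis (Fin d) ℝ (GroupLieAlgebra 𝓘(ℝ, E') G)) (g : Metric E M)
    (Ψ : LocalTrivialization E E' M G n) (v : Fin n → ℝ) (w : Fin d → ℝ) : VField E M := fun y =>
  (∑ i, v i • frameX b g Ψ i y) + ∑ a, w a • hatE b Ψ a y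

/-- The combination of the `X_i` and the `Ẽ_a` with constant coefficients. -/
def tildeField (b : Module.Basis (Fin d) ℝ (GroupLieAlgebra 𝓘(ℝ, E') G)) (g : Metric E M)
    (Ψ : LocalTrivialization E E' M G n) (v : Fin n → ℝ) (c : Fin d → ℝ) : VField E M := fun y =>
  (∑ i, v i • frameX b g Ψ i y) + ∑ a, c a • tildeE b a y

theorem smoothAt_hatField [FiniteDimensional ℝ E'] (hgk : VerticalPartFrom g k) (hm : m ∈ Ψ.dom)
    (v : Fin n → ℝ) (w : Fin d → ℝ) : SmoothAt (hatField b g Ψ v w) m :=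
  ContMDiffAt.add_section (SmoothAt.sum_const_smul fun i _ => smoothAt_frameX hgk hm i)
    (SmoothAt.sum_const_smul fun a _ => smoothAt_hatE hm a)

theorem smoothAt_tildeField (hgk : VerticalPartFrom g k) (hm : m ∈ Ψ.dom)
    (v : Fin n → ℝ) (c : Fin d → ℝ) : SmoothAt (tildeField b g Ψ v c) m :=
  ContMDiffAt.add_section (SmoothAt.sum_const_smul fun i _ => smoothAt_frameX hgk hm i)
    (SmoothAt.sum_const_smul fun a _ => smoothAt_tildeE a m)

theorem hatField_smul (hg : IsInvariantMetric G g) (hgk : VerticalPartFrom g k) (hm : m ∈ Ψ.dom)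
    (v : Fin n → ℝ) (w : Fin d → ℝ) (h : G) :
    (hatField b g Ψ v w (h • m) : E) =
      mfderiv 𝓘(ℝ, E) 𝓘(ℝ, E) (fun y : M => h • y) m (hatField b g Ψ v w m) := by
  let A : E →L[ℝ] E := mfderiv 𝓘(ℝ, E) 𝓘(ℝ, E) (fun y : M => h • y) m
  have h1 : ∀ i, (frameX b g Ψ i (h • m) : E) = A (frameX b g Ψ i m) :=
    fun i => frameX_smul hg hgk hm h i
  have h2 : ∀ a, (hatE b Ψ a (h • m) : E) = A (hatE b Ψ a m) := fun a => hatE_smul hm h a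
  let X : Fin n → E := fun i => frameX b g Ψ i (h • m)
  let Y : Fin d → E := fun a => hatE b Ψ a (h • m)
  let X' : Fin n → E := fun i => frameX b g Ψ i m
  let Y' : Fin d → E := fun a => hatE b Ψ a m
  show (∑ i, v i • X i) + ∑ a, w a • Y a = A ((∑ i, v i • X' i) + ∑ a, w a • Y' a)
  have h1' : X = fun i => A (X' i) := funext h1
  have h2' : Y = fun a => A (Y' a) := funext h2
  rw [h1', h2']
  simp only [map_add, map_sum, map_smul]

/-- The complete lift of a fundamental field annihilates the kinetic energy. -/
theorem along_clift_fundamental_kinetic (hg : IsInvariantMetric G g) {W : VField E M}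
    (hW : SmoothAt W m)
    (hinv : ∀ h : G, (W (h • m) : E) = mfderiv 𝓘(ℝ, E) 𝓘(ℝ, E) (fun y : M => h • y) m (W m))
    (ξ : GroupLieAlgebra 𝓘(ℝ, E') G) :
    along (clift (fundamental (E := E) ξ)) (kinetic g) (pt m (W m)) = 0 := by
  have hd : MDifferentiableAt 𝓘(ℝ, E) 𝓘(ℝ, ℝ) (fun y => 1 / 2 * g.inner y (W y) (W y)) m :=
    mdifferentiableAt_mul mdifferentiableAt_const
      ((contMDiffAt_inner_field g hW hW).mdifferentiableAt (by simp))
  rw [along_clift_kinetic g (smoothAt_fundamental ξ m) hW,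
    mlieBracket_fundamental_eq_zero ξ hW (Filter.Eventually.of_forall hinv), map_zero, sub_zero,
    mvfderiv_fundamental hd]
  have h : (fun h : G => 1 / 2 * g.inner (h • m) (W (h • m)) (W (h • m))) =
      fun _ => 1 / 2 * g.inner m (W m) (W m) := by
    funext h
    rw [← hg h m]
    exact congrArg (fun v : TangentSpace 𝓘(ℝ, E) (h • m) => 1 / 2 * g.inner (h • m) v v) (hinv h)
  rw [h, mvfderiv_const]
  rfl

theorem inner_tildeField (hg : IsInvariantMetric G g) (hgk : VerticalPartFrom g k) (hm : m ∈ Ψ.dom)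
    (v : Fin n → ℝ) (c : Fin d → ℝ) :
    g.inner m (tildeField b g Ψ v c m) (tildeField b g Ψ v c m) =
      (∑ i, ∑ j, v i * v j * redMetric b g Ψ (Ψ.coord m) i j) +
        ∑ a, ∑ e, c a * c e * lieGram b k a e := by
  have h1 : ∀ i a, g.inner m (frameX b g Ψ i m) (tildeE b a m) = 0 := fun i a =>
    inner_frameX_fundamental hgk m i (b a)
  have h2 : ∀ i a, g.inner m (tildeE b a m) (frameX b g Ψ i m) = 0 := fun i a =>
    (g.symm m _ _).trans (h1 i a)
  have h3 : ∀ a e, g.inner m (tildeE b a m) (tildeE b e m) = lieGram b k a e := fun a e =>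
    inner_fundamental hgk m _ _
  simp only [tildeField, map_add, map_sum, map_smul, ContinuousLinearMap.add_apply,
    ContinuousLinearMap.sum_apply, ContinuousLinearMap.smul_apply, smul_eq_mul, h1, h2, h3,
    inner_frameX hg hgk hm, mul_zero, Finset.sum_const_zero, add_zero, zero_add, Finset.mul_sum]
  congr 1 <;> rw [Finset.sum_comm] <;>
    exact Finset.sum_congr rfl fun i _ => Finset.sum_congr rfl fun j _ => by ring

theorem inner_tildeField_tildeE (hgk : VerticalPartFrom g k) (m : M)
    (v : Fin n → ℝ) (c : Fin d → ℝ) (e : Fin d) :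
    g.inner m (tildeField b g Ψ v c m) (tildeE b e m) = ∑ a, c a * lieGram b k a e := by
  have h1 : ∀ i a, g.inner m (frameX b g Ψ i m) (tildeE b a m) = 0 := fun i a =>
    inner_frameX_fundamental hgk m i (b a)
  have h3 : ∀ a e, g.inner m (tildeE b a m) (tildeE b e m) = lieGram b k a e := fun a e =>
    inner_fundamental hgk m _ _
  simp only [tildeField, map_add, map_sum, map_smul, ContinuousLinearMap.add_apply,
    ContinuousLinearMap.sum_apply, ContinuousLinearMap.smul_apply, smul_eq_mul, h1, h3,
    mul_zero, Finset.sum_const_zero, zero_add]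

theorem inner_tildeField_frameX (hg : IsInvariantMetric G g) (hgk : VerticalPartFrom g k)
    (hm : m ∈ Ψ.dom) (v : Fin n → ℝ) (c : Fin d → ℝ) (j : Fin n) :
    g.inner m (tildeField b g Ψ v c m) (frameX b g Ψ j m) =
      ∑ i, v i * redMetric b g Ψ (Ψ.coord m) i j := by
  have h2 : ∀ i a, g.inner m (tildeE b a m) (frameX b g Ψ i m) = 0 := fun i a =>
    (g.symm m _ _).trans (inner_frameX_fundamental hgk m i (b a))
  simp only [tildeField, map_add, map_sum, map_smul, ContinuousLinearMap.add_apply,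
    ContinuousLinearMap.sum_apply, ContinuousLinearMap.smul_apply, smul_eq_mul, h2,
    mul_zero, Finset.sum_const_zero, add_zero, inner_frameX hg hgk hm]

/-- As `[X_i, Ẽ_a] = 0`, only `[X_i, X_j]` contributes. With the `Ê_a` in place of the `Ẽ_a` this
would fail, since their coefficients `𝒜` vary along `X_i`. -/
theorem mlieBracket_frameX_tildeField [CompleteSpace E] (hg : IsInvariantMetric G g)
    (hgk : VerticalPartFrom g k) (hm : m ∈ Ψ.dom) (i : Fin n) (v : Fin n → ℝ) (c : Fin d → ℝ) :
    VectorField.mlieBracket 𝓘(ℝ, E) (frameX b g Ψ i) (tildeField b g Ψ v c) m =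
      ∑ a, (∑ j, v j * curv b g Ψ i j m a) • tildeE b a m := by
  have hX : ∀ j, SmoothAt (frameX b g Ψ j) m := fun j => smoothAt_frameX hgk hm j
  have hT : ∀ a, SmoothAt (E := E) (tildeE b a) m := fun a => smoothAt_tildeE a m
  have h1 : tildeField b g Ψ v c = (fun y => ∑ i, v i • frameX b g Ψ i y) +
    (fun y => ∑ a, c a • tildeE b a y) := rfl
  have h0 : ∀ a, VectorField.mlieBracket 𝓘(ℝ, E) (frameX b g Ψ i) (tildeE b a) m = 0 := fun a => by
    rw [VectorField.mlieBracket_swap_apply, mlieBracket_tildeE_frameX hg hgk hm, neg_zero]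
  rw [h1, VectorField.mlieBracket_add_right (SmoothAt.sum_const_smul fun j _ => hX j).mdiff
      (SmoothAt.sum_const_smul fun a _ => hT a).mdiff,
    mlieBracket_sum_const_smul_right (fun j _ => hX j),
    mlieBracket_sum_const_smul_right (fun a _ => hT a)]
  simp only [h0, smul_zero, Finset.sum_const_zero, add_zero, mlieBracket_frameX hgk hm,
    Finset.smul_sum, smul_smul, Finset.sum_smul]
  exact Finset.sum_comm

theorem tildeField_vel (hgk : VerticalPartFrom g k) {p : TM E M} (hp : p.1 ∈ Ψ.dom) :
    tildeField b g Ψ (fun i => velV Ψ i p) (fun a => velA b g a p) p.1 = p.2 :=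
  (vel_decomp hgk hp).symm

theorem hatField_vel (hgk : VerticalPartFrom g k) {p : TM E M} (hp : p.1 ∈ Ψ.dom) :
    hatField b g Ψ (fun i => velV Ψ i p) (fun a => velW b g Ψ a p) p.1 = p.2 :=
  (vel_decomp' hgk hp).symm

/-- The velocity is extended to the invariant field `hatField`, which commutes with `Ẽ_a` and has
constant length along orbits. -/
theorem along_clift_tildeE_kinetic [FiniteDimensional ℝ E'] (hg : IsInvariantMetric G g)
    (hgk : VerticalPartFrom g k) {p : TM E M} (hp : p.1 ∈ Ψ.dom) (a : Fin d) :
    along (clift (tildeE b a)) (kinetic g) p = 0 := by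
  have h := along_clift_fundamental_kinetic hg
    (smoothAt_hatField (b := b) hgk hp (fun i => velV Ψ i p) (fun a => velW b g Ψ a p))
    (fun h => hatField_smul hg hgk hp _ _ h) (b a)
  rw [hatField_vel hgk hp] at h
  exact h

/-- For the extension `tildeField` the length varies only through `g_{jl}(x)`, and pairing the
bracket with the velocity turns the curvature into its contraction with the momentum. -/
theorem along_clift_frameX_kinetic [CompleteSpace E] (hg : IsInvariantMetric G g)
    (hgk : VerticalPartFrom g k) {p : TM E M} (hp : p.1 ∈ Ψ.dom) (i : Fin n) :
    along (clift (frameX b g Ψ i)) (kinetic g) p =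
      1 / 2 * (∑ j, ∑ l, velV Ψ j p * velV Ψ l p * dRedMetric b g Ψ i j l (Ψ.coord p.1)) -
      ∑ a, (∑ j, velV Ψ j p * curv b g Ψ i j p.1 a) * flat g (tildeE b a) p := by
  set v := fun i => velV Ψ i p
  set c := fun a => velA b g a p
  have hp' : p = pt p.1 (tildeField b g Ψ v c p.1) := by rw [tildeField_vel hgk hp]
  have h := along_clift_kinetic g (smoothAt_frameX (b := b) (g := g) hgk hp i)
    (smoothAt_tildeField (b := b) hgk hp v c)
  rw [tildeField_vel hgk hp, mlieBracket_frameX_tildeField hg hgk hp] at h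
  refine h.trans (congrArg₂ (fun r s : ℝ => r - s) ?_ ?_)
  · have hev : (fun y => 1 / 2 * g.inner y (tildeField b g Ψ v c y) (tildeField b g Ψ v c y)) =ᶠ[nhds p.1]
        fun y => 1 / 2 * ((∑ i, ∑ j, v i * v j * redMetric b g Ψ (Ψ.coord y) i j) +
          ∑ a, ∑ e, c a * c e * lieGram b k a e) := by
      filter_upwards [LocalTrivialization.dom_mem_nhds hp] with y hy
      rw [inner_tildeField hg hgk hy]
    have hd : ∀ j l, MDifferentiableAt 𝓘(ℝ, E) 𝓘(ℝ, ℝ)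
        (fun y => v j * v l * redMetric b g Ψ (Ψ.coord y) j l) p.1 := fun j l =>
      mdifferentiableAt_mul mdifferentiableAt_const (mdifferentiableAt_redMetric_coord hgk hp j l)
    have hd1 : ∀ j, MDifferentiableAt 𝓘(ℝ, E) 𝓘(ℝ, ℝ)
        (fun y => ∑ l, v j * v l * redMetric b g Ψ (Ψ.coord y) j l) p.1 := fun j =>
      mdifferentiableAt_sum _ fun l _ => hd j l
    have hd2 : MDifferentiableAt 𝓘(ℝ, E) 𝓘(ℝ, ℝ)
        (fun y => ∑ j, ∑ l, v j * v l * redMetric b g Ψ (Ψ.coord y) j l) p.1 :=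
      mdifferentiableAt_sum _ fun j _ => hd1 j
    have hd3 : MDifferentiableAt 𝓘(ℝ, E) 𝓘(ℝ, ℝ)
        (fun y => (∑ j, ∑ l, v j * v l * redMetric b g Ψ (Ψ.coord y) j l) +
          ∑ a, ∑ e, c a * c e * lieGram b k a e) p.1 := hd2.add mdifferentiableAt_const
    rw [mvfderiv_congr hev, mvfderiv_const_mul_apply _ hd3,
      mvfderiv_add_apply hd2 mdifferentiableAt_const, mvfderiv_const]
    refine congrArg (fun r : ℝ => 1 / 2 * r) ?_
    refine (add_zero _).trans ?_
    rw [mvfderiv_sum_apply _ fun j _ => hd1 j]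
    refine Finset.sum_congr rfl fun j _ => ?_
    rw [mvfderiv_sum_apply _ fun l _ => hd j l]
    refine Finset.sum_congr rfl fun l _ => ?_
    rw [mvfderiv_const_mul_apply _ (mdifferentiableAt_redMetric_coord hgk hp j l),
      mvfderiv_redMetric_coord hgk hp, mvfderiv_coord_frameX hp]
    simp only [Pi.single_apply, mul_ite, mul_one, mul_zero, Finset.sum_ite_eq', Finset.mem_univ, if_true]
    rfl
  · rw [map_sum]
    refine Finset.sum_congr rfl fun a _ => ?_
    rw [map_smul]; rfl

/-- The pairing of `tildeField` with `Ẽ_e` is constant, so the bracket alone contributes. -/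
theorem along_clift_frameX_flat [CompleteSpace E] (hg : IsInvariantMetric G g)
    (hgk : VerticalPartFrom g k) {p : TM E M} (hp : p.1 ∈ Ψ.dom) (i : Fin n) (e : Fin d) :
    along (clift (frameX b g Ψ i)) (flat g (tildeE b e)) p =
      -∑ a, (∑ j, velV Ψ j p * curv b g Ψ i j p.1 a) * lieGram b k a e := by
  set v := fun i => velV Ψ i p
  set c := fun a => velA b g a p
  have h := along_clift_flat g (smoothAt_tildeE (b := b) e p.1)
    (smoothAt_frameX (b := b) (g := g) hgk hp i) (smoothAt_tildeField (b := b) hgk hp v c)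
  rw [tildeField_vel hgk hp, mlieBracket_frameX_tildeField hg hgk hp] at h
  refine h.trans ?_
  have h1 : (fun y => g.inner y (tildeField b g Ψ v c y) (tildeE b e y)) =
      fun _ => ∑ a, c a * lieGram b k a e := funext fun y => inner_tildeField_tildeE hgk y v c e
  rw [h1, mvfderiv_const]
  refine (zero_sub _).trans (congrArg (fun r : ℝ => -r) ?_)
  rw [map_sum, sum_apply]
  refine Finset.sum_congr rfl fun a _ => ?_
  rw [map_smul]
  exact congrArg (fun r : ℝ => _ * r) (inner_fundamental hgk p.1 (b a) (b e))

end Action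

section Action
variable {E E' : Type*} [NormedAddCommGroup E] [NormedSpace ℝ E]
  [NormedAddCommGroup E'] [NormedSpace ℝ E']
  {M : Type*} [TopologicalSpace M] [ChartedSpace E M] [IsManifold 𝓘(ℝ, E) ∞ M]
  {G : Type*} [TopologicalSpace G] [ChartedSpace E' G] [Group G] [LieGroup 𝓘(ℝ, E') ∞ G]
  [MulAction G M] [ContMDiffSMul 𝓘(ℝ, E') 𝓘(ℝ, E) ∞ G M]
  {n d : ℕ} {b : Module.Basis (Fin d) ℝ (GroupLieAlgebra 𝓘(ℝ, E') G)} {g : Metric E M}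
  {k : Metric E' G} {Ψ : LocalTrivialization E E' M G n} {m : M}

/-! ### The Euler-Lagrange equations in the adapted frame -/

/-- Near `p.1` every smooth field is a combination of the `X_i` and `Ẽ_a` with smooth coefficients
`dxⁱ(Z)` and `ω^a(Z)`, and the expression is tensorial. -/
theorem eulerLagrangeAt_iff_frame [CompleteSpace E] (hgk : VerticalPartFrom g k) {Γ : TMField E M}
    (hΓ : IsSecondOrder Γ) {p : TM E M} (hp : p.1 ∈ Ψ.dom) :
    EulerLagrangeAt (kinetic g) Γ p ↔
      (∀ i, eulerLagrange g Γ p (frameX b g Ψ i) = 0) ∧ ∀ a, eulerLagrange g Γ p (tildeE b a) = 0 := by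
  rw [eulerLagrangeAt_iff]
  constructor
  · exact fun h => ⟨fun i => h _ (smoothAt_frameX hgk hp i), fun a => h _ (smoothAt_tildeE a _)⟩
  · rintro ⟨h1, h2⟩ Z hZ
    have hdc : ∀ i : Fin n, ContMDiff 𝓘(ℝ, Fin n → ℝ) 𝓘(ℝ, ℝ) ∞ (fun x : Fin n → ℝ => x i) :=
      fun i => (ContinuousLinearMap.proj (R := ℝ) (φ := fun _ : Fin n => ℝ) i).contMDiff
    have h := eulerLagrange_sum_smul (ι := Fin n ⊕ Fin d) g hΓ
      (smoothAt_tildeField (b := b) hgk hp _ _) (tildeField_vel hgk hp)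
      (f := Sum.elim (fun i y => mvfderiv 𝓘(ℝ, E) Ψ.coord y (Z y) i) (fun a y => conn b g y (Z y) a))
      (Y := Sum.elim (frameX b g Ψ) (tildeE b)) (Z := Z) ?_ ?_ ?_
    · rw [h]
      refine Finset.sum_eq_zero fun s _ => ?_
      rcases s with i | a
      · simp [h1 i]
      · simp [h2 a]
    · rintro (i | a)
      · exact (hdc i).contMDiffAt.comp p.1
          (contMDiffAt_mvfderiv_field (LocalTrivialization.contMDiffAt_coord hp) hZ)
      · exact contMDiffAt_conn hgk hZ a
    · rintro (i | a)
      · exact smoothAt_frameX hgk hp i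
      · exact smoothAt_tildeE a _
    · filter_upwards [LocalTrivialization.dom_mem_nhds hp] with y hy
      rw [Fintype.sum_sum_type]
      exact sum_frameX_add_tildeE hgk hy (Z y)

theorem eulerLagrange_tildeE [FiniteDimensional ℝ E'] (hg : IsInvariantMetric G g)
    (hgk : VerticalPartFrom g k) (Γ : TMField E M) {p : TM E M} (hp : p.1 ∈ Ψ.dom) (a : Fin d) :
    eulerLagrange g Γ p (tildeE b a) = along Γ (flat g (tildeE b a)) p := by
  rw [eulerLagrange, along_clift_tildeE_kinetic hg hgk hp, sub_zero]

/-- The contraction `v^j R^a_{ij} p_a`. -/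
def curvForce (b : Module.Basis (Fin d) ℝ (GroupLieAlgebra 𝓘(ℝ, E') G)) (g : Metric E M)
    (Ψ : LocalTrivialization E E' M G n) (p : TM E M) (i : Fin n) : ℝ :=
  ∑ a, (∑ j, velV Ψ j p * curv b g Ψ i j p.1 a) * flat g (tildeE b a) p

theorem flat_frameX (hg : IsInvariantMetric G g) (hgk : VerticalPartFrom g k) {p : TM E M}
    (hp : p.1 ∈ Ψ.dom) (i : Fin n) :
    flat g (frameX b g Ψ i) p = ∑ j, velV Ψ j p * redMetric b g Ψ (Ψ.coord p.1) j i := by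
  have := inner_tildeField_frameX (b := b) hg hgk hp (fun i => velV Ψ i p) (fun a => velA b g a p) i
  rw [tildeField_vel hgk hp] at this
  exact this

/-- By orthogonality `g(u, X_i) = v^j g_{ji}(x)`, and a second-order field differentiates functions
of `x` along the velocity. -/
theorem along_flat_frameX (hg : IsInvariantMetric G g) (hgk : VerticalPartFrom g k)
    {Γ : TMField E M} (hΓ : IsSecondOrder Γ) {p : TM E M} (hp : p.1 ∈ Ψ.dom) (i : Fin n) :
    along Γ (flat g (frameX b g Ψ i)) p =
      ∑ j, (along Γ (velV Ψ j) p * redMetric b g Ψ (Ψ.coord p.1) j i +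
        velV Ψ j p * ∑ l, dRedMetric b g Ψ l j i (Ψ.coord p.1) * velV Ψ l p) := by
  have hpr : Filter.Tendsto (fun q : TM E M => q.1) (nhds p) (nhds p.1) :=
    (show MDifferentiableAt 𝓘(ℝ, E).tangent 𝓘(ℝ, E) (fun q : TM E M => q.1) p from
      mdifferentiableAt_proj (TangentSpace 𝓘(ℝ, E))).continuousAt
  have hev : flat g (frameX b g Ψ i) =ᶠ[nhds p]
      fun q => ∑ j, velV Ψ j q * redMetric b g Ψ (Ψ.coord q.1) j i := by
    filter_upwards [hpr.eventually (LocalTrivialization.dom_mem_nhds hp)] with q hq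
      using flat_frameX hg hgk hq i
  have hv := fun j => mdifferentiableAt_velV (Ψ := Ψ) hp j
  have hr := fun j => mdifferentiableAt_comp_proj
    (mdifferentiableAt_redMetric_coord (b := b) hgk hp j i)
  rw [along_eq, mvfderiv_congr hev, mvfderiv_sum_apply _ fun j _ => mdifferentiableAt_mul (hv j) (hr j)]
  refine Finset.sum_congr rfl fun j _ => ?_
  rw [mvfderiv_mul_apply (hv j) (hr j)]
  have h := along_comp_proj hΓ (mdifferentiableAt_redMetric_coord (b := b) hgk hp j i)
  rw [mvfderiv_redMetric_coord hgk hp] at h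
  exact congrArg₂ (fun r s : ℝ => r * redMetric b g Ψ (Ψ.coord p.1) j i + velV Ψ j p * s) rfl h

theorem eulerLagrange_frameX [CompleteSpace E] (hg : IsInvariantMetric G g)
    (hgk : VerticalPartFrom g k) {Γ : TMField E M} (hΓ : IsSecondOrder Γ) {p : TM E M}
    (hp : p.1 ∈ Ψ.dom) (i : Fin n) :
    eulerLagrange g Γ p (frameX b g Ψ i) =
      ∑ j, (along Γ (velV Ψ j) p * redMetric b g Ψ (Ψ.coord p.1) j i +
        velV Ψ j p * ∑ l, dRedMetric b g Ψ l j i (Ψ.coord p.1) * velV Ψ l p) -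
      (1 / 2 * (∑ j, ∑ l, velV Ψ j p * velV Ψ l p * dRedMetric b g Ψ i j l (Ψ.coord p.1)) -
        curvForce b g Ψ p i) := by
  rw [eulerLagrange, along_flat_frameX hg hgk hΓ hp, along_clift_frameX_kinetic hg hgk hp]
  rfl

theorem dRedMetric_symm (l i j : Fin n) (x : Fin n → ℝ) :
    dRedMetric b g Ψ l i j x = dRedMetric b g Ψ l j i x := by
  rw [dRedMetric, dRedMetric]
  simp only [redMetric_symm _ i j]

theorem curv_swap (i j : Fin n) (m : M) (a : Fin d) :
    curv b g Ψ i j m a = -curv b g Ψ j i m a := by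
  have h : conn b g m (-(VectorField.mlieBracket 𝓘(ℝ, E) (frameX b g Ψ j) (frameX b g Ψ i) m)) =
    -conn b g m (VectorField.mlieBracket 𝓘(ℝ, E) (frameX b g Ψ j) (frameX b g Ψ i) m) :=
    map_neg (connL b g m) _
  rw [curv, VectorField.mlieBracket_swap_apply, h]
  rfl

theorem curv_eq_mulVec (i j : Fin n) (m : M) :
    curv b g Ψ i j m = AdMatrix b (Ψ.fib m) *ᵥ curvK b g Ψ i j m := by
  rw [curvK, Matrix.mulVec_mulVec, Matrix.mul_nonsing_inv _ (isUnit_AdMatrix _), Matrix.one_mulVec]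

/-- With `R = 𝒜 K`, `p = k v` and `v = 𝒜 w`, the adjoint matrices combine into `𝒜ᵀ k 𝒜 = h`. -/
theorem curv_dotProduct_momentum (hg : IsInvariantMetric G g) (hk : IsBiInvariant k)
    (hgk : VerticalPartFrom g k) {p : TM E M} (hp : p.1 ∈ Ψ.dom) (i j : Fin n) :
    ∑ a, curv b g Ψ i j p.1 a * flat g (tildeE b a) p =
      ∑ a, ∑ c, hMetric b g Ψ (Ψ.coord p.1) a c * redK b g Ψ c i j (Ψ.coord p.1) * velW b g Ψ a p := by
  have hK : curvK b g Ψ i j p.1 = fun c => redK b g Ψ c i j (Ψ.coord p.1) :=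
    funext fun c => curvK_eq hg hgk hp i j c
  have hh : ∀ a c, hMetric b g Ψ (Ψ.coord p.1) a c = hMetric b g Ψ (Ψ.coord p.1) c a := fun a c =>
    g.symm _ _ _
  have h1 : (curv b g Ψ i j p.1) ⬝ᵥ (fun a => flat g (tildeE b a) p) =
      (fun c => redK b g Ψ c i j (Ψ.coord p.1)) ⬝ᵥ
        (hMetric b g Ψ (Ψ.coord p.1) *ᵥ fun a => velW b g Ψ a p) := by
    rw [hMetric_eq_mul hk hgk _ (Ψ.fib p.1), ← lieGram_mulVec_velA hgk, velA_eq (Ψ := Ψ),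
      curv_eq_mulVec, hK, ← Matrix.mulVec_mulVec, ← Matrix.mulVec_mulVec,
      Matrix.dotProduct_mulVec _ (AdMatrix b (Ψ.fib p.1))ᵀ, Matrix.vecMul_transpose]
  refine Eq.trans h1 ?_
  simp only [dotProduct, Matrix.mulVec, Finset.mul_sum]
  rw [Finset.sum_comm]
  exact Finset.sum_congr rfl fun a _ => Finset.sum_congr rfl fun c _ => by rw [hh a c]; ring

/-- The sign comes from exchanging the lower indices of the curvature: the free index is first in
`curvForce` and second in Wong's equations. -/
theorem curvForce_eq (hg : IsInvariantMetric G g) (hk : IsBiInvariant k)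
    (hgk : VerticalPartFrom g k) {p : TM E M} (hp : p.1 ∈ Ψ.dom) (i : Fin n) :
    curvForce b g Ψ p i = -∑ a, ∑ c, ∑ l, hMetric b g Ψ (Ψ.coord p.1) a c *
      redK b g Ψ c l i (Ψ.coord p.1) * velV Ψ l p * velW b g Ψ a p := by
  have h1 : curvForce b g Ψ p i = ∑ l, -velV Ψ l p *
      ∑ a, curv b g Ψ l i p.1 a * flat g (tildeE b a) p := by
    simp only [curvForce, Finset.sum_mul, Finset.mul_sum]
    rw [Finset.sum_comm]
    exact Finset.sum_congr rfl fun l _ => Finset.sum_congr rfl fun a _ => by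
      rw [curv_swap i l]; ring
  rw [h1]
  simp only [curv_dotProduct_momentum hg hk hgk hp, Finset.mul_sum, ← Finset.sum_neg_distrib]
  rw [Finset.sum_comm]
  refine Finset.sum_congr rfl fun a _ => ?_
  rw [Finset.sum_comm]
  exact Finset.sum_congr rfl fun c _ => Finset.sum_congr rfl fun l _ => by ring

/-- The purely algebraic relation between the two forms of the reduced equations. -/
theorem christoffel_algebra {g₀ : Matrix (Fin n) (Fin n) ℝ} (hdet : IsUnit g₀.det)
    (hsymm : ∀ i j, g₀ i j = g₀ j i) {D : Fin n → Fin n → Fin n → ℝ}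
    (hD : ∀ l i j, D l i j = D l j i) (acc v F : Fin n → ℝ) :
    (∀ i, ∑ j, (acc j * g₀ j i + v j * ∑ l, D l j i * v l) -
        (1 / 2 * (∑ j, ∑ l, v j * v l * D i j l) - -F i) = 0) ↔
      ∀ i, acc i + ∑ j, ∑ k, (1 / 2 * ∑ l, g₀⁻¹ i l * (D j l k + D k l j - D l j k)) * v j * v k =
        ∑ m, g₀⁻¹ i m * F m := by
  -- `B` is the Christoffel symbol of the first kind contracted with `v` twice; it arises by
  -- symmetrising `(∂g_{ji}/∂x^l) v^j v^l` in `j` and `l`.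
  set B : Fin n → ℝ := fun i => ∑ j, ∑ k, 1 / 2 * (D j i k + D k i j - D i j k) * v j * v k with hB
  have h1 : ∀ i, ∑ j, (acc j * g₀ j i + v j * ∑ l, D l j i * v l) -
      (1 / 2 * (∑ j, ∑ l, v j * v l * D i j l) - -F i) = (g₀ *ᵥ acc) i + B i - F i := by
    intro i
    have e1 : ∑ j, ∑ k, D j i k * v j * v k = ∑ j, ∑ k, D k i j * v j * v k := by
      rw [Finset.sum_comm]
      exact Finset.sum_congr rfl fun j _ => Finset.sum_congr rfl fun k _ => by ring
    have e2 : B i = 1 / 2 * (∑ j, ∑ k, D j i k * v j * v k) + 1 / 2 * (∑ j, ∑ k, D k i j * v j * v k) -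
        1 / 2 * (∑ j, ∑ k, v j * v k * D i j k) := by
      simp only [hB, Finset.mul_sum, ← Finset.sum_add_distrib, ← Finset.sum_sub_distrib]
      exact Finset.sum_congr rfl fun j _ => Finset.sum_congr rfl fun k _ => by ring
    have e3 : ∑ j, v j * ∑ l, D l j i * v l = ∑ j, ∑ k, D k i j * v j * v k := by
      simp only [Finset.mul_sum]
      exact Finset.sum_congr rfl fun j _ => Finset.sum_congr rfl fun k _ => by rw [hD k j i]; ring
    have e4 : ∑ j, acc j * g₀ j i = (g₀ *ᵥ acc) i :=
      Finset.sum_congr rfl fun j _ => by rw [hsymm j i, mul_comm]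
    rw [Finset.sum_add_distrib, e3, e4, e2, e1]
    ring
  have h2 : ∀ i, ∑ j, ∑ k, (1 / 2 * ∑ l, g₀⁻¹ i l * (D j l k + D k l j - D l j k)) * v j * v k =
      (g₀⁻¹ *ᵥ B) i := by
    intro i
    simp only [hB, Matrix.mulVec, dotProduct, Finset.mul_sum, Finset.sum_mul]
    symm
    rw [Finset.sum_comm]
    refine Finset.sum_congr rfl fun j _ => ?_
    rw [Finset.sum_comm]
    exact Finset.sum_congr rfl fun k _ => Finset.sum_congr rfl fun l _ => by ring
  have h3 : (∀ i, (g₀ *ᵥ acc) i + B i - F i = 0) ↔ g₀ *ᵥ acc + B = F := by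
    rw [funext_iff]
    exact forall_congr' fun i => sub_eq_zero
  have h4 : (∀ i, acc i + (g₀⁻¹ *ᵥ B) i = ∑ m, g₀⁻¹ i m * F m) ↔ acc + g₀⁻¹ *ᵥ B = g₀⁻¹ *ᵥ F := by
    rw [funext_iff]; rfl
  simp only [h1, h2, h3, h4]
  constructor
  · rintro rfl
    rw [Matrix.mulVec_add, Matrix.mulVec_mulVec, Matrix.nonsing_inv_mul _ hdet, Matrix.one_mulVec]
  · intro h
    have := congrArg (fun x => g₀ *ᵥ x) h
    simpa only [Matrix.mulVec_add, Matrix.mulVec_mulVec, Matrix.mul_nonsing_inv _ hdet,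
      Matrix.one_mulVec] using this

end Action

section Action
variable {E E' : Type*} [NormedAddCommGroup E] [NormedSpace ℝ E]
  [NormedAddCommGroup E'] [NormedSpace ℝ E']
  {M : Type*} [TopologicalSpace M] [ChartedSpace E M] [IsManifold 𝓘(ℝ, E) ∞ M]
  {G : Type*} [TopologicalSpace G] [ChartedSpace E' G] [Group G] [LieGroup 𝓘(ℝ, E') ∞ G]
  [MulAction G M] [ContMDiffSMul 𝓘(ℝ, E') 𝓘(ℝ, E) ∞ G M]
  {n d : ℕ} {b : Module.Basis (Fin d) ℝ (GroupLieAlgebra 𝓘(ℝ, E') G)} {g : Metric E M}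
  {k : Metric E' G} {Ψ : LocalTrivialization E E' M G n} {m : M}

theorem eulerLagrange_frameX_iff_wong [CompleteSpace E] (hg : IsInvariantMetric G g)
    (hk : IsBiInvariant k) (hgk : VerticalPartFrom g k) {Γ : TMField E M} (hΓ : IsSecondOrder Γ)
    {p : TM E M} (hp : p.1 ∈ Ψ.dom) :
    (∀ i, eulerLagrange g Γ p (frameX b g Ψ i) = 0) ↔
      ∀ i, along Γ (velV Ψ i) p
        + ∑ j, ∑ k, christoffel b g Ψ i j k (Ψ.coord p.1) * velV Ψ j p * velV Ψ k p
      = ∑ m, ∑ a, ∑ c, ∑ l, (redMetric b g Ψ (Ψ.coord p.1))⁻¹ i m *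
          hMetric b g Ψ (Ψ.coord p.1) a c * redK b g Ψ c l m (Ψ.coord p.1) * velV Ψ l p *
          velW b g Ψ a p := by
  have h := christoffel_algebra (isUnit_redMetric (b := b) (g := g) (LocalTrivialization.coord_mem hp))
    (redMetric_symm (b := b) (g := g) (Ψ := Ψ) (Ψ.coord p.1))
    (fun l i j => dRedMetric_symm (b := b) (g := g) (Ψ := Ψ) l i j (Ψ.coord p.1))
    (fun i => along Γ (velV Ψ i) p) (fun i => velV Ψ i p)
    (fun i => ∑ a, ∑ c, ∑ l, hMetric b g Ψ (Ψ.coord p.1) a c *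
      redK b g Ψ c l i (Ψ.coord p.1) * velV Ψ l p * velW b g Ψ a p)
  -- After this rewriting the force is `-F`, which accounts for the term `- -F i` in
  -- `christoffel_algebra`.
  simp only [eulerLagrange_frameX hg hgk hΓ hp, curvForce_eq hg hk hgk hp]
  refine h.trans (forall_congr' fun i => ?_)
  have hR : ∑ m, (redMetric b g Ψ (Ψ.coord p.1))⁻¹ i m * (∑ a, ∑ c, ∑ l,
        hMetric b g Ψ (Ψ.coord p.1) a c * redK b g Ψ c l m (Ψ.coord p.1) * velV Ψ l p *
          velW b g Ψ a p) =
      ∑ m, ∑ a, ∑ c, ∑ l, (redMetric b g Ψ (Ψ.coord p.1))⁻¹ i m *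
          hMetric b g Ψ (Ψ.coord p.1) a c * redK b g Ψ c l m (Ψ.coord p.1) * velV Ψ l p *
          velW b g Ψ a p := by
    simp only [Finset.mul_sum, mul_assoc]
  rw [hR]
  rfl

/-! ### The Routhian -/

theorem momentum_kinetic (a : Fin d) : momentum b (kinetic g) a = flat g (tildeE b a) :=
  along_vlift_kinetic g (tildeE b a)

theorem hessVert_kinetic (hgk : VerticalPartFrom g k) (p : TM E M) :
    hessVert b (kinetic g) p = lieGram b k := by
  funext a c
  rw [hessVert, momentum_kinetic, along_vlift_flat g _ (smoothAt_tildeE c p.1)]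
  exact inner_fundamental hgk p.1 _ _

theorem lieGram_inv_symm (a c : Fin d) : (lieGram b k)⁻¹ a c = (lieGram b k)⁻¹ c a := by
  have h : (lieGram b k)ᵀ = lieGram b k := by
    ext i j; exact lieGram_symm j i
  have h2 : ((lieGram b k)⁻¹)ᵀ = (lieGram b k)⁻¹ := by rw [Matrix.transpose_nonsing_inv, h]
  exact congrFun (congrFun h2 c) a

/-- Symmetry of the inverse Gram matrix moves it from `x` onto the momenta, where it produces the
`v^a`. -/
theorem sum_lieGram_inv_mulVec_mul (hgk : VerticalPartFrom g k) (p : TM E M) (x : Fin d → ℝ) :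
    ∑ a, ((lieGram b k)⁻¹ *ᵥ x) a * flat g (tildeE b a) p = ∑ a, velA b g a p * x a := by
  have h3 : ∀ a, velA b g a p = ∑ c, (lieGram b k)⁻¹ a c * flat g (tildeE b c) p := fun a =>
    congrFun (velA_eq_sum hgk a) p
  simp only [h3, Matrix.mulVec, dotProduct, Finset.sum_mul]
  rw [Finset.sum_comm]
  exact Finset.sum_congr rfl fun a _ => Finset.sum_congr rfl fun c _ => by
    rw [lieGram_inv_symm c a]; ring

theorem mdifferentiableAt_routhian_term (hgk : VerticalPartFrom g k) (a : Fin d) (p : TM E M) :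
    MDifferentiableAt 𝓘(ℝ, E).tangent 𝓘(ℝ, ℝ)
      (fun q => velA b g a q * flat g (tildeE b a) q) p :=
  mdifferentiableAt_mul (mdifferentiableAt_velA hgk a p) (mdifferentiableAt_flat_tildeE a p)

theorem routhian_kinetic : routhian b g (kinetic g) =
    fun q => kinetic g q - ∑ a, velA b g a q * flat g (tildeE b a) q := by
  funext q
  simp only [routhian, momentum_kinetic]

/-- Both halves of the derivative of `v^a p_a` equal `v^a dp_a`, because `v` and `p` are related by
a constant symmetric matrix; hence the factor 2. -/
theorem mvfderiv_routhian (hgk : VerticalPartFrom g k) (p : TM E M)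
    (ζ : TangentSpace 𝓘(ℝ, E).tangent p) :
    mvfderiv 𝓘(ℝ, E).tangent (routhian b g (kinetic g)) p ζ =
      mvfderiv 𝓘(ℝ, E).tangent (kinetic g) p ζ -
        2 * ∑ a, velA b g a p * mvfderiv 𝓘(ℝ, E).tangent (flat g (tildeE b a)) p ζ := by
  have ht := fun a => mdifferentiableAt_routhian_term (b := b) hgk a p
  rw [routhian_kinetic, mvfderiv_sub_apply (mdifferentiableAt_kinetic g p)
    (mdifferentiableAt_sum _ fun a _ => ht a), mvfderiv_sum_apply _ fun a _ => ht a]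
  set dp := fun a => mvfderiv 𝓘(ℝ, E).tangent (flat g (tildeE b a)) p ζ with hdp
  have h1 : ∀ a, mvfderiv 𝓘(ℝ, E).tangent (fun q => velA b g a q * flat g (tildeE b a) q) p ζ =
      ((lieGram b k)⁻¹ *ᵥ dp) a * flat g (tildeE b a) p + velA b g a p * dp a := fun a => by
    rw [mvfderiv_mul_apply (mdifferentiableAt_velA hgk a p) (mdifferentiableAt_flat_tildeE a p),
      ← mvfderiv_velA hgk]
  have h2 := sum_lieGram_inv_mulVec_mul (b := b) hgk p dp
  simp only [h1, Finset.sum_add_distrib, h2]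
  ring

theorem along_routhian (hgk : VerticalPartFrom g k) (V : TMField E M) (p : TM E M) :
    along V (routhian b g (kinetic g)) p = along V (kinetic g) p -
      2 * ∑ a, velA b g a p * along V (flat g (tildeE b a)) p :=
  mvfderiv_routhian hgk p (V p)

theorem along_vlift_tildeE_routhian (hgk : VerticalPartFrom g k) (p : TM E M) (a : Fin d) :
    along (vlift (tildeE b a)) (routhian b g (kinetic g)) p = -flat g (tildeE b a) p := by
  have h1 := congrFun (lieGram_mulVec_velA (b := b) hgk p) a
  have h2 : ∀ c, along (vlift (tildeE b a)) (flat g (tildeE b c)) p = lieGram b k a c := fun c => by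
    rw [along_vlift_flat g _ (smoothAt_tildeE c p.1)]
    exact inner_fundamental hgk p.1 _ _
  have h3 : ∑ c, velA b g c p * lieGram b k a c = flat g (tildeE b a) p := by
    refine Eq.trans (Finset.sum_congr rfl fun c _ => mul_comm _ _) h1
  rw [along_routhian hgk, along_vlift_kinetic]
  simp only [h2, h3]
  ring

/-- The correction by the `Ẽ_aⱽ` contributes `+ v^a W(p_a)`, which cancels one of the two copies
subtracted in `along_routhian`. -/
theorem along_tangentPart (hgk : VerticalPartFrom g k) (W : TMField E M) (p : TM E M) :
    along (tangentPart b (kinetic g) W) (routhian b g (kinetic g)) p =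
      along W (kinetic g) p - ∑ a, velA b g a p * along W (flat g (tildeE b a)) p := by
  set dp := fun a => along W (flat g (tildeE b a)) p with hdp
  have h0 : tangentPart b (kinetic g) W p = W p + ∑ a, (-((lieGram b k)⁻¹ *ᵥ dp) a) •
      vlift (tildeE b a) p := by
    rw [tangentPart, hessVert_kinetic hgk]
    simp only [momentum_kinetic]
    rfl
  have h1 : along (tangentPart b (kinetic g) W) (routhian b g (kinetic g)) p =
      along W (routhian b g (kinetic g)) p + ∑ a, (-((lieGram b k)⁻¹ *ᵥ dp) a) *
        along (vlift (tildeE b a)) (routhian b g (kinetic g)) p := by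
    rw [along_eq, h0, map_add, map_sum]
    simp only [map_smul]
    rfl
  have h2 := sum_lieGram_inv_mulVec_mul (b := b) hgk p dp
  rw [h1, along_routhian hgk]
  simp only [along_vlift_tildeE_routhian hgk, neg_mul_neg, h2]
  ring

/-- `X_i` is orthogonal to the orbits, so its vertical lift already annihilates the momenta. -/
theorem along_tangentPart_vlift_frameX (hgk : VerticalPartFrom g k) (i : Fin n) :
    along (tangentPart b (kinetic g) (vlift (frameX b g Ψ i))) (routhian b g (kinetic g)) =
      flat g (frameX b g Ψ i) := by
  funext q
  have h : ∀ a, along (vlift (frameX b g Ψ i)) (flat g (tildeE b a)) q = 0 := fun a => by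
    rw [along_vlift_flat g _ (smoothAt_tildeE a q.1)]
    exact inner_frameX_fundamental hgk q.1 i (b a)
  rw [along_tangentPart hgk, along_vlift_kinetic]
  simp only [h, mul_zero, Finset.sum_const_zero, sub_zero]

/-- The added term is `-v^e X_iᶜ(p_e)`. It cancels the curvature part of `X_iᶜ(L)`, leaving the
derivative of the reduced kinetic energy. -/
theorem along_tangentPart_clift_frameX [CompleteSpace E] (hg : IsInvariantMetric G g)
    (hgk : VerticalPartFrom g k) {p : TM E M} (hp : p.1 ∈ Ψ.dom) (i : Fin n) :
    along (tangentPart b (kinetic g) (clift (frameX b g Ψ i))) (routhian b g (kinetic g)) p =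
      along (clift (frameX b g Ψ i)) (kinetic g) p + curvForce b g Ψ p i := by
  have h3 : ∀ a, ∑ c, lieGram b k a c * velA b g c p = flat g (tildeE b a) p := fun a =>
    congrFun (lieGram_mulVec_velA (b := b) hgk p) a
  rw [along_tangentPart hgk, sub_eq_add_neg]
  congr 1
  simp only [along_clift_frameX_flat hg hgk hp, curvForce, ← h3, mul_neg, Finset.sum_neg_distrib,
    neg_neg, Finset.mul_sum]
  rw [Finset.sum_comm]
  exact Finset.sum_congr rfl fun a _ => Finset.sum_congr rfl fun c _ => by ring

/-- The level `μ` is forced to be the momentum at `p`; the right-hand side is then `-curvForce` and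
cancels the `curvForce` contained in `X̄_iᶜ(ℛ)`. -/
theorem routhAt_iff [CompleteSpace E] (hg : IsInvariantMetric G g)
    (hgk : VerticalPartFrom g k) (Γ : TMField E M) {p : TM E M} (hp : p.1 ∈ Ψ.dom) :
    (∀ μ : Fin d → ℝ, (∀ a, momentum b (kinetic g) a p = μ a) →
      RouthAt b g Ψ (kinetic g) Γ μ p) ↔ ∀ i, eulerLagrange g Γ p (frameX b g Ψ i) = 0 := by
  have h1 : (∀ μ : Fin d → ℝ, (∀ a, momentum b (kinetic g) a p = μ a) →
      RouthAt b g Ψ (kinetic g) Γ μ p) ↔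
      RouthAt b g Ψ (kinetic g) Γ (fun a => flat g (tildeE b a) p) p := by
    simp only [momentum_kinetic, ← funext_iff]
    exact ⟨fun h => h _ rfl, fun h μ hμ => hμ ▸ h⟩
  rw [h1]
  refine forall_congr' fun i => ?_
  have hS : ∑ a, ∑ j, flat g (tildeE b a) p * curv b g Ψ i j p.1 a * velV Ψ j p =
      curvForce b g Ψ p i := by
    simp only [curvForce, Finset.sum_mul]
    exact Finset.sum_congr rfl fun a _ => Finset.sum_congr rfl fun j _ => by ring
  rw [hS, along_tangentPart_vlift_frameX hgk, along_tangentPart_clift_frameX hg hgk hp,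
    eulerLagrange]
  constructor <;> intro h <;> linarith

theorem conserved_routh_iff_wong [CompleteSpace E] [FiniteDimensional ℝ E']
    (hg : IsInvariantMetric G g) (hk : IsBiInvariant k) (hgk : VerticalPartFrom g k)
    {Γ : TMField E M} (hΓ : IsSecondOrder Γ) {p : TM E M} (hp : p.1 ∈ Ψ.dom) :
    ((∀ a, along Γ (momentum b (kinetic g) a) p = 0) ∧
      ∀ μ : Fin d → ℝ, (∀ a, momentum b (kinetic g) a p = μ a) →
        RouthAt b g Ψ (kinetic g) Γ μ p) ↔ WongAt b g Ψ Γ p := by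
  have hΓ1 : (Γ p : E × E).1 = p.2 := (mfderiv_proj_apply p (Γ p)).symm.trans (hΓ p)
  rw [routhAt_iff hg hgk Γ hp, eulerLagrange_frameX_iff_wong hg hk hgk hΓ hp, and_comm]
  refine and_congr Iff.rfl ?_
  simp only [momentum_kinetic]
  exact (mvfderiv_flat_tildeE_eq_zero_iff hg hgk hp hΓ1).trans funext_iff

theorem eulerLagrangeAt_iff_conserved_routh [CompleteSpace E] [FiniteDimensional ℝ E']
    (hg : IsInvariantMetric G g) (hgk : VerticalPartFrom g k)
    {Γ : TMField E M} (hΓ : IsSecondOrder Γ) {p : TM E M} (hp : p.1 ∈ Ψ.dom) :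
    EulerLagrangeAt (kinetic g) Γ p ↔
      ((∀ a, along Γ (momentum b (kinetic g) a) p = 0) ∧
        ∀ μ : Fin d → ℝ, (∀ a, momentum b (kinetic g) a p = μ a) →
          RouthAt b g Ψ (kinetic g) Γ μ p) := by
  rw [eulerLagrangeAt_iff_frame (b := b) hgk hΓ hp, routhAt_iff hg hgk Γ hp, and_comm]
  simp only [momentum_kinetic, eulerLagrange_tildeE hg hgk Γ hp]

end Action

section Action
variable {E E' : Type*} [NormedAddCommGroup E] [NormedSpace ℝ E]
  [NormedAddCommGroup E'] [NormedSpace ℝ E']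
  {M : Type*} [TopologicalSpace M] [ChartedSpace E M] [IsManifold 𝓘(ℝ, E) ∞ M]
  {G : Type*} [TopologicalSpace G] [ChartedSpace E' G] [Group G] [LieGroup 𝓘(ℝ, E') ∞ G]
  [MulAction G M] [ContMDiffSMul 𝓘(ℝ, E') 𝓘(ℝ, E) ∞ G M]
  {n d : ℕ} {b : Module.Basis (Fin d) ℝ (GroupLieAlgebra 𝓘(ℝ, E') G)} {g : Metric E M}
  {k : Metric E' G} {Ψ : LocalTrivialization E E' M G n} {m : M}

/-! ### Curves -/

theorem hasDerivAt_comp_curve {f : TM E M → ℝ} {γ : ℝ → TM E M} {t : ℝ}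
    (hf : MDifferentiableAt 𝓘(ℝ, E).tangent 𝓘(ℝ, ℝ) f (γ t))
    (hγ : MDifferentiableAt 𝓘(ℝ, ℝ) 𝓘(ℝ, E).tangent γ t) :
    HasDerivAt (fun s => f (γ s))
      (mvfderiv 𝓘(ℝ, E).tangent f (γ t) (mfderiv 𝓘(ℝ, ℝ) 𝓘(ℝ, E).tangent γ t (1 : ℝ))) t := by
  have h : HasMFDerivAt 𝓘(ℝ, ℝ) 𝓘(ℝ, ℝ) (fun s => f (γ s)) t _ :=
    hf.hasMFDerivAt.comp t hγ.hasMFDerivAt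
  exact HasFDerivAt.hasDerivAt (𝕜 := ℝ) (F := ℝ) (hasMFDerivAt_iff_hasFDerivAt.1 h)

theorem hasDerivAt_coord_curve {c : ℝ → M} {t : ℝ} (hc : MDifferentiableAt 𝓘(ℝ, ℝ) 𝓘(ℝ, E) c t)
    (ht : c t ∈ Ψ.dom) :
    HasDerivAt (fun s => Ψ.coord (c s)) (fun i => velV Ψ i (velocity (E := E) c t)) t := by
  have h : HasMFDerivAt 𝓘(ℝ, ℝ) 𝓘(ℝ, Fin n → ℝ) (fun s => Ψ.coord (c s)) t _ :=
    (LocalTrivialization.mdifferentiableAt_coord ht).hasMFDerivAt.comp t hc.hasMFDerivAt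
  exact HasFDerivAt.hasDerivAt (𝕜 := ℝ) (F := Fin n → ℝ) (hasMFDerivAt_iff_hasFDerivAt.1 h)

theorem along_vlift_of_linear {f : TM E M → ℝ} {p : TM E M} {Z : VField E M}
    (hf : MDifferentiableAt 𝓘(ℝ, E).tangent 𝓘(ℝ, ℝ) f p)
    (hlin : ∀ s : ℝ, f (pt p.1 (p.2 + s • Z p.1)) = f p + s * f (pt p.1 (Z p.1))) :
    along (vlift Z) f p = f (pt p.1 (Z p.1)) := by
  rw [along_vlift_eq_deriv hf]
  simp only [hlin]
  simp

theorem velV_add_smul (i : Fin n) (m : M) (u z : TangentSpace 𝓘(ℝ, E) m) (s : ℝ) :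
    velV Ψ i (pt m (u + s • z)) = velV Ψ i (pt m u) + s * velV Ψ i (pt m z) := by
  simp only [velV_eq, map_add, map_smul]
  rfl

theorem velW_add_smul (a : Fin d) (m : M) (u z : TangentSpace 𝓘(ℝ, E) m) (s : ℝ) :
    velW b g Ψ a (pt m (u + s • z)) = velW b g Ψ a (pt m u) + s * velW b g Ψ a (pt m z) := by
  have h : conn b g m (u + s • z) = conn b g m u + s • conn b g m z :=
    ((connL b g m).map_add u (s • z)).trans
      (congrArg (fun x => conn b g m u + x) ((connL b g m).map_smul s z))
  show ((AdMatrix b (Ψ.fib m))⁻¹ *ᵥ conn b g m (u + s • z)) a = _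
  rw [h, Matrix.mulVec_add, Matrix.mulVec_smul]
  rfl

/-- Vectors tangent to the tangent manifold are determined by their projections and the
derivatives of the quasi-velocities. -/
theorem tangent_tangent_ext [FiniteDimensional ℝ E'] (hgk : VerticalPartFrom g k) {p : TM E M}
    (hp : p.1 ∈ Ψ.dom) {ζ ζ' : TangentSpace 𝓘(ℝ, E).tangent p}
    (h1 : (ζ : E × E).1 = (ζ' : E × E).1)
    (hv : ∀ i, mvfderiv 𝓘(ℝ, E).tangent (velV Ψ i) p ζ = mvfderiv 𝓘(ℝ, E).tangent (velV Ψ i) p ζ')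
    (hw : ∀ a, mvfderiv 𝓘(ℝ, E).tangent (velW b g Ψ a) p ζ =
      mvfderiv 𝓘(ℝ, E).tangent (velW b g Ψ a) p ζ') : ζ = ζ' := by
  let e : E := (ζ : E × E).2 - (ζ' : E × E).2
  -- Only the value at `p.1` matters for the vertical lift. The functions `v` and `w` are linear on
  -- fibres, so their derivatives along it are their values on `e`; if all of these vanish, so does
  -- `e`.
  let Z : VField E M := fun _ => e
  have hη : ζ - ζ' = vlift Z p := by
    rw [vlift_eq]
    exact Prod.ext (sub_eq_zero.2 h1) rfl
  have hv' : ∀ i, velV Ψ i (pt p.1 (Z p.1)) = 0 := fun i => by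
    rw [← along_vlift_of_linear (mdifferentiableAt_velV hp i) (fun s => velV_add_smul i p.1 p.2 _ s),
      along_eq, ← hη, map_sub, hv i, sub_self]
  have hw' : ∀ a, velW b g Ψ a (pt p.1 (Z p.1)) = 0 := fun a => by
    rw [← along_vlift_of_linear (mdifferentiableAt_velW hgk hp a)
      (fun s => velW_add_smul a p.1 p.2 _ s), along_eq, ← hη, map_sub, hw a, sub_self]
  have hZ := vel_decomp' (b := b) hgk (p := pt p.1 (Z p.1)) hp
  simp only [hv', hw', zero_smul, Finset.sum_const_zero, add_zero] at hZ
  have he : e = 0 := hZ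
  have h2 : (ζ : E × E).2 = (ζ' : E × E).2 := sub_eq_zero.1 he
  exact Prod.ext h1 h2

/-- The velocity is `v^i X_i + w^a Ê_a` with smooth frame fields along the curve, so
differentiability of `v` and `w` suffices. This recovers the regularity of `ċ` from that of a
solution of Wong's equations. -/
theorem mdifferentiableAt_velocity [FiniteDimensional ℝ E'] (hgk : VerticalPartFrom g k)
    {c : ℝ → M} {t : ℝ} (hc : MDifferentiableAt 𝓘(ℝ, ℝ) 𝓘(ℝ, E) c t) (ht : c t ∈ Ψ.dom)
    (hv : ∀ i, DifferentiableAt ℝ (fun s => velV Ψ i (velocity (E := E) c s)) t)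
    (hw : ∀ a, DifferentiableAt ℝ (fun s => velW b g Ψ a (velocity (E := E) c s)) t) :
    MDifferentiableAt 𝓘(ℝ, ℝ) 𝓘(ℝ, E).tangent (velocity (E := E) c) t := by
  rw [mdifferentiableAt_tm_iff]
  refine ⟨hc, ?_⟩
  have hfib : ∀ {Z : VField E M}, SmoothAt Z (c t) →
      DifferentiableAt ℝ (fun s => fibreCoord (c t) (pt (c s) (Z (c s)))) t := fun {Z} hZ => by
    rw [← mdifferentiableAt_iff_differentiableAt]
    exact MDifferentiableAt.comp t (g := fun y => fibreCoord (c t) (pt y (Z y)))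
      (mdifferentiableAt_tm_iff.1 hZ.mdiff).2 hc
  have hadd : ∀ (y : M), fibreCoord (c t) (pt y (0 : TangentSpace 𝓘(ℝ, E) y)) = 0 := fun y => by
    have := fibreCoord_smul (c t) y 0 (0 : TangentSpace 𝓘(ℝ, E) y)
    rwa [zero_smul, zero_smul] at this
  have hsum : ∀ {ι : Type} (S : Finset ι) (y : M) (r : ι → ℝ) (X : ι → TangentSpace 𝓘(ℝ, E) y),
      fibreCoord (c t) (pt y (∑ i ∈ S, r i • X i)) = ∑ i ∈ S, r i • fibreCoord (c t) (pt y (X i)) := by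
    intro ι S y r X
    classical
    induction S using Finset.induction_on with
    | empty => simpa using hadd y
    | insert i S hi ih =>
      rw [Finset.sum_insert hi, Finset.sum_insert hi, fibreCoord_add, fibreCoord_smul, ih]
  have hev : (fun s => fibreCoord (c t) (velocity (E := E) c s)) =ᶠ[nhds t] fun s =>
      (∑ i, velV Ψ i (velocity (E := E) c s) • fibreCoord (c t) (pt (c s) (frameX b g Ψ i (c s)))) +
        ∑ a, velW b g Ψ a (velocity (E := E) c s) • fibreCoord (c t) (pt (c s) (hatE b Ψ a (c s))) := by
    filter_upwards [hc.continuousAt.eventually (LocalTrivialization.dom_mem_nhds ht)] with s hs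
    rw [← hsum, ← hsum, ← fibreCoord_add]
    exact congrArg (fun u : TangentSpace 𝓘(ℝ, E) (c s) => fibreCoord (c t) (pt (c s) u))
      (vel_decomp' (b := b) hgk (p := velocity (E := E) c s) hs)
  refine MDifferentiableAt.congr_of_eventuallyEq ?_ hev
  apply DifferentiableAt.mdifferentiableAt
  refine DifferentiableAt.add ?_ ?_
  · exact DifferentiableAt.fun_sum fun i _ => (hv i).smul (hfib (smoothAt_frameX hgk ht i))
  · exact DifferentiableAt.fun_sum fun a _ => (hw a).smul (hfib (smoothAt_hatE ht a))

theorem mfderiv_velocity_fst {c : ℝ → M} {t : ℝ}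
    (hγ : MDifferentiableAt 𝓘(ℝ, ℝ) 𝓘(ℝ, E).tangent (velocity (E := E) c) t) :
    (mfderiv 𝓘(ℝ, ℝ) 𝓘(ℝ, E).tangent (velocity (E := E) c) t (1 : ℝ) : E × E).1 = (velocity (E := E) c t).2 :=
  congrArg Prod.fst (mfderiv_tm hγ (1 : ℝ))

/-- The base integral curves of the geodesic field are the solutions of Wong's equations. -/
theorem isMIntegralCurveOn_velocity_iff [CompleteSpace E] [FiniteDimensional ℝ E']
    (hg : IsInvariantMetric G g) (hk : IsBiInvariant k) (hgk : VerticalPartFrom g k)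
    {Γ : TMField E M} (hΓ : IsGeodesicField g Γ) {J : Set ℝ} {c : ℝ → M} (hJ : IsOpen J)
    (hc : ∀ t ∈ J, MDifferentiableAt 𝓘(ℝ, ℝ) 𝓘(ℝ, E) c t ∧ c t ∈ Ψ.dom) :
    IsMIntegralCurveOn (velocity (E := E) c) Γ J ↔
      ∀ t ∈ J, WongCurveAt b g Ψ (fun s => Ψ.coord (c s))
        (fun s a => velW b g Ψ a (velocity (E := E) c s)) t := by
  have hwong : ∀ t ∈ J, WongAt b g Ψ Γ (velocity (E := E) c t) := fun t ht =>
    (conserved_routh_iff_wong hg hk hgk hΓ.1 (hc t ht).2).1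
      ((eulerLagrangeAt_iff_conserved_routh hg hgk hΓ.1 (hc t ht).2).1 (hΓ.2 _))
  have hx : ∀ t ∈ J, deriv (fun s => Ψ.coord (c s)) t = fun i => velV Ψ i (velocity (E := E) c t) :=
    fun t ht => (hasDerivAt_coord_curve (hc t ht).1 (hc t ht).2).deriv
  -- Openness of `J` makes `ẋ = v` hold on a neighbourhood of `t`, so that `ẍ` is the derivative of
  -- `v`.
  have hxev : ∀ t ∈ J, deriv (fun s => Ψ.coord (c s)) =ᶠ[nhds t]
      fun s i => velV Ψ i (velocity (E := E) c s) := fun t ht => by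
    filter_upwards [hJ.mem_nhds ht] with s hs using hx s hs
  refine forall₂_congr fun t ht => ?_
  obtain ⟨hct, hdt⟩ := hc t ht
  have hiff : HasMFDerivWithinAt 𝓘(ℝ, ℝ) 𝓘(ℝ, E).tangent (velocity (E := E) c) J t
      ((1 : ℝ →L[ℝ] ℝ).smulRight (Γ (velocity (E := E) c t))) ↔
      MDifferentiableAt 𝓘(ℝ, ℝ) 𝓘(ℝ, E).tangent (velocity (E := E) c) t ∧
        mfderiv 𝓘(ℝ, ℝ) 𝓘(ℝ, E).tangent (velocity (E := E) c) t (1 : ℝ) = Γ (velocity (E := E) c t) := by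
    constructor
    · intro h
      have h' := h.hasMFDerivAt (hJ.mem_nhds ht)
      refine ⟨h'.mdifferentiableAt, ?_⟩
      rw [h'.mfderiv]
      exact one_smul ℝ (Γ (velocity (E := E) c t))
    · rintro ⟨h1, h2⟩
      have h3 : mfderiv 𝓘(ℝ, ℝ) 𝓘(ℝ, E).tangent (velocity (E := E) c) t =
          (1 : ℝ →L[ℝ] ℝ).smulRight (Γ (velocity (E := E) c t)) := by
        refine ContinuousLinearMap.ext_ring (h2.trans ?_)
        exact (one_smul ℝ (Γ (velocity (E := E) c t))).symm
      rw [← h3]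
      exact h1.hasMFDerivAt.hasMFDerivWithinAt
  refine hiff.trans ?_
  constructor
  · rintro ⟨hγ, hζ⟩
    have hv : HasDerivAt (fun s i => velV Ψ i (velocity (E := E) c s))
        (fun i => along Γ (velV Ψ i) (velocity (E := E) c t)) t := hasDerivAt_pi.2 fun i => by
      have := hasDerivAt_comp_curve (mdifferentiableAt_velV hdt i) hγ
      rwa [hζ] at this
    have hw : HasDerivAt (fun s a => velW b g Ψ a (velocity (E := E) c s))
        (fun a => along Γ (velW b g Ψ a) (velocity (E := E) c t)) t := hasDerivAt_pi.2 fun a => by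
      have := hasDerivAt_comp_curve (mdifferentiableAt_velW (b := b) hgk hdt a) hγ
      rwa [hζ] at this
    have hv' := hv.congr_of_eventuallyEq (hxev t ht)
    refine ⟨(hasDerivAt_coord_curve hct hdt).differentiableAt, hv'.differentiableAt,
      hw.differentiableAt, ?_, ?_⟩
    · rw [hv'.deriv, hx t ht]
      exact (hwong t ht).1
    · rw [hw.deriv, hx t ht]
      exact (hwong t ht).2
  · rintro ⟨-, hx2, hw, hW1, hW2⟩
    have hx2' := hx2.congr_of_eventuallyEq (hxev t ht).symm
    have hγ := mdifferentiableAt_velocity (b := b) hgk hct hdt (fun i => differentiableAt_pi.1 hx2' i)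
      (fun a => differentiableAt_pi.1 hw a)
    refine ⟨hγ, ?_⟩
    have hv : HasDerivAt (fun s i => velV Ψ i (velocity (E := E) c s)) _ t :=
      hasDerivAt_pi.2 fun i => hasDerivAt_comp_curve (mdifferentiableAt_velV hdt i) hγ
    have hwd : HasDerivAt (fun s a => velW b g Ψ a (velocity (E := E) c s)) _ t :=
      hasDerivAt_pi.2 fun a => hasDerivAt_comp_curve (mdifferentiableAt_velW (b := b) hgk hdt a) hγ
    rw [(hv.congr_of_eventuallyEq (hxev t ht)).deriv, hx t ht] at hW1
    rw [hwd.deriv, hx t ht] at hW2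
    -- The acceleration of `c` and the value of `Γ` satisfy Wong's equations with the same
    -- lower-order terms, so the derivatives of `v` and `w` along them agree.
    refine tangent_tangent_ext (b := b) hgk hdt ?_ ?_ ?_
    · exact (mfderiv_velocity_fst hγ).trans
        ((mfderiv_proj_apply _ (Γ (velocity (E := E) c t))).symm.trans (hΓ.1 _)).symm
    · intro i
      exact add_right_cancel ((hW1 i).trans ((hwong t ht).1 i).symm)
    · intro a
      exact add_right_cancel ((hW2 a).trans ((hwong t ht).2 a).symm)

end Action

end Routh

end

open Routh in
theorem mainTheorem9
    {E E' : Type*} [NormedAddCommGroup E] [NormedSpace ℝ E] [FiniteDimensional ℝ E]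
    [NormedAddCommGroup E'] [NormedSpace ℝ E'] [FiniteDimensional ℝ E']
    {M : Type*} [TopologicalSpace M] [T2Space M] [SecondCountableTopology M]
    [ChartedSpace E M] [IsManifold 𝓘(ℝ, E) ∞ M]
    {G : Type*} [TopologicalSpace G] [T2Space G] [SecondCountableTopology G]
    [ChartedSpace E' G] [Group G] [LieGroup 𝓘(ℝ, E') ∞ G] [ConnectedSpace G]
    [MulAction G M] [ContMDiffSMul 𝓘(ℝ, E') 𝓘(ℝ, E) ∞ G M] [ProperSMul G M]
    (hfree : ∀ (a : G) (m : M), a • m = m → a = 1)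
    (g : Metric E M) (hg : IsInvariantMetric G g)
    (k : Metric E' G) (hk : IsBiInvariant k) (hgk : VerticalPartFrom g k)
    {n d : ℕ} (b : Module.Basis (Fin d) ℝ (GroupLieAlgebra 𝓘(ℝ, E') G))
    (Ψ : LocalTrivialization E E' M G n) :
    -- the coefficients of Wong's equations are functions of `x` alone, and `h` is constant
    ((∀ m ∈ Ψ.dom,
        (∀ i j, g.inner m (frameX b g Ψ i m) (frameX b g Ψ j m)
          = redMetric b g Ψ (Ψ.coord m) i j) ∧
        (∀ a c, g.inner m (hatE b Ψ a m) (hatE b Ψ c m) = hMetric b g Ψ (Ψ.coord m) a c) ∧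
        (∀ i, frameX b g Ψ i m
          = Ψ.partialX i m - ∑ a, connCoeff b g Ψ a i (Ψ.coord m) • hatE b Ψ a m) ∧
        (∀ i j, VectorField.mlieBracket 𝓘(ℝ, E) (frameX b g Ψ i) (frameX b g Ψ j) m
          = ∑ a, curv b g Ψ i j m a • tildeE b a m) ∧
        (∀ i j a, curvK b g Ψ i j m a = redK b g Ψ a i j (Ψ.coord m))) ∧
      (∀ x ∈ Ψ.base, ∀ y ∈ Ψ.base, hMetric b g Ψ x = hMetric b g Ψ y)) ∧
    -- for second-order fields: the geodesic (Euler-Lagrange) equations amount to the generalized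
    -- Routh equations and momentum conservation, and these to Wong's equations
    (∀ Γ : TMField E M, IsSecondOrder Γ → ∀ p : TM E M, p.1 ∈ Ψ.dom →
      (EulerLagrangeAt (kinetic g) Γ p ↔
        ((∀ a, along Γ (momentum b (kinetic g) a) p = 0) ∧
          ∀ μ : Fin d → ℝ, (∀ a, momentum b (kinetic g) a p = μ a) →
            RouthAt b g Ψ (kinetic g) Γ μ p)) ∧
      (((∀ a, along Γ (momentum b (kinetic g) a) p = 0) ∧
          ∀ μ : Fin d → ℝ, (∀ a, momentum b (kinetic g) a p = μ a) →
            RouthAt b g Ψ (kinetic g) Γ μ p) ↔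
        WongAt b g Ψ Γ p)) ∧
    -- for curves: a curve over the chart domain is a base integral curve of the geodesic field
    -- if and only if its coordinates and quasi-velocities `(x, w)` satisfy Wong's equations
    (∀ Γ : TMField E M, IsGeodesicField g Γ →
      ∀ (J : Set ℝ) (c : ℝ → M), IsOpen J →
        (∀ t ∈ J, MDifferentiableAt 𝓘(ℝ, ℝ) 𝓘(ℝ, E) c t ∧ c t ∈ Ψ.dom) →
        (IsMIntegralCurveOn (velocity c) Γ J ↔
          ∀ t ∈ J, WongCurveAt b g Ψ (fun s => Ψ.coord (c s))
            (fun s a => velW b g Ψ a (velocity c s)) t)) := by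
  have : CompleteSpace E := FiniteDimensional.complete ℝ E
  exact ⟨⟨fun m hm => invariance_on_dom hg hk hgk hm,
      fun x _ y _ => (hMetric_eq hk hgk x).trans (hMetric_eq hk hgk y).symm⟩,
    fun Γ hΓ p hp => ⟨eulerLagrangeAt_iff_conserved_routh hg hgk hΓ hp,
      conserved_routh_iff_wong hg hk hgk hΓ hp⟩,
    fun Γ hΓ J c hJ hc => isMIntegralCurveOn_velocity_iff hg hk hgk hΓ hJ hc⟩
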